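/- Let $\Lambda\ge 3$ be an odd integer. There is a constant $D=D(\Lambda)>0$ such that the following holds. Let $\mathbb R^2$ be tiled by regular hexagons of side length $a>0$ (in any position), each divided into six equilateral triangles by the segments from its centre to its vertices. For $x\in\mathbb R^2$ let $c(x)$ be the centre of the hexagon to which $x$ belongs (points on the boundaries of hexagons being assigned measurably to one of the hexagons that contain them), let $f(x)=c(x)+\Lambda\,(x-c(x))$, and let $\mathcal F\mu(A)=\mu(f^{-1}(A))$ be the Perron–Frobenius operator of $f$ on measures. Denote by $g_s(x)=\frac{1}{2\pi s}e^{-|x|^2/(2s)}$ the density of the centred isotropic Gaussian measure on $\mathbb R^2$ with variance $s$ in each coordinate. Then: 1. If $\mu$ is a measure with a constant density on each of the triangles, then so is $\mathcal F\mu$; if moreover the density of $\mu$ is nonzero on only finitely many triangles, the same is true of $\mathcal F\mu$. 2. If $\mu_0$ is a probability measure with a constant density on each of the triangles, and $\rho_n$ is the density of $\mathcal F^n\mu_0$, then $n\,\|\rho_n-g_{Da^2n}\|_{L^\infty(\mathbb R^2)}\to 0$ as $n\to\infty$. 3. Normal deterministic diffusion occurs: for every probability measure $\mu_0$ on $\mathbb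 R^2$ that is absolutely continuous with respect to Lebesgue measure, all $\mathcal F^n\mu_0$ are absolutely continuous, and their densities $\rho_n$ satisfy $\|\rho_n-g_{Da^2n}\|_{L^1(\mathbb R^2)}\to 0$ as $n\to\infty$. -/

import Mathlib

open MeasureTheory Filter Topology
open scoped ENNReal NNReal

/-- The Euclidean plane `ℝ²`. -/
abbrev Plane : Type := EuclideanSpace ℝ (Fin 2)

/-- Counterclockwise rotation of the plane by 60 degrees about the origin. -/
noncomputable def rot60 (v : Plane) : Plane :=
  !₂[v 0 / 2 - Real.sqrt 3 / 2 * v 1, Real.sqrt 3 / 2 * v 0 + v 1 / 2]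

/-- The hexagon centres of the regular hexagonal tiling for which `o` is one of the centres and
`o + v` is a vertex of the hexagon around `o` (so that the side length is `‖v‖`). -/
noncomputable def hexCenter (o v : Plane) (p : ℤ × ℤ) : Plane :=
  o + (p.1 : ℝ) • (v + rot60 v) + (p.2 : ℝ) • (rot60 v + rot60 (rot60 v))

/-- The closed regular hexagon with centre `z` and a vertex at `z + v`. -/
noncomputable def hexagon (v z : Plane) : Set Plane :=
  convexHull ℝ (Set.range fun k : Fin 6 => z + rot60^[(k : ℕ)] v)

/-- Index of a triangle: the hexagon that contains it, and its position in that hexagon. -/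
abbrev TriangleIndex : Type := (ℤ × ℤ) × Fin 6

/-- The regular triangles into which the hexagons of the tiling are divided: each is spanned by
the centre of a hexagon and two adjacent vertices of it. -/
noncomputable def triangle (o v : Plane) (i : TriangleIndex) : Set Plane :=
  convexHull ℝ {hexCenter o v i.1,
    hexCenter o v i.1 + rot60^[(i.2 : ℕ)] v,
    hexCenter o v i.1 + rot60^[(i.2 : ℕ) + 1] v}

/-- `c` sends every point to the centre of the hexagon of the tiling to which it belongs. A point
on a common side of several hexagons may be assigned to any one of them, in a measurable way. -/
def IsHexCenterMap (o v : Plane) (c : Plane → Plane) : Prop :=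
  Measurable c ∧ ∀ x, ∃ p : ℤ × ℤ, c x = hexCenter o v p ∧ x ∈ hexagon v (hexCenter o v p)

/-- The map `x ↦ c(x) + Λ (x - c(x))`. -/
noncomputable def stretchMap (Λ : ℝ) (c : Plane → Plane) (x : Plane) : Plane :=
  c x + Λ • (x - c x)

/-- The Perron-Frobenius operator of `f`, acting on measures: `A ↦ μ (f ⁻¹' A)`. -/
noncomputable def perronFrobenius (f : Plane → Plane) (μ : Measure Plane) : Measure Plane :=
  μ.map f

/-- The measure which has the constant density `w i` on each triangle `i` of the tiling. -/
noncomputable def triangleMeasure (o v : Plane) (w : TriangleIndex → ℝ≥0) : Measure Plane :=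
  Measure.sum fun i => w i • (volume : Measure Plane).restrict (triangle o v i)

/-- The density of a measure with respect to Lebesgue measure. -/
noncomputable def density (μ : Measure Plane) (x : Plane) : ℝ :=
  (μ.rnDeriv volume x).toReal

/-- The density of the centred isotropic Gaussian measure on the plane whose coordinates have
variance `s`. -/
noncomputable def planarGaussian (s : ℝ) (x : Plane) : ℝ :=
  1 / (2 * Real.pi * s) * Real.exp (-‖x‖ ^ 2 / (2 * s))

/-! The grid of triangles is a Markov partition. Stretching a triangle by Λ about the centre of its
hexagon gives a union of Λ² grid triangles, so on densities constant on triangles the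
Perron–Frobenius operator is the transition operator of a Markov chain on triangles: from `(p, k)`
the chain moves to `(p + y, l)`, uniformly over the Λ² pairs with `y ∈ offsets Λ k l`. The
displacement law depends on the position `k` in the hexagon (the type) but not on `p`, so this is a
random walk on the lattice of centres driven by a chain on six types. Almost every point is interior
to a single triangle, so boundary conventions play no role.

A Fourier series over the lattice turns n steps into the n-th power of a 6 × 6 matrix `charOp Λ θ`.
Two facts carry the local limit theorem `exists_local_limit`. Away from zero, each stretched
triangle contains pairs of triangles of equal type whose displacements differ by two generators of
the lattice; partial cancellation gives the uniform bound exp(-c n |θ|²) on the whole dual cell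
(`norm_charOp_iterate_le`). Near zero, solutions of the Poisson equation for the type chain give an
approximate eigenvector with eigenvalue 1 - s²q/2 up to O(s³), and mixing of the types handles every
other vector (`exists_tendsto_charOp_iterate`). Dominated convergence in the Fourier inversion
formula then gives uniform convergence after multiplication by n. Invariance under rotation by 60
degrees makes the limiting covariance isotropic, and the decay bound makes it positive.

For a general density, log-Lipschitz functions are dense in L¹ and each step divides their constant
by Λ (`cellStep_iterate_le_exp_mul`), so after finitely many steps the density is nearly constant on
each triangle. Since the operator contracts L¹, this error does not grow, and uniform convergence
with a Scheffé argument gives convergence in L¹. -/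

/-! ### Lattice coordinates adapted to the hexagonal tiling. -/

/-- The six linear forms in lattice coordinates that bound the triangles of a hexagon. -/
def hexForm {R : Type*} [CommRing R] (k : Fin 6) (s t : R) : R :=
  ![s, s + t, t, -s, -s - t, -t] k

/-- The first coordinate of a vector with respect to the basis `v, rot60 v`. -/
noncomputable def coordS (v : Plane) : Plane →ₗ[ℝ] ℝ where
  toFun x := (x 0 * rot60 v 1 - x 1 * rot60 v 0) / (Real.sqrt 3 / 2 * (v 0 ^ 2 + v 1 ^ 2))
  map_add' x y := by simp only [PiLp.add_apply]; ring
  map_smul' r x := by simp only [PiLp.smul_apply, smul_eq_mul, RingHom.id_apply]; ring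

/-- The second coordinate of a vector with respect to the basis `v, rot60 v`. -/
noncomputable def coordT (v : Plane) : Plane →ₗ[ℝ] ℝ where
  toFun x := (v 0 * x 1 - v 1 * x 0) / (Real.sqrt 3 / 2 * (v 0 ^ 2 + v 1 ^ 2))
  map_add' x y := by simp only [PiLp.add_apply]; ring
  map_smul' r x := by simp only [PiLp.smul_apply, smul_eq_mul, RingHom.id_apply]; ring

theorem norm_sq_plane (v : Plane) : ‖v‖ ^ 2 = v 0 ^ 2 + v 1 ^ 2 := by
  rw [EuclideanSpace.norm_sq_eq]; simp [Fin.sum_univ_two]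

theorem rot60_rot60 (v : Plane) : rot60 (rot60 v) = rot60 v - v := by
  have h3 : Real.sqrt 3 * Real.sqrt 3 = 3 := Real.mul_self_sqrt (by norm_num)
  ext i
  fin_cases i
  · simp [rot60]; linear_combination (-(v 0) / 4) * h3
  · simp [rot60]; linear_combination (-(v 1) / 4) * h3

theorem rot60_add (v w : Plane) : rot60 (v + w) = rot60 v + rot60 w := by
  ext i; fin_cases i <;> simp [rot60] <;> ring

theorem rot60_neg (v : Plane) : rot60 (-v) = -rot60 v := by
  ext i; fin_cases i <;> simp [rot60] <;> ring

theorem rot60_sub (v w : Plane) : rot60 (v - w) = rot60 v - rot60 w := by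
  rw [sub_eq_add_neg, rot60_add, rot60_neg, sub_eq_add_neg]

theorem rot60_iterate (v : Plane) : rot60^[0] v = v ∧ rot60^[1] v = rot60 v ∧
    rot60^[2] v = rot60 v - v ∧ rot60^[3] v = -v ∧ rot60^[4] v = -rot60 v ∧
    rot60^[5] v = v - rot60 v ∧ rot60^[6] v = v := by
  have h2 : rot60^[2] v = rot60 v - v := by simp [rot60_rot60]
  have h3 : rot60^[3] v = -v := by
    rw [Function.iterate_succ_apply', h2, rot60_sub, rot60_rot60]; abel
  have h4 : rot60^[4] v = -rot60 v := by rw [Function.iterate_succ_apply', h3, rot60_neg]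
  have h5 : rot60^[5] v = v - rot60 v := by
    rw [Function.iterate_succ_apply', h4, rot60_neg, rot60_rot60]; abel
  have h6 : rot60^[6] v = v := by
    rw [Function.iterate_succ_apply', h5, rot60_sub, rot60_rot60]; abel
  exact ⟨rfl, rfl, h2, h3, h4, h5, h6⟩

theorem coord_det_ne {v : Plane} (hv : v ≠ 0) :
    Real.sqrt 3 / 2 * (v 0 ^ 2 + v 1 ^ 2) ≠ 0 := by
  have : 0 < ‖v‖ := norm_pos_iff.2 hv
  rw [← norm_sq_plane]; positivity

theorem det_rot60 (v : Plane) :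
    v 0 * rot60 v 1 - v 1 * rot60 v 0 = Real.sqrt 3 / 2 * (v 0 ^ 2 + v 1 ^ 2) := by
  simp [rot60]; ring

theorem coordS_self {v : Plane} (hv : v ≠ 0) : coordS v v = 1 := by
  have := coord_det_ne hv
  simp only [coordS, LinearMap.coe_mk, AddHom.coe_mk]
  rw [det_rot60, div_self this]

theorem coordS_rot60 (v : Plane) : coordS v (rot60 v) = 0 := by
  simp only [coordS, LinearMap.coe_mk, AddHom.coe_mk]
  rw [div_eq_zero_iff]; left; ring

theorem coordT_self (v : Plane) : coordT v v = 0 := by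
  simp only [coordT, LinearMap.coe_mk, AddHom.coe_mk]
  rw [div_eq_zero_iff]; left; ring

theorem coordT_rot60 {v : Plane} (hv : v ≠ 0) : coordT v (rot60 v) = 1 := by
  have := coord_det_ne hv
  simp only [coordT, LinearMap.coe_mk, AddHom.coe_mk]
  rw [det_rot60, div_self this]

theorem coord_expand {v : Plane} (hv : v ≠ 0) (x : Plane) :
    x = coordS v x • v + coordT v x • rot60 v := by
  have := coord_det_ne hv
  have hd := det_rot60 v
  ext i
  simp only [coordS, coordT, LinearMap.coe_mk, AddHom.coe_mk, PiLp.add_apply, PiLp.smul_apply,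
      smul_eq_mul]
  generalize Real.sqrt 3 / 2 * (v 0 ^ 2 + v 1 ^ 2) = d at this hd ⊢
  fin_cases i
  · field_simp
    simp only [← hd, Fin.zero_eta]
    ring
  · field_simp
    simp only [← hd, Fin.mk_one]
    ring

theorem norm_sq_coord {v : Plane} (hv : v ≠ 0) (x : Plane) :
    ‖x‖ ^ 2 = ‖v‖ ^ 2 * (coordS v x ^ 2 + coordS v x * coordT v x + coordT v x ^ 2) := by
  have h3 : Real.sqrt 3 * Real.sqrt 3 = 3 := Real.mul_self_sqrt (by norm_num)
  have h := coord_expand hv x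
  generalize coordS v x = s at h ⊢
  generalize coordT v x = t at h ⊢
  rw [h, norm_sq_plane, norm_sq_plane]
  simp [rot60]
  linear_combination (t ^ 2 * (v 0 ^ 2 + v 1 ^ 2) / 4) * h3

/-- In the basis `v`, `rot60 v` the centres are the integer points (s, t) with s ≡ t mod 3, a
sublattice of index three in the integer points. This reduces the later case analyses to integer
arithmetic. -/
theorem hexCenter_eq (o v : Plane) (p : ℤ × ℤ) :
    hexCenter o v p = o + ((p.1 - p.2 : ℤ) : ℝ) • v + ((p.1 + 2 * p.2 : ℤ) : ℝ) • rot60 v := by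
  rw [hexCenter, rot60_rot60]
  push_cast
  module

theorem coordS_center {v : Plane} (hv : v ≠ 0) (o : Plane) (p : ℤ × ℤ) :
    coordS v (hexCenter o v p - o) = ((p.1 - p.2 : ℤ) : ℝ) := by
  rw [hexCenter_eq, add_assoc, add_sub_cancel_left, map_add, map_smul, map_smul, coordS_self hv,
    coordS_rot60]
  simp

theorem coordT_center {v : Plane} (hv : v ≠ 0) (o : Plane) (p : ℤ × ℤ) :
    coordT v (hexCenter o v p - o) = ((p.1 + 2 * p.2 : ℤ) : ℝ) := by
  rw [hexCenter_eq, add_assoc, add_sub_cancel_left, map_add, map_smul, map_smul, coordT_self,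
    coordT_rot60 hv]
  simp

theorem mem_convexHull_triple {z a b x : Plane} : x ∈ convexHull ℝ {z, z + a, z + b} ↔
    ∃ α β : ℝ, 0 ≤ α ∧ 0 ≤ β ∧ α + β ≤ 1 ∧ x = z + α • a + β • b := by
  constructor
  · intro hx
    have hc : Convex ℝ {x : Plane | ∃ α β : ℝ, 0 ≤ α ∧ 0 ≤ β ∧ α + β ≤ 1 ∧
        x = z + α • a + β • b} := by
      rintro x ⟨α, β, h1, h2, h3, rfl⟩ y ⟨α', β', h1', h2', h3', rfl⟩ r r' hr hr' hrr
      refine ⟨r * α + r' * α', r * β + r' * β', by positivity, by positivity, ?_, ?_⟩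
      · nlinarith [mul_le_mul_of_nonneg_left h3 hr, mul_le_mul_of_nonneg_left h3' hr']
      · obtain rfl : r' = 1 - r := by linarith
        module
    refine convexHull_min ?_ hc hx
    rintro y (rfl | rfl | rfl)
    · exact ⟨0, 0, by simp⟩
    · exact ⟨1, 0, by simp⟩
    · exact ⟨0, 1, by simp⟩
  · rintro ⟨α, β, h1, h2, h3, rfl⟩
    have hs := convex_convexHull ℝ ({z, z + a, z + b} : Set Plane)
    have hz : z ∈ convexHull ℝ ({z, z + a, z + b} : Set Plane) := subset_convexHull ℝ _ (by simp)
    have ha : z + a ∈ convexHull ℝ ({z, z + a, z + b} : Set Plane) :=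
      subset_convexHull ℝ _ (by simp)
    have hb : z + b ∈ convexHull ℝ ({z, z + a, z + b} : Set Plane) :=
      subset_convexHull ℝ _ (by simp)
    have := hs.sum_mem (t := Finset.univ) (w := ![1 - α - β, α, β])
      (z := ![z, z + a, z + b])
      (by intro i _; fin_cases i <;> simp <;> linarith) (by simp [Fin.sum_univ_three]; ring)
      (by intro i _; fin_cases i <;> simp [hz, ha, hb])
    convert this using 1
    simp [Fin.sum_univ_three]
    module

/-- Membership in a triangle in terms of lattice coordinates relative to the hexagon centre. -/
theorem mem_triangle {v : Plane} (hv : v ≠ 0) (o : Plane) (p : ℤ × ℤ) (k : Fin 6) (x : Plane) :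
    x ∈ triangle o v (p, k) ↔
      0 ≤ hexForm k (coordS v (x - hexCenter o v p)) (coordT v (x - hexCenter o v p)) ∧
      0 ≤ hexForm (k + 2) (coordS v (x - hexCenter o v p)) (coordT v (x - hexCenter o v p)) ∧
      hexForm (k + 1) (coordS v (x - hexCenter o v p)) (coordT v (x - hexCenter o v p)) ≤ 1 := by
  obtain ⟨h0, h1, h2, h3, h4, h5, h6⟩ := rot60_iterate v
  rw [triangle, mem_convexHull_triple]
  set z := hexCenter o v p
  have hx : x = z + coordS v (x - z) • v + coordT v (x - z) • rot60 v := by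
    rw [add_assoc, ← coord_expand hv (x - z)]; abel
  have hS : ∀ α β : ℝ, coordS v (z + α • v + β • rot60 v - z) = α := by
    intro α β
    rw [add_assoc, add_sub_cancel_left, map_add, map_smul, map_smul, coordS_self hv, coordS_rot60]
    simp
  have hT : ∀ α β : ℝ, coordT v (z + α • v + β • rot60 v - z) = β := by
    intro α β
    rw [add_assoc, add_sub_cancel_left, map_add, map_smul, map_smul, coordT_self, coordT_rot60 hv]
    simp
  constructor
  · rintro ⟨α, β, ha, hb, hab, rfl⟩
    fin_cases k
    · simp only [h0, h1, Nat.reduceAdd, hS, hT, hexForm, Fin.isValue, Fin.zero_eta]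
      simp; grind
    · have : z + α • rot60^[1] v + β • rot60^[2] v = z + (-β) • v + (α + β) • rot60 v := by
        rw [h1, h2]; module
      simp only [Nat.reduceAdd, this, hS, hT, hexForm, Fin.isValue, Fin.mk_one]
      simp; grind
    · have : z + α • rot60^[2] v + β • rot60^[3] v = z + (-α - β) • v + α • rot60 v := by
        rw [h3, h2]; module
      simp only [Nat.reduceAdd, this, hS, hT, hexForm, Fin.isValue, Fin.reduceFinMk]
      simp; grind
    · have : z + α • rot60^[3] v + β • rot60^[4] v = z + (-α) • v + (-β) • rot60 v := by
        rw [h3, h4]; module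
      simp only [Nat.reduceAdd, this, hS, hT, hexForm, Fin.isValue, Fin.reduceFinMk]
      simp; grind
    · have : z + α • rot60^[4] v + β • rot60^[5] v = z + β • v + (-α - β) • rot60 v := by
        rw [h5, h4]; module
      simp only [Nat.reduceAdd, this, hS, hT, hexForm, Fin.isValue, Fin.reduceFinMk]
      simp; grind
    · have : z + α • rot60^[5] v + β • rot60^[6] v = z + (α + β) • v + (-α) • rot60 v := by
        rw [h5, h6]; module
      simp only [Nat.reduceAdd, this, hS, hT, hexForm, Fin.isValue, Fin.reduceFinMk]
      simp; grind
  · generalize coordS v (x - z) = s at hx ⊢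
    generalize coordT v (x - z) = t at hx ⊢
    rintro ⟨ha, hb, hab⟩
    -- The forms `k` and `k + 2` are the coefficients along the two spanning vectors of the
    -- triangle, and their sum is the form `k + 1`.
    refine ⟨hexForm k s t, hexForm (k + 2) s t, ha, hb, ?_, ?_⟩
    · refine le_of_eq_of_le ?_ hab
      fin_cases k <;> simp [hexForm] <;> ring
    · rw [hx]
      fin_cases k <;> simp [hexForm, h1, h2, h3, h4, h5, h6, -Function.iterate_succ,
        -Function.iterate_one] <;> module

theorem abs_le_of_mem_hexagon {v : Plane} (hv : v ≠ 0) {z x : Plane} (hx : x ∈ hexagon v z) :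
    |coordS v (x - z)| ≤ 1 ∧ |coordT v (x - z)| ≤ 1 ∧
      |coordS v (x - z) + coordT v (x - z)| ≤ 1 := by
  obtain ⟨h0, h1, h2, h3, h4, h5, h6⟩ := rot60_iterate v
  have key : hexagon v z ⊆ {x | |coordS v (x - z)| ≤ 1 ∧ |coordT v (x - z)| ≤ 1 ∧
      |coordS v (x - z) + coordT v (x - z)| ≤ 1} := by
    refine convexHull_min ?_ ?_
    · rintro _ ⟨k, rfl⟩
      have e1 := coordS_self hv
      have e2 := coordS_rot60 v
      have e3 := coordT_self v
      have e4 := coordT_rot60 hv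
      fin_cases k <;>
        simp [h2, h3, h4, h5, -Function.iterate_succ, e1, e2, e3, e4]
    · intro x hx y hy r r' hr hr' hrr
      have hc : r • x + r' • y - z = r • (x - z) + r' • (y - z) := by
        obtain rfl : r' = 1 - r := by linarith
        module
      simp only [Set.mem_ofPred_eq, abs_le, hc, map_add, map_smul, smul_eq_mul] at hx hy ⊢
      obtain ⟨⟨a1, a2⟩, ⟨a3, a4⟩, a5, a6⟩ := hx
      obtain ⟨⟨b1, b2⟩, ⟨b3, b4⟩, b5, b6⟩ := hy
      refine ⟨⟨?_, ?_⟩, ⟨?_, ?_⟩, ?_, ?_⟩ <;> nlinarith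
  exact key hx

/-! ### Generic points, integer parts, and the triangle containing a point. -/

/-- The points that lie on none of the lines of the triangular grid. -/
def gridGeneric (o v : Plane) : Set Plane :=
  {x | ∀ m : ℤ, coordS v (x - o) ≠ m ∧ coordT v (x - o) ≠ m ∧
    coordS v (x - o) + coordT v (x - o) ≠ m}

theorem ae_linearMap_ne {l : Plane →ₗ[ℝ] ℝ} {u : Plane} (hl : l u ≠ 0) (o : Plane) (r : ℝ) :
    ∀ᵐ x : Plane, l (x - o) ≠ r := by
  have h0 : (volume : Measure Plane) (LinearMap.ker l : Set Plane) = 0 := by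
    refine Measure.addHaar_submodule _ _ fun h => hl ?_
    have : u ∈ LinearMap.ker l := h ▸ Submodule.mem_top
    exact this
  rw [ae_iff]
  have hset : {x : Plane | ¬ l (x - o) ≠ r} =
      (fun x => x + (-(o + (r / l u) • u))) ⁻¹' (LinearMap.ker l : Set Plane) := by
    ext x
    simp only [ne_eq, not_not, Set.mem_ofPred_eq, Set.mem_preimage, SetLike.mem_coe,
      LinearMap.mem_ker, map_add, map_sub, map_neg, map_smul, smul_eq_mul, div_mul_cancel₀ _ hl]
    constructor <;> intro h <;> linarith
  rw [hset, measure_preimage_add_right, h0]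

theorem ae_mem_gridGeneric {v : Plane} (hv : v ≠ 0) (o : Plane) :
    ∀ᵐ x : Plane, x ∈ gridGeneric o v := by
  have hS : coordS v v ≠ 0 := by rw [coordS_self hv]; exact one_ne_zero
  have hT : coordT v (rot60 v) ≠ 0 := by rw [coordT_rot60 hv]; exact one_ne_zero
  have hST : (coordS v + coordT v) v ≠ 0 := by
    rw [LinearMap.add_apply, coordS_self hv, coordT_self]; norm_num
  have := ae_all_iff.2 fun m : ℤ => (ae_linearMap_ne hS o m).and
    ((ae_linearMap_ne hT o m).and (ae_linearMap_ne hST o m))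
  exact this

/-- The homothety with ratio `Λ⁻¹` towards the centre of a hexagon. -/
noncomputable def contract (Λ : ℕ) (o v : Plane) (p : ℤ × ℤ) (x : Plane) : Plane :=
  hexCenter o v p + (Λ : ℝ)⁻¹ • (x - hexCenter o v p)

/-- The inequalities between the integer parts of the coordinates of a generic point that describe
the triangle `(0, k)` stretched by the factor `N`. -/
def cellCond (N : ℤ) (k : Fin 6) (a b c : ℤ) : Prop :=
  ![0 ≤ a ∧ 0 ≤ b ∧ c < N, 0 ≤ c ∧ a < 0 ∧ b < N, 0 ≤ b ∧ c < 0 ∧ -N ≤ a,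
    a < 0 ∧ b < 0 ∧ -N ≤ c, c < 0 ∧ 0 ≤ a ∧ -N ≤ b, b < 0 ∧ 0 ≤ c ∧ a < N] k

/-- Integer parts of the three coordinates of a generic point. -/
structure GridCell (o v x : Plane) (a b c : ℤ) : Prop where
  leS : ∀ m : ℤ, (m : ℝ) ≤ coordS v (x - o) ↔ m ≤ a
  geS : ∀ m : ℤ, coordS v (x - o) ≤ m ↔ a < m
  leT : ∀ m : ℤ, (m : ℝ) ≤ coordT v (x - o) ↔ m ≤ b
  geT : ∀ m : ℤ, coordT v (x - o) ≤ m ↔ b < m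
  leST : ∀ m : ℤ, (m : ℝ) ≤ coordS v (x - o) + coordT v (x - o) ↔ m ≤ c
  geST : ∀ m : ℤ, coordS v (x - o) + coordT v (x - o) ≤ m ↔ c < m
  le_c : a + b ≤ c
  c_le : c ≤ a + b + 1

theorem exists_gridCell {o v x : Plane} (hx : x ∈ gridGeneric o v) :
    ∃ a b c : ℤ, GridCell o v x a b c := by
  have le_iff : ∀ (r : ℝ), (∀ m : ℤ, r ≠ m) → ∀ m : ℤ, r ≤ m ↔ ⌊r⌋ < m := by
    intro r hr m
    rw [Int.floor_lt]
    exact ⟨fun h => lt_of_le_of_ne h (hr m), le_of_lt⟩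
  refine ⟨_, _, _, fun m => Int.le_floor.symm, le_iff _ fun m => (hx m).1, fun m => Int.le_floor.symm,
    le_iff _ fun m => (hx m).2.1, fun m => Int.le_floor.symm, le_iff _ fun m => (hx m).2.2,
    Int.le_floor_add _ _, ?_⟩
  have := Int.le_floor_add_floor (coordS v (x - o)) (coordT v (x - o))
  linarith

/-- Every side of the stretched triangle lies on a grid line, so each inequality compares a
coordinate with an integer and, at a generic point, depends only on the integer part. The case `Λ =
1` describes the triangle itself. -/
theorem contract_mem_triangle {o v x : Plane} (hv : v ≠ 0) {a b c : ℤ}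
    (h : GridCell o v x a b c) {Λ : ℕ} (hΛ : 0 < Λ) (p : ℤ × ℤ) (k : Fin 6) :
    contract Λ o v p x ∈ triangle o v (p, k) ↔
      cellCond Λ k (a - (p.1 - p.2)) (b - (p.1 + 2 * p.2)) (c - (2 * p.1 + p.2)) := by
  have hΛ' : (0 : ℝ) < Λ := by exact_mod_cast hΛ
  rw [mem_triangle hv]
  have hsub : contract Λ o v p x - hexCenter o v p =
      (Λ : ℝ)⁻¹ • ((x - o) - (hexCenter o v p - o)) := by
    rw [contract, add_sub_cancel_left, sub_sub_sub_cancel_right]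
  rw [hsub, map_smul, map_smul, map_sub (coordS v) (x - o), map_sub (coordT v) (x - o), coordS_center hv, coordT_center hv]
  obtain ⟨h1, h2, h3, h4, h5, h6, -, -⟩ := h
  generalize coordS v (x - o) = s at *
  generalize coordT v (x - o) = t at *
  have i1 : ∀ r : ℝ, 0 ≤ (Λ : ℝ)⁻¹ * r ↔ 0 ≤ r := fun r => by
    rw [mul_nonneg_iff_of_pos_left (by positivity)]
  have i2 : ∀ r : ℝ, (Λ : ℝ)⁻¹ * r ≤ 1 ↔ r ≤ Λ := fun r => by
    rw [inv_mul_le_iff₀ hΛ', mul_one]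
  have lin : ∀ k : Fin 6, hexForm k ((Λ : ℝ)⁻¹ • (s - ((p.1 - p.2 : ℤ) : ℝ)))
      ((Λ : ℝ)⁻¹ • (t - ((p.1 + 2 * p.2 : ℤ) : ℝ))) =
      (Λ : ℝ)⁻¹ * hexForm k (s - ((p.1 - p.2 : ℤ) : ℝ)) (t - ((p.1 + 2 * p.2 : ℤ) : ℝ)) := by
    intro k; fin_cases k <;> simp [hexForm] <;> ring
  rw [lin, lin, lin, i1, i1, i2]
  have a1 : ∀ m : ℤ, (0 ≤ s - m) ↔ m ≤ a := fun m => by rw [sub_nonneg, h1]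
  have a2 : ∀ m : ℤ, (0 ≤ -(s - m)) ↔ a < m := fun m => by rw [neg_nonneg, sub_nonpos, h2]
  have a3 : ∀ m : ℤ, (0 ≤ t - m) ↔ m ≤ b := fun m => by rw [sub_nonneg, h3]
  have a4 : ∀ m : ℤ, (0 ≤ -(t - m)) ↔ b < m := fun m => by rw [neg_nonneg, sub_nonpos, h4]
  have a5 : ∀ m n : ℤ, (0 ≤ s - m + (t - n)) ↔ m + n ≤ c := fun m n => by
    rw [← h5]; push_cast; constructor <;> intro h <;> linarith
  have a6 : ∀ m n : ℤ, (0 ≤ -(s - m) - (t - n)) ↔ c < m + n := fun m n => by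
    rw [← h6]; push_cast; constructor <;> intro h <;> linarith
  have b1 : ∀ m : ℤ, (s - m ≤ (Λ : ℝ)) ↔ a < m + Λ := fun m => by
    rw [← h2]; push_cast; constructor <;> intro h <;> linarith
  have b2 : ∀ m : ℤ, (-(s - m) ≤ (Λ : ℝ)) ↔ m - Λ ≤ a := fun m => by
    rw [← h1]; push_cast; constructor <;> intro h <;> linarith
  have b3 : ∀ m : ℤ, (t - m ≤ (Λ : ℝ)) ↔ b < m + Λ := fun m => by
    rw [← h4]; push_cast; constructor <;> intro h <;> linarith
  have b4 : ∀ m : ℤ, (-(t - m) ≤ (Λ : ℝ)) ↔ m - Λ ≤ b := fun m => by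
    rw [← h3]; push_cast; constructor <;> intro h <;> linarith
  have b5 : ∀ m n : ℤ, (s - m + (t - n) ≤ (Λ : ℝ)) ↔ c < m + n + Λ := fun m n => by
    rw [← h6]; push_cast; constructor <;> intro h <;> linarith
  have b6 : ∀ m n : ℤ, (-(s - m) - (t - n) ≤ (Λ : ℝ)) ↔ m + n - Λ ≤ c := fun m n => by
    rw [← h5]; push_cast; constructor <;> intro h <;> linarith
  generalize hA : p.1 - p.2 = A
  generalize hB : p.1 + 2 * p.2 = B
  fin_cases k
  · change (0 ≤ s - (A : ℝ)) ∧ (0 ≤ t - (B : ℝ)) ∧ (s - A + (t - B) ≤ (Λ : ℝ)) ↔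
      (0 ≤ a - A) ∧ (0 ≤ b - B) ∧ c - (2 * p.1 + p.2) < Λ
    rw [a1, a3, b5]; omega
  · change (0 ≤ s - A + (t - B)) ∧ (0 ≤ -(s - (A : ℝ))) ∧ (t - B ≤ (Λ : ℝ)) ↔
      (0 ≤ c - (2 * p.1 + p.2)) ∧ (a - A < 0) ∧ b - B < Λ
    rw [a5, a2, b3]; omega
  · change (0 ≤ t - (B : ℝ)) ∧ (0 ≤ -(s - (A : ℝ)) - (t - B)) ∧ (-(s - A) ≤ (Λ : ℝ)) ↔
      (0 ≤ b - B) ∧ (c - (2 * p.1 + p.2) < 0) ∧ -(Λ : ℤ) ≤ a - A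
    rw [a3, a6, b2]; omega
  · change (0 ≤ -(s - (A : ℝ))) ∧ (0 ≤ -(t - (B : ℝ))) ∧ (-(s - A) - (t - B) ≤ (Λ : ℝ)) ↔
      (a - A < 0) ∧ (b - B < 0) ∧ -(Λ : ℤ) ≤ c - (2 * p.1 + p.2)
    rw [a2, a4, b6]; omega
  · change (0 ≤ -(s - (A : ℝ)) - (t - B)) ∧ (0 ≤ s - (A : ℝ)) ∧ (-(t - B) ≤ (Λ : ℝ)) ↔
      (c - (2 * p.1 + p.2) < 0) ∧ (0 ≤ a - A) ∧ -(Λ : ℤ) ≤ b - B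
    rw [a6, a1, b4]; omega
  · change (0 ≤ -(t - (B : ℝ))) ∧ (0 ≤ s - A + (t - B)) ∧ (s - A ≤ (Λ : ℝ)) ↔
      (b - B < 0) ∧ (0 ≤ c - (2 * p.1 + p.2)) ∧ a - A < Λ
    rw [a4, a5, b1]; omega

theorem contract_one (o v : Plane) (p : ℤ × ℤ) (x : Plane) : contract 1 o v p x = x := by
  simp [contract]

theorem mem_triangle_iff_cellCond {o v x : Plane} (hv : v ≠ 0) {a b c : ℤ}
    (h : GridCell o v x a b c) (p : ℤ × ℤ) (k : Fin 6) :
    x ∈ triangle o v (p, k) ↔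
      cellCond 1 k (a - (p.1 - p.2)) (b - (p.1 + 2 * p.2)) (c - (2 * p.1 + p.2)) := by
  have := contract_mem_triangle hv h one_pos p k
  rwa [contract_one] at this

theorem fin6_cases (k : Fin 6) : k = 0 ∨ k = 1 ∨ k = 2 ∨ k = 3 ∨ k = 4 ∨ k = 5 := by
  fin_cases k <;> simp

theorem cellCond_iff (N : ℤ) (k : Fin 6) (a b c : ℤ) : cellCond N k a b c ↔
    (k = 0 ∧ 0 ≤ a ∧ 0 ≤ b ∧ c < N) ∨ (k = 1 ∧ 0 ≤ c ∧ a < 0 ∧ b < N) ∨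
    (k = 2 ∧ 0 ≤ b ∧ c < 0 ∧ -N ≤ a) ∨ (k = 3 ∧ a < 0 ∧ b < 0 ∧ -N ≤ c) ∨
    (k = 4 ∧ c < 0 ∧ 0 ≤ a ∧ -N ≤ b) ∨ (k = 5 ∧ b < 0 ∧ 0 ≤ c ∧ a < N) := by
  fin_cases k <;> simp [cellCond]

/-- The integer parts determine the unit triangle containing the point: `c = a + b` and `c = a + b +
1` are its two orientations. On its three vertices t - s takes all residues mod 3, so exactly one
vertex is a hexagon centre; the residue of `b - a` says which. -/
theorem existsUnique_triangle {o v x : Plane} (hv : v ≠ 0) (hx : x ∈ gridGeneric o v) :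
    ∃! i : TriangleIndex, x ∈ triangle o v i := by
  obtain ⟨a, b, c, h⟩ := exists_gridCell hx
  have hm := mem_triangle_iff_cellCond hv h
  have h1 := h.le_c
  have h2 := h.c_le
  refine existsUnique_of_exists_of_unique ?_ ?_
  · obtain hc | hc : c = a + b ∨ c = a + b + 1 := by omega
    · obtain hd | hd | hd : (b - a) % 3 = 0 ∨ (b - a) % 3 = 1 ∨ (b - a) % 3 = 2 := by omega
      · refine ⟨((a + (b - a) / 3, (b - a) / 3), 0), (hm _ _).2 ((cellCond_iff ..).2 ?_)⟩
        left; simp only [true_and]; omega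
      · refine ⟨((a + 1 + (b - a - 1) / 3, (b - a - 1) / 3), 2),
          (hm _ _).2 ((cellCond_iff ..).2 ?_)⟩
        right; right; left; simp only [true_and]; omega
      · refine ⟨((a + (b - a + 1) / 3, (b - a + 1) / 3), 4), (hm _ _).2 ((cellCond_iff ..).2 ?_)⟩
        right; right; right; right; left; simp only [true_and]; omega
    · obtain hd | hd | hd : (b - a) % 3 = 0 ∨ (b - a) % 3 = 1 ∨ (b - a) % 3 = 2 := by omega
      · refine ⟨((a + 1 + (b - a) / 3, (b - a) / 3), 3), (hm _ _).2 ((cellCond_iff ..).2 ?_)⟩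
        right; right; right; left; simp only [true_and]; omega
      · refine ⟨((a + 1 + (b - a - 1) / 3, (b - a - 1) / 3), 1),
          (hm _ _).2 ((cellCond_iff ..).2 ?_)⟩
        right; left; simp only [true_and]; omega
      · refine ⟨((a + (b - a + 1) / 3, (b - a + 1) / 3), 5), (hm _ _).2 ((cellCond_iff ..).2 ?_)⟩
        right; right; right; right; right; simp only [true_and]; omega
  · rintro ⟨⟨p, q⟩, k⟩ ⟨⟨p', q'⟩, k'⟩ hi hi'
    rw [hm, cellCond_iff] at hi hi'
    have : p = p' ∧ q = q' ∧ k = k' := by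
      simp only at hi hi'
      omega
    grind

/-- A generic point lies in only one closed hexagon, so the choice made by `IsHexCenterMap` on
common sides affects a null set only. -/
theorem eq_of_mem_hexagon {o v x : Plane} (hv : v ≠ 0) (hx : x ∈ gridGeneric o v)
    {i : TriangleIndex} (hi : x ∈ triangle o v i) {p : ℤ × ℤ}
    (hp : x ∈ hexagon v (hexCenter o v p)) : p = i.1 := by
  obtain ⟨a, b, c, h⟩ := exists_gridCell hx
  obtain ⟨⟨p', q'⟩, k⟩ := i
  obtain ⟨p, q⟩ := p
  rw [mem_triangle_iff_cellCond hv h, cellCond_iff] at hi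
  have hb := abs_le_of_mem_hexagon hv hp
  rw [← sub_sub_sub_cancel_right x _ o, map_sub (coordS v) (x - o),
    map_sub (coordT v) (x - o), coordS_center hv, coordT_center hv, abs_le, abs_le, abs_le] at hb
  obtain ⟨h1, h2, h3, h4, h5, h6, h7, h8⟩ := h
  obtain ⟨⟨g1, g2⟩, ⟨g3, g4⟩, g5, g6⟩ := hb
  simp only at g1 g2 g3 g4 g5 g6
  have e1 := (h1 (p - q - 1)).1 (by push_cast at *; linarith)
  have e2 := (h2 (p - q + 1)).1 (by push_cast at *; linarith)
  have e3 := (h3 (p + 2 * q - 1)).1 (by push_cast at *; linarith)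
  have e4 := (h4 (p + 2 * q + 1)).1 (by push_cast at *; linarith)
  have e5 := (h5 (2 * p + q - 1)).1 (by push_cast at *; linarith)
  have e6 := (h6 (2 * p + q + 1)).1 (by push_cast at *; linarith)
  have : p = p' ∧ q = q' := by
    simp only at hi
    omega
  grind

/-! ### The grid triangles that fill a stretched triangle. -/

/-- Three times the barycentres of the triangles of the hexagon around `0`. -/
def baryS : Fin 6 → ℤ := ![1, -1, -2, -1, 1, 2]

/-- Three times the barycentres of the triangles of the hexagon around `0`. -/
def baryT : Fin 6 → ℤ := ![1, 2, 1, -1, -2, -1]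

/-- The triangle `(y, l)` lies in the triangle `(0, k)` stretched by the factor `Λ`. -/
def IsOffset (Λ : ℕ) (k l : Fin 6) (y : ℤ × ℤ) : Prop :=
  0 < hexForm k (3 * (y.1 - y.2) + baryS l) (3 * (y.1 + 2 * y.2) + baryT l) ∧
  0 < hexForm (k + 2) (3 * (y.1 - y.2) + baryS l) (3 * (y.1 + 2 * y.2) + baryT l) ∧
  hexForm (k + 1) (3 * (y.1 - y.2) + baryS l) (3 * (y.1 + 2 * y.2) + baryT l) < 3 * Λ

instance (Λ : ℕ) (k l : Fin 6) : DecidablePred (IsOffset Λ k l) := fun y => by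
  unfold IsOffset; infer_instance

/-- The positions of the triangles of type `l` in the triangle `(0, k)` stretched by `Λ`. -/
noncomputable def offsets (Λ : ℕ) (k l : Fin 6) : Finset (ℤ × ℤ) :=
  (Finset.Icc (-(2 * Λ + 2) : ℤ) (2 * Λ + 2) ×ˢ Finset.Icc (-(2 * Λ + 2) : ℤ) (2 * Λ + 2)).filter
    (IsOffset Λ k l)

theorem isOffset_iff (Λ : ℕ) (k l : Fin 6) (y : ℤ × ℤ) : IsOffset Λ k l y ↔
    ∃ s t : ℤ, ((l = 0 ∧ s = 3 * (y.1 - y.2) + 1 ∧ t = 3 * (y.1 + 2 * y.2) + 1) ∨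
      (l = 1 ∧ s = 3 * (y.1 - y.2) - 1 ∧ t = 3 * (y.1 + 2 * y.2) + 2) ∨
      (l = 2 ∧ s = 3 * (y.1 - y.2) - 2 ∧ t = 3 * (y.1 + 2 * y.2) + 1) ∨
      (l = 3 ∧ s = 3 * (y.1 - y.2) - 1 ∧ t = 3 * (y.1 + 2 * y.2) - 1) ∨
      (l = 4 ∧ s = 3 * (y.1 - y.2) + 1 ∧ t = 3 * (y.1 + 2 * y.2) - 2) ∨
      (l = 5 ∧ s = 3 * (y.1 - y.2) + 2 ∧ t = 3 * (y.1 + 2 * y.2) - 1)) ∧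
    ((k = 0 ∧ 0 < s ∧ 0 < t ∧ s + t < 3 * Λ) ∨ (k = 1 ∧ 0 < s + t ∧ s < 0 ∧ t < 3 * Λ) ∨
      (k = 2 ∧ 0 < t ∧ s + t < 0 ∧ -s < 3 * Λ) ∨ (k = 3 ∧ s < 0 ∧ t < 0 ∧ -s - t < 3 * Λ) ∨
      (k = 4 ∧ s + t < 0 ∧ 0 < s ∧ -t < 3 * Λ) ∨ (k = 5 ∧ t < 0 ∧ 0 < s + t ∧ s < 3 * Λ)) := by
  have h : IsOffset Λ k l y ↔ ∃ s t : ℤ, (s = 3 * (y.1 - y.2) + baryS l ∧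
      t = 3 * (y.1 + 2 * y.2) + baryT l) ∧ (0 < hexForm k s t ∧ 0 < hexForm (k + 2) s t ∧
      hexForm (k + 1) s t < 3 * Λ) := by
    constructor
    · exact fun h => ⟨_, _, ⟨rfl, rfl⟩, h⟩
    · rintro ⟨_, _, ⟨rfl, rfl⟩, h⟩; exact h
  rw [h]
  refine exists_congr fun s => exists_congr fun t => and_congr ?_ ?_
  · fin_cases l <;> simp [baryS, baryT, sub_eq_add_neg]
  · fin_cases k <;> simp [hexForm] <;> intros <;> omega

/-- The box in `offsets` only supplies finiteness: the inequalities bound both barycentric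
coordinates by 3Λ in absolute value, which keeps `y` well inside it. -/
theorem mem_offsets {Λ : ℕ} {k l : Fin 6} {y : ℤ × ℤ} : y ∈ offsets Λ k l ↔ IsOffset Λ k l y := by
  simp only [offsets, Finset.mem_filter, Finset.mem_product, Finset.mem_Icc,
    and_iff_right_iff_imp]
  intro h
  rw [isOffset_iff] at h
  obtain ⟨s, t, h1, h2⟩ := h
  omega

/-- The stretched triangle is a union of grid triangles, so it contains the whole grid triangle
around a generic point of it, and testing the point or the barycentre is the same. The condition
involves only the difference of the two hexagons, which is the translation invariance behind the
random walk. -/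
theorem contract_mem_triangle_iff {o v x : Plane} (hv : v ≠ 0) (hx : x ∈ gridGeneric o v)
    {Λ : ℕ} (hΛ : 0 < Λ) {j : TriangleIndex} (hj : x ∈ triangle o v j) (i : TriangleIndex) :
    contract Λ o v i.1 x ∈ triangle o v i ↔ j.1 - i.1 ∈ offsets Λ i.2 j.2 := by
  obtain ⟨a, b, c, h⟩ := exists_gridCell hx
  obtain ⟨⟨p, q⟩, k⟩ := i
  obtain ⟨⟨p', q'⟩, l⟩ := j
  rw [contract_mem_triangle hv h hΛ, mem_offsets, isOffset_iff, cellCond_iff]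
  rw [mem_triangle_iff_cellCond hv h, cellCond_iff] at hj
  have h1 := h.le_c
  have h2 := h.c_le
  simp only [Prod.mk_sub_mk] at hj ⊢
  rcases fin6_cases l with rfl | rfl | rfl | rfl | rfl | rfl <;>
  rcases fin6_cases k with rfl | rfl | rfl | rfl | rfl | rfl <;>
  simp at hj ⊢ <;> omega

/-! ### The Perron–Frobenius operator on densities given triangle by triangle. -/

/-- The function that is given by `h i` on the triangle `i`. -/
noncomputable def cellFun (o v : Plane) (h : TriangleIndex → Plane → ℝ≥0∞) (x : Plane) : ℝ≥0∞ :=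
  ∑' i, (triangle o v i).indicator (h i) x

/-- The action of the Perron-Frobenius operator on densities given triangle by triangle. -/
noncomputable def cellStep (Λ : ℕ) (o v : Plane) (h : TriangleIndex → Plane → ℝ≥0∞)
    (j : TriangleIndex) (x : Plane) : ℝ≥0∞ :=
  ((Λ : ℝ≥0∞) ^ 2)⁻¹ * ∑ k, ∑ y ∈ offsets Λ k j.2, h (j.1 - y, k) (contract Λ o v (j.1 - y) x)

theorem measurableSet_triangle (o v : Plane) (i : TriangleIndex) :
    MeasurableSet (triangle o v i) := by
  refine IsCompact.measurableSet ?_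
  exact (Set.toFinite _).isCompact_convexHull ℝ

theorem cellFun_apply {o v x : Plane} (hv : v ≠ 0) (hx : x ∈ gridGeneric o v) {j : TriangleIndex}
    (hj : x ∈ triangle o v j) (h : TriangleIndex → Plane → ℝ≥0∞) : cellFun o v h x = h j x := by
  rw [cellFun, tsum_eq_single j, Set.indicator_of_mem hj]
  intro i hi
  exact Set.indicator_of_notMem (fun h' => hi ((existsUnique_triangle hv hx).unique h' hj)) _

theorem measurable_cellFun (o v : Plane) {h : TriangleIndex → Plane → ℝ≥0∞}
    (hh : ∀ i, Measurable (h i)) : Measurable (cellFun o v h) :=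
  Measurable.tsum fun i => (hh i).indicator (measurableSet_triangle o v i)

theorem measurable_contract (Λ : ℕ) (o v : Plane) (p : ℤ × ℤ) :
    Measurable (contract Λ o v p) := by
  unfold contract; fun_prop

theorem measurable_cellStep (Λ : ℕ) (o v : Plane) {h : TriangleIndex → Plane → ℝ≥0∞}
    (hh : ∀ i, Measurable (h i)) (j : TriangleIndex) : Measurable (cellStep Λ o v h j) := by
  unfold cellStep
  refine Measurable.const_mul (Finset.measurable_sum _ fun k _ => Finset.measurable_sum _
    fun y _ => (hh _).comp (measurable_contract ..)) _

theorem lintegral_comp_contract {Λ : ℕ} (hΛ : 0 < Λ) (o v : Plane) (p : ℤ × ℤ)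
    {g : Plane → ℝ≥0∞} (hg : Measurable g) :
    ∫⁻ x, g x = ((Λ : ℝ≥0∞) ^ 2)⁻¹ * ∫⁻ x, g (contract Λ o v p x) := by
  have hr : ((Λ : ℝ)⁻¹) ≠ 0 := by positivity
  set z := hexCenter o v p
  have h1 : ∫⁻ x, g (contract Λ o v p x) = ∫⁻ x, g (z + (Λ : ℝ)⁻¹ • x) :=
    lintegral_sub_right_eq_self (fun x => g (z + (Λ : ℝ)⁻¹ • x)) z
  have hm : Measurable fun x => g (z + x) := hg.comp (measurable_const_add z)
  have h2 : ∫⁻ x, g (z + (Λ : ℝ)⁻¹ • x) = (Λ : ℝ≥0∞) ^ 2 * ∫⁻ x, g (z + x) := by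
    have := lintegral_map (μ := (volume : Measure Plane)) hm (measurable_const_smul ((Λ : ℝ)⁻¹))
    rw [← this, Measure.map_addHaar_smul _ hr, lintegral_smul_measure]
    congr 1
    simp only [finrank_euclideanSpace, Fintype.card_fin, inv_pow, inv_inv]
    rw [abs_of_nonneg (by positivity), ← Nat.cast_pow, ENNReal.ofReal_natCast, Nat.cast_pow]
  rw [h1, h2, lintegral_add_left_eq_self (fun x => g x) z, ← mul_assoc, ENNReal.inv_mul_cancel,
    one_mul]
  · simp [hΛ.ne']
  · exact ENNReal.pow_ne_top (ENNReal.natCast_ne_top _)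

theorem measurable_stretchMap (Λ : ℝ) {c : Plane → Plane} (hc : Measurable c) :
    Measurable (stretchMap Λ c) := by
  unfold stretchMap; fun_prop

theorem stretchMap_of_mem {o v x : Plane} (hv : v ≠ 0) {c : Plane → Plane}
    (hc : IsHexCenterMap o v c) (hx : x ∈ gridGeneric o v) {i : TriangleIndex}
    (hi : x ∈ triangle o v i) (Λ : ℝ) :
    stretchMap Λ c x = hexCenter o v i.1 + Λ • (x - hexCenter o v i.1) := by
  obtain ⟨p, hp, hxp⟩ := hc.2 x
  rw [stretchMap, hp, eq_of_mem_hexagon hv hx hi hxp]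

/-- Of all the inverse branches of the stretching, only those recorded by `offsets` land in their
own triangle; reindexing by the displacement gives the finite sum in `cellStep`. -/
theorem tsum_indicator_contract {o v x : Plane} (hv : v ≠ 0) (hx : x ∈ gridGeneric o v)
    {Λ : ℕ} (hΛ : 0 < Λ) {j : TriangleIndex} (hj : x ∈ triangle o v j)
    (h : TriangleIndex → Plane → ℝ≥0∞) :
    ∑' i, ((Λ : ℝ≥0∞) ^ 2)⁻¹ * (triangle o v i).indicator (h i) (contract Λ o v i.1 x) =
      cellStep Λ o v h j x := by
  classical
  rw [ENNReal.tsum_mul_left, cellStep]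
  congr 1
  have e : ∀ i : TriangleIndex, (triangle o v i).indicator (h i) (contract Λ o v i.1 x) =
      if j.1 - i.1 ∈ offsets Λ i.2 j.2 then h i (contract Λ o v i.1 x) else 0 := by
    intro i
    simp only [Set.indicator_apply, contract_mem_triangle_iff hv hx hΛ hj]
  simp_rw [e]
  rw [ENNReal.tsum_prod (f := fun p k => if j.1 - p ∈ offsets Λ k j.2 then
    h (p, k) (contract Λ o v p x) else 0), ENNReal.tsum_comm, tsum_fintype]
  refine Finset.sum_congr rfl fun k _ => ?_
  rw [← (Equiv.subLeft j.1).tsum_eq]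
  simp only [Equiv.subLeft_apply, sub_sub_cancel]
  rw [tsum_eq_sum (s := offsets Λ k j.2)]
  · exact Finset.sum_congr rfl fun y hy => by simp [hy]
  · intro y hy; simp [hy]

/-- Up to a null set the map is a homothety of ratio Λ on each triangle. The mass is split into
triangles, the change of variables with Jacobian Λ⁻² is made in each, and the result is regrouped at
the image point. -/
theorem perronFrobenius_cellFun {o v : Plane} (hv : v ≠ 0) {c : Plane → Plane}
    (hc : IsHexCenterMap o v c) {Λ : ℕ} (hΛ : 0 < Λ) {h : TriangleIndex → Plane → ℝ≥0∞}
    (hh : ∀ i, Measurable (h i)) :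
    perronFrobenius (stretchMap Λ c) (volume.withDensity (cellFun o v h)) =
      volume.withDensity (cellFun o v (cellStep Λ o v h)) := by
  classical
  have hf := measurable_stretchMap (Λ : ℝ) hc.1
  have hΛ0 : (Λ : ℝ) ≠ 0 := by positivity
  ext A hA
  rw [perronFrobenius, Measure.map_apply hf hA, withDensity_apply _ (hf hA),
    withDensity_apply _ hA, ← lintegral_indicator (hf hA), ← lintegral_indicator hA]
  let H : TriangleIndex → Plane → Plane := fun i x =>
    hexCenter o v i.1 + (Λ : ℝ) • (x - hexCenter o v i.1)
  have hHm : ∀ i, Measurable (H i) := fun i => by fun_prop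
  have hH : ∀ i x, H i (contract Λ o v i.1 x) = x := by
    intro i x
    simp only [H, contract, add_sub_cancel_left, smul_smul, mul_inv_cancel₀ hΛ0, one_smul]
    abel
  let G : TriangleIndex → Plane → ℝ≥0∞ := fun i =>
    (H i ⁻¹' A).indicator ((triangle o v i).indicator (h i))
  have hG : ∀ i, Measurable (G i) := fun i =>
    ((hh i).indicator (measurableSet_triangle o v i)).indicator (hHm i hA)
  calc ∫⁻ x, (stretchMap Λ c ⁻¹' A).indicator (cellFun o v h) x
      = ∫⁻ x, ∑' i, G i x := by
        refine lintegral_congr_ae ?_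
        filter_upwards [ae_mem_gridGeneric hv o] with x hx
        obtain ⟨j, hj, hju⟩ := existsUnique_triangle hv hx
        have hG' : ∀ i ≠ j, G i x = 0 := by
          intro i hi
          have : x ∉ triangle o v i := fun h' => hi (hju i h')
          simp [G, this]
        rw [tsum_eq_single j hG']
        simp only [G, Set.indicator_apply, Set.mem_preimage, cellFun_apply hv hx hj h,
          stretchMap_of_mem hv hc hx hj, H, if_pos hj]
    _ = ∑' i, ∫⁻ x, G i x := lintegral_tsum fun i => (hG i).aemeasurable
    _ = ∑' i, ∫⁻ x, ((Λ : ℝ≥0∞) ^ 2)⁻¹ * G i (contract Λ o v i.1 x) := by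
        refine tsum_congr fun i => ?_
        rw [lintegral_comp_contract hΛ o v i.1 (hG i), lintegral_const_mul]
        exact (hG i).comp (measurable_contract ..)
    _ = ∫⁻ x, ∑' i, ((Λ : ℝ≥0∞) ^ 2)⁻¹ * G i (contract Λ o v i.1 x) :=
        (lintegral_tsum fun i =>
          (((hG i).comp (measurable_contract ..)).const_mul _).aemeasurable).symm
    _ = ∫⁻ x, A.indicator (cellFun o v (cellStep Λ o v h)) x := by
        refine lintegral_congr_ae ?_
        filter_upwards [ae_mem_gridGeneric hv o] with x hx
        obtain ⟨j, hj, hju⟩ := existsUnique_triangle hv hx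
        rw [Set.indicator_apply, cellFun_apply hv hx hj, ← tsum_indicator_contract hv hx hΛ hj h]
        by_cases hxA : x ∈ A <;>
        simp [G, Set.indicator_apply, hH, hxA]

/-- The action of the Perron-Frobenius operator on the weights of the triangles. -/
noncomputable def weightStep (Λ : ℕ) (w : TriangleIndex → ℝ≥0) (j : TriangleIndex) : ℝ≥0 :=
  ((Λ : ℝ≥0) ^ 2)⁻¹ * ∑ k, ∑ y ∈ offsets Λ k j.2, w (j.1 - y, k)

theorem triangleMeasure_eq_withDensity (o v : Plane) (w : TriangleIndex → ℝ≥0) :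
    triangleMeasure o v w = volume.withDensity (cellFun o v fun i _ => (w i : ℝ≥0∞)) := by
  have : cellFun o v (fun i _ => (w i : ℝ≥0∞)) =
      ∑' i, (triangle o v i).indicator fun _ => (w i : ℝ≥0∞) := by
    ext x
    rw [cellFun, tsum_apply (Pi.summable.2 fun _ => ENNReal.summable)]
  rw [triangleMeasure, this, withDensity_tsum
    fun i => measurable_const.indicator (measurableSet_triangle o v i)]
  congr 1
  ext i : 1
  rw [withDensity_indicator (measurableSet_triangle o v i), withDensity_const]
  rfl

theorem perronFrobenius_triangleMeasure {o v : Plane} (hv : v ≠ 0) {c : Plane → Plane}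
    (hc : IsHexCenterMap o v c) {Λ : ℕ} (hΛ : 0 < Λ) (w : TriangleIndex → ℝ≥0) :
    perronFrobenius (stretchMap Λ c) (triangleMeasure o v w) =
      triangleMeasure o v (weightStep Λ w) := by
  rw [triangleMeasure_eq_withDensity, triangleMeasure_eq_withDensity,
    perronFrobenius_cellFun hv hc hΛ fun i => measurable_const]
  congr 2
  ext j x
  simp only [cellStep, weightStep]
  rw [ENNReal.coe_mul, ENNReal.coe_inv (by positivity)]
  push_cast
  rfl

theorem perronFrobenius_iterate_triangleMeasure {o v : Plane} (hv : v ≠ 0) {c : Plane → Plane}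
    (hc : IsHexCenterMap o v c) {Λ : ℕ} (hΛ : 0 < Λ) (w : TriangleIndex → ℝ≥0) (n : ℕ) :
    (perronFrobenius (stretchMap Λ c))^[n] (triangleMeasure o v w) =
      triangleMeasure o v ((weightStep Λ)^[n] w) := by
  induction n with
  | zero => rfl
  | succ n ih =>
    rw [Function.iterate_succ_apply', ih, perronFrobenius_triangleMeasure hv hc hΛ,
      Function.iterate_succ_apply']

theorem finite_support_weightStep (Λ : ℕ) {w : TriangleIndex → ℝ≥0}
    (hw : (Function.support w).Finite) : (Function.support (weightStep Λ w)).Finite := by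
  refine Set.Finite.subset (s := ⋃ i ∈ Function.support w, ⋃ l : Fin 6,
    (fun y => (i.1 + y, l)) '' (offsets Λ i.2 l : Set (ℤ × ℤ))) ?_ ?_
  · exact hw.biUnion fun i _ => Set.finite_iUnion fun l => (Finset.finite_toSet _).image _
  · intro j hj
    simp only [Function.mem_support, weightStep] at hj
    obtain ⟨k, -, hk⟩ := Finset.exists_ne_zero_of_sum_ne_zero (right_ne_zero_of_mul hj)
    obtain ⟨y, hy, hky⟩ := Finset.exists_ne_zero_of_sum_ne_zero hk
    simp only [Set.mem_iUnion]
    exact ⟨_, hky, j.2, y, hy, by simp⟩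

/-! ### Areas of the triangles and the number of offsets. -/

theorem volume_standard_triangle :
    volume {x : Plane | 0 ≤ x 0 ∧ 0 ≤ x 1 ∧ x 0 + x 1 ≤ 1} = ENNReal.ofReal (1 / 2) := by
  let s : Set (ℝ × ℝ) := {p | 0 ≤ p.1 ∧ 0 ≤ p.2 ∧ p.1 + p.2 ≤ 1}
  have hs : MeasurableSet s := by
    refine IsClosed.measurableSet ?_
    refine (isClosed_le continuous_const continuous_fst).inter
      ((isClosed_le continuous_const continuous_snd).inter
        (isClosed_le (continuous_fst.add continuous_snd) continuous_const))
  have hp := (volume_preserving_finTwoArrow ℝ).comp (EuclideanSpace.volume_preserving_symm_measurableEquiv_toLp (Fin 2))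
  have : {x : Plane | 0 ≤ x 0 ∧ 0 ≤ x 1 ∧ x 0 + x 1 ≤ 1} =
      (MeasurableEquiv.finTwoArrow ∘ (MeasurableEquiv.toLp 2 (Fin 2 → ℝ)).symm) ⁻¹' s := by
    ext x; simp [s]
  rw [this, hp.measure_preimage hs.nullMeasurableSet, Measure.volume_eq_prod, Measure.prod_apply hs]
  have hsec : ∀ x : ℝ, volume (Prod.mk x ⁻¹' s) =
      (Set.Icc (0 : ℝ) 1).indicator (fun x => ENNReal.ofReal (1 - x)) x := by
    intro x
    by_cases hx : x ∈ Set.Icc (0 : ℝ) 1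
    · rw [Set.indicator_of_mem hx]
      have : Prod.mk x ⁻¹' s = Set.Icc 0 (1 - x) := by
        ext y
        simp only [s, Set.mem_preimage, Set.mem_ofPred_eq, Set.mem_Icc, hx.1, true_and]
        constructor <;> rintro ⟨h1, h2⟩ <;> exact ⟨h1, by linarith⟩
      rw [this, Real.volume_Icc, sub_zero]
    · rw [Set.indicator_of_notMem hx]
      have : Prod.mk x ⁻¹' s = ∅ := by
        ext y
        simp only [s, Set.mem_preimage, Set.mem_ofPred_eq, Set.mem_empty_iff_false, iff_false]
        rintro ⟨h1, h2, h3⟩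
        exact hx ⟨h1, by linarith⟩
      rw [this, measure_empty]
  simp_rw [hsec]
  rw [lintegral_indicator measurableSet_Icc, ← ofReal_integral_eq_lintegral_ofReal]
  · rw [integral_Icc_eq_integral_Ioc, ← intervalIntegral.integral_of_le zero_le_one]
    congr 1
    rw [intervalIntegral.integral_sub (by simp) (by simp)]
    simp; norm_num
  · exact (continuous_const.sub continuous_id).continuousOn.integrableOn_Icc
  · filter_upwards [self_mem_ae_restrict measurableSet_Icc] with x hx
    simpa using hx.2

theorem volume_convexHull_rot60 (z a : Plane) :
    volume (convexHull ℝ {z, z + a, z + rot60 a}) =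
      ENNReal.ofReal (Real.sqrt 3 / 4 * ‖a‖ ^ 2) := by
  let M : Plane →ₗ[ℝ] Plane :=
    { toFun := fun x => x 0 • a + x 1 • rot60 a
      map_add' := fun x y => by simp only [PiLp.add_apply]; module
      map_smul' := fun r x => by
        simp only [PiLp.smul_apply, smul_eq_mul, RingHom.id_apply]; module }
  have hdet : LinearMap.det M = Real.sqrt 3 / 2 * ‖a‖ ^ 2 := by
    rw [← LinearMap.det_toMatrix (EuclideanSpace.basisFun (Fin 2) ℝ).toBasis,
      Matrix.det_fin_two, norm_sq_plane, ← det_rot60]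
    simp [LinearMap.toMatrix_apply, M]
    ring
  have hset : convexHull ℝ {z, z + a, z + rot60 a} =
      (fun x => z + x) '' (M '' {x : Plane | 0 ≤ x 0 ∧ 0 ≤ x 1 ∧ x 0 + x 1 ≤ 1}) := by
    ext x
    rw [mem_convexHull_triple]
    simp only [Set.image_image, Set.mem_image, Set.mem_ofPred_eq]
    constructor
    · rintro ⟨α, β, h1, h2, h3, rfl⟩
      exact ⟨!₂[α, β], by simp [h1, h2, h3], by simp [M, add_assoc]⟩
    · rintro ⟨y, ⟨h1, h2, h3⟩, rfl⟩
      exact ⟨y 0, y 1, h1, h2, h3, by simp [M, add_assoc]⟩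
  rw [hset, Set.image_add_left, measure_preimage_add, Measure.addHaar_image_linearMap, hdet,
    volume_standard_triangle, ← ENNReal.ofReal_mul (abs_nonneg _), abs_of_nonneg (by positivity)]
  congr 1; ring

theorem norm_rot60 (v : Plane) : ‖rot60 v‖ = ‖v‖ := by
  have h3 : Real.sqrt 3 * Real.sqrt 3 = 3 := Real.mul_self_sqrt (by norm_num)
  rw [← sq_eq_sq₀ (norm_nonneg _) (norm_nonneg _), norm_sq_plane, norm_sq_plane]
  simp [rot60]
  linear_combination ((v 0 ^ 2 + v 1 ^ 2) / 4) * h3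

theorem norm_rot60_iterate (v : Plane) (k : ℕ) : ‖rot60^[k] v‖ = ‖v‖ := by
  induction k with
  | zero => rfl
  | succ k ih => rw [Function.iterate_succ_apply', norm_rot60, ih]

theorem volume_triangle (o v : Plane) (i : TriangleIndex) :
    volume (triangle o v i) = ENNReal.ofReal (Real.sqrt 3 / 4 * ‖v‖ ^ 2) := by
  rw [triangle, Function.iterate_succ_apply', volume_convexHull_rot60, norm_rot60_iterate]

theorem dist_le_of_mem_triangle {o v x : Plane} {i : TriangleIndex} (hx : x ∈ triangle o v i) :
    ‖x - hexCenter o v i.1‖ ≤ ‖v‖ := by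
  rw [triangle, mem_convexHull_triple] at hx
  obtain ⟨α, β, h1, h2, h3, rfl⟩ := hx
  rw [add_assoc, add_sub_cancel_left]
  refine (norm_add_le _ _).trans ?_
  rw [norm_smul, norm_smul, norm_rot60_iterate, norm_rot60_iterate, Real.norm_of_nonneg h1,
    Real.norm_of_nonneg h2, ← add_mul]
  exact mul_le_of_le_one_left (norm_nonneg _) h3

theorem lintegral_cellFun_const (o v : Plane) (w : TriangleIndex → ℝ≥0∞) :
    ∫⁻ x, cellFun o v (fun i _ => w i) x =
      ENNReal.ofReal (Real.sqrt 3 / 4 * ‖v‖ ^ 2) * ∑' i, w i := by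
  simp only [cellFun]
  rw [lintegral_tsum fun i =>
    (measurable_const.indicator (measurableSet_triangle o v i)).aemeasurable,
    ← ENNReal.tsum_mul_left]
  refine tsum_congr fun i => ?_
  rw [lintegral_indicator_const (measurableSet_triangle o v i), volume_triangle, mul_comm]

/-- Conservation of mass replaces a count: a unit density on one triangle is spread with density Λ⁻²
over the triangles listed in `offsets`, and all triangles have the same area. One concrete tiling
suffices, since the sets do not depend on the tiling. -/
theorem sum_card_offsets {Λ : ℕ} (hΛ : 0 < Λ) (k : Fin 6) :
    ∑ l, (offsets Λ k l).card = Λ ^ 2 := by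
  classical
  let v : Plane := !₂[1, 0]
  have hv : v ≠ 0 := by
    intro h
    have : v 0 = 0 := by rw [h]; rfl
    simp [v] at this
  have hpos : 0 < Real.sqrt 3 / 4 * ‖v‖ ^ 2 := by
    have := norm_pos_iff.2 hv
    positivity
  let w : TriangleIndex → ℝ≥0∞ := Pi.single (0, k) 1
  have hw : ∑' i, w i = 1 := by rw [tsum_pi_single]
  have key : ∫⁻ x, cellFun 0 v (fun i _ => w i) x =
      ∫⁻ x, cellFun 0 v (cellStep Λ 0 v fun i _ => w i) x := by
    have hm : ∀ i, Measurable ((triangle 0 v i).indicator fun _ => w i) := fun i =>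
      measurable_const.indicator (measurableSet_triangle 0 v i)
    have e : ∫⁻ x, cellFun 0 v (cellStep Λ 0 v fun i _ => w i) x = ∫⁻ x, ∑' i,
        ((Λ : ℝ≥0∞) ^ 2)⁻¹ * (triangle 0 v i).indicator (fun _ => w i)
          (contract Λ 0 v i.1 x) := by
      refine lintegral_congr_ae ?_
      filter_upwards [ae_mem_gridGeneric hv 0] with x hx
      obtain ⟨j, hj, -⟩ := existsUnique_triangle hv hx
      rw [cellFun_apply hv hx hj, tsum_indicator_contract hv hx hΛ hj]
    rw [e, lintegral_tsum (f := fun (i : TriangleIndex) x => ((Λ : ℝ≥0∞) ^ 2)⁻¹ *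
      (triangle 0 v i).indicator (fun _ => w i) (contract Λ 0 v i.1 x)) fun i =>
      (((hm i).comp (measurable_contract ..)).const_mul _).aemeasurable]
    simp only [cellFun]
    rw [lintegral_tsum fun i => (hm i).aemeasurable]
    refine tsum_congr fun i => ?_
    rw [lintegral_comp_contract hΛ 0 v i.1 (hm i), lintegral_const_mul]
    exact (hm i).comp (measurable_contract ..)
  have hstep : cellStep Λ 0 v (fun i _ => w i) = fun j _ =>
      ((Λ : ℝ≥0∞) ^ 2)⁻¹ * if j.1 ∈ offsets Λ k j.2 then 1 else 0 := by
    ext j x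
    simp only [cellStep]
    congr 1
    rw [Finset.sum_eq_single k]
    · have : ∀ y, w (j.1 - y, k) = if y = j.1 then 1 else 0 := by
        intro y
        simp only [w, Pi.single_apply, Prod.mk.injEq, and_true, sub_eq_zero, eq_comm]
      simp only [this, Finset.sum_ite_eq']
    · intro k' _ hk'
      exact Finset.sum_eq_zero fun y _ => by simp [w, hk']
    · simp
  rw [hstep, lintegral_cellFun_const, lintegral_cellFun_const, hw,
    ENNReal.mul_right_inj (by simpa using hpos) ENNReal.ofReal_ne_top, ENNReal.tsum_mul_left,
    ENNReal.tsum_prod (f := fun p l => if p ∈ offsets Λ k l then 1 else 0), ENNReal.tsum_comm,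
    tsum_fintype] at key
  have hin : ∀ l, ∑' p : ℤ × ℤ, (if p ∈ offsets Λ k l then (1 : ℝ≥0∞) else 0) =
      ((offsets Λ k l).card : ℝ≥0∞) := by
    intro l
    rw [tsum_eq_sum (s := offsets Λ k l) fun p hp => by simp [hp]]
    simp
  simp_rw [hin] at key
  have hne : ((Λ : ℝ≥0∞) ^ 2) ≠ 0 := by simp [hΛ.ne']
  have hne' : ((Λ : ℝ≥0∞) ^ 2) ≠ ⊤ := ENNReal.pow_ne_top (ENNReal.natCast_ne_top _)
  have := congrArg (fun r => (Λ : ℝ≥0∞) ^ 2 * r) key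
  simp only [mul_one, ← mul_assoc, ENNReal.mul_inv_cancel hne hne', one_mul] at this
  exact_mod_cast this.symm

/-! ### Sixfold symmetry and some distinguished offsets. -/

/-- Rotation by 60 degrees in the coordinates of the lattice of hexagon centres. -/
def latticeRot : ℤ × ℤ ≃ ℤ × ℤ where
  toFun y := (-y.2, y.1 + y.2)
  invFun y := (y.1 + y.2, -y.1)
  left_inv y := by ext <;> simp
  right_inv y := by ext <;> simp

theorem isOffset_rot (Λ : ℕ) (k l : Fin 6) (y : ℤ × ℤ) :
    IsOffset Λ (k + 1) (l + 1) (latticeRot y) ↔ IsOffset Λ k l y := by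
  obtain ⟨p, q⟩ := y
  rcases fin6_cases l with rfl | rfl | rfl | rfl | rfl | rfl <;>
  rcases fin6_cases k with rfl | rfl | rfl | rfl | rfl | rfl <;>
  simp [IsOffset, hexForm, baryS, baryT, latticeRot] <;> omega

theorem offsets_rot (Λ : ℕ) (k l : Fin 6) :
    offsets Λ (k + 1) (l + 1) = (offsets Λ k l).map latticeRot.toEmbedding := by
  ext y
  have := isOffset_rot Λ k l (latticeRot.symm y)
  rw [Equiv.apply_symm_apply] at this
  rw [Finset.mem_map_equiv, mem_offsets, mem_offsets, this]

theorem card_offsets_rot (Λ : ℕ) (k l d : Fin 6) :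
    (offsets Λ (k + d) (l + d)).card = (offsets Λ k l).card := by
  have h : ∀ n : ℕ, (offsets Λ (k + n • (1 : Fin 6)) (l + n • (1 : Fin 6))).card =
      (offsets Λ k l).card := by
    intro n
    induction n with
    | zero => simp
    | succ n ih =>
      rw [succ_nsmul, ← add_assoc, ← add_assoc, offsets_rot, Finset.card_map, ih]
  have hd : d.val • (1 : Fin 6) = d := by fin_cases d <;> rfl
  rw [← h d.val, hd]

/-- By rotation the count depends only on `l - k`, so column sums equal row sums. The type chain is
therefore doubly stochastic and preserves the uniform law on types. -/
theorem sum_card_offsets_left {Λ : ℕ} (hΛ : 0 < Λ) (l : Fin 6) :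
    ∑ k, (offsets Λ k l).card = Λ ^ 2 := by
  rw [← sum_card_offsets hΛ 0, ← (Equiv.subLeft l).sum_comp]
  refine Finset.sum_congr rfl fun k _ => ?_
  rw [← card_offsets_rot Λ 0 k (l - k)]
  simp

/-- The six shortest vectors of the lattice of hexagon centres. -/
def latticeDir : Fin 6 → ℤ × ℤ := ![(1, 0), (0, 1), (-1, 1), (-1, 0), (0, -1), (1, -1)]

/-- The hexagon around `latticeDir k` is inscribed in the triangle `(0, k)` stretched by 3, so all
six of its triangles are available once `3 ≤ Λ`. In particular every type is reached from every type
in one step. -/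
theorem latticeDir_mem_offsets {Λ : ℕ} (hΛ : 3 ≤ Λ) (k l : Fin 6) :
    latticeDir k ∈ offsets Λ k l := by
  rw [mem_offsets]
  rcases fin6_cases l with rfl | rfl | rfl | rfl | rfl | rfl <;>
  rcases fin6_cases k with rfl | rfl | rfl | rfl | rfl | rfl <;>
  simp [IsOffset, hexForm, baryS, baryT, latticeDir] <;> omega

theorem zero_mem_offsets {Λ : ℕ} (hΛ : 3 ≤ Λ) (k : Fin 6) : 0 ∈ offsets Λ k k := by
  rw [mem_offsets]
  rcases fin6_cases k with rfl | rfl | rfl | rfl | rfl | rfl <;>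
  simp [IsOffset, hexForm, baryS, baryT] <;> omega

/-- For `Λ = 3` this is the triangle at a corner of the stretched triangle. With the inscribed
hexagon it gives two triangles of type `k + 2` whose displacements differ by `latticeDir (k + 5)`.
-/
theorem latticeDir_add_mem_offsets {Λ : ℕ} (hΛ : 3 ≤ Λ) (k : Fin 6) :
    latticeDir k + latticeDir (k + 5) ∈ offsets Λ k (k + 2) := by
  rw [mem_offsets]
  rcases fin6_cases k with rfl | rfl | rfl | rfl | rfl | rfl <;>
  simp [IsOffset, hexForm, baryS, baryT, latticeDir] <;> omega

/-! ### Averages over one step of the chain. -/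

/-- The mean of `F` over the triangles that make up the triangle `(0, k)` stretched by `Λ`. -/
noncomputable def stepMean {E : Type*} [AddCommGroup E] [Module ℝ E] (Λ : ℕ) (k : Fin 6)
    (F : Fin 6 → ℤ × ℤ → E) : E :=
  ((Λ : ℝ) ^ 2)⁻¹ • ∑ l, ∑ y ∈ offsets Λ k l, F l y

section stepMean

variable {E : Type*} [AddCommGroup E] [Module ℝ E]

theorem stepMean_add (Λ : ℕ) (k : Fin 6) (F G : Fin 6 → ℤ × ℤ → E) :
    stepMean Λ k (fun l y => F l y + G l y) = stepMean Λ k F + stepMean Λ k G := by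
  simp only [stepMean, Finset.sum_add_distrib, smul_add]

theorem stepMean_sub (Λ : ℕ) (k : Fin 6) (F G : Fin 6 → ℤ × ℤ → E) :
    stepMean Λ k (fun l y => F l y - G l y) = stepMean Λ k F - stepMean Λ k G := by
  simp only [stepMean, Finset.sum_sub_distrib, smul_sub]

theorem stepMean_map {E' : Type*} [AddCommGroup E'] [Module ℝ E'] (Λ : ℕ) (k : Fin 6)
    (L : E →ₗ[ℝ] E') (F : Fin 6 → ℤ × ℤ → E) :
    stepMean Λ k (fun l y => L (F l y)) = L (stepMean Λ k F) := by
  simp only [stepMean, map_smul, map_sum]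

theorem stepMean_mul {A : Type*} [Ring A] [Algebra ℝ A] (Λ : ℕ) (k : Fin 6) (r : A)
    (F : Fin 6 → ℤ × ℤ → A) :
    stepMean Λ k (fun l y => r * F l y) = r * stepMean Λ k F :=
  stepMean_map Λ k (LinearMap.mulLeft ℝ r) F

theorem stepMean_const {Λ : ℕ} (hΛ : 0 < Λ) (k : Fin 6) (a : E) :
    stepMean Λ k (fun _ _ => a) = a := by
  have hr : ((Λ : ℝ) ^ 2) ≠ 0 := by positivity
  simp only [stepMean, Finset.sum_const, ← Finset.sum_smul, sum_card_offsets hΛ k]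
  rw [← Nat.cast_smul_eq_nsmul ℝ, smul_smul, Nat.cast_pow, inv_mul_cancel₀ hr, one_smul]

theorem stepMean_rot (Λ : ℕ) (k : Fin 6) (F : Fin 6 → ℤ × ℤ → E) :
    stepMean Λ (k + 1) F = stepMean Λ k (fun l y => F (l + 1) (latticeRot y)) := by
  simp only [stepMean]
  rw [← Fintype.sum_equiv (Equiv.addRight (1 : Fin 6)) _ _ fun _ => rfl]
  simp [offsets_rot]

theorem sum_stepMean {Λ : ℕ} (hΛ : 0 < Λ) (u : Fin 6 → E) :
    ∑ k, stepMean Λ k (fun l _ => u l) = ∑ l, u l := by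
  have hr : ((Λ : ℝ) ^ 2) ≠ 0 := by positivity
  simp only [stepMean, Finset.sum_const, ← Finset.smul_sum]
  rw [Finset.sum_comm]
  simp only [← Finset.sum_smul, sum_card_offsets_left hΛ]
  rw [← Finset.smul_sum, ← Nat.cast_smul_eq_nsmul ℝ, smul_smul, Nat.cast_pow, inv_mul_cancel₀ hr,
    one_smul]

end stepMean

theorem norm_stepMean_le {E : Type*} [NormedAddCommGroup E] [NormedSpace ℝ E] {Λ : ℕ} (hΛ : 0 < Λ)
    (k : Fin 6) {F : Fin 6 → ℤ × ℤ → E} {M : ℝ} (h : ∀ l, ∀ y ∈ offsets Λ k l, ‖F l y‖ ≤ M) :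
    ‖stepMean Λ k F‖ ≤ M := by
  have h1 := stepMean_const hΛ k M
  rw [← h1, stepMean, stepMean, norm_smul, smul_eq_mul, Real.norm_of_nonneg (by positivity)]
  gcongr
  refine norm_sum_le_of_le _ fun l _ => norm_sum_le_of_le _ fun y hy => h l y hy

/-! ### Fourier series over the lattice of centres. -/

/-- The pairing of a lattice point with a frequency. -/
def phase (y : ℤ × ℤ) (θ : ℝ × ℝ) : ℝ := y.1 * θ.1 + y.2 * θ.2

theorem phase_add (y z : ℤ × ℤ) (θ : ℝ × ℝ) : phase (y + z) θ = phase y θ + phase z θ := by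
  simp only [phase, Prod.fst_add, Prod.snd_add, Int.cast_add]; ring

theorem phase_smul (y : ℤ × ℤ) (r : ℝ) (θ : ℝ × ℝ) : phase y (r • θ) = r * phase y θ := by
  simp only [phase, Prod.smul_fst, Prod.smul_snd, smul_eq_mul]; ring

/-- The character of the lattice with frequency `θ`. -/
noncomputable def latticeChar (θ : ℝ × ℝ) (y : ℤ × ℤ) : ℂ := Complex.exp (phase y θ * Complex.I)

theorem norm_latticeChar (θ : ℝ × ℝ) (y : ℤ × ℤ) : ‖latticeChar θ y‖ = 1 :=
  Complex.norm_exp_ofReal_mul_I _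

theorem latticeChar_add (θ : ℝ × ℝ) (y z : ℤ × ℤ) :
    latticeChar θ (y + z) = latticeChar θ y * latticeChar θ z := by
  rw [latticeChar, phase_add, Complex.ofReal_add, add_mul, Complex.exp_add]; rfl

/-- The transition operator twisted by a character. -/
noncomputable def charOp (Λ : ℕ) (θ : ℝ × ℝ) (u : Fin 6 → ℂ) (k : Fin 6) : ℂ :=
  stepMean Λ k fun l y => latticeChar θ y * u l

/-- The Fourier series of the weights of the triangles of type `l`. -/
noncomputable def weightFourier (w : TriangleIndex → ℝ≥0) (θ : ℝ × ℝ) (l : Fin 6) : ℂ :=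
  ∑' p : ℤ × ℤ, ((w (p, l) : ℝ) : ℂ) * latticeChar θ p

theorem summable_type {w : TriangleIndex → ℝ≥0} (hw : Summable w) (l : Fin 6) :
    Summable fun p : ℤ × ℤ => (w (p, l) : ℝ) := by
  have : Summable fun p : ℤ × ℤ => w (p, l) :=
    NNReal.summable_comp_injective hw (i := fun p : ℤ × ℤ => (p, l))
      fun p q h => (Prod.mk.inj h).1
  exact_mod_cast this

theorem summable_weightFourier {w : TriangleIndex → ℝ≥0} (hw : Summable w) (θ : ℝ × ℝ)
    (l : Fin 6) : Summable fun p : ℤ × ℤ => ((w (p, l) : ℝ) : ℂ) * latticeChar θ p := by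
  refine Summable.of_norm ?_
  simp only [norm_mul, norm_latticeChar, mul_one, Complex.norm_real, NNReal.norm_eq]
  exact summable_type hw l

/-- By translation invariance `weightStep` is a matrix-valued convolution, so on Fourier series it
is multiplication by the transpose of `charOp Λ θ`. Pairing with a test vector `u` lets the
iteration act on `u`. -/
theorem weightFourier_step {w : TriangleIndex → ℝ≥0} (hw : Summable w) (Λ : ℕ) (θ : ℝ × ℝ)
    (u : Fin 6 → ℂ) :
    ∑ l, weightFourier (weightStep Λ w) θ l * u l =
      ∑ k, weightFourier w θ k * charOp Λ θ u k := by
  have key : ∀ l, weightFourier (weightStep Λ w) θ l =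
      ((Λ : ℂ) ^ 2)⁻¹ * ∑ k, ∑ y ∈ offsets Λ k l, latticeChar θ y * weightFourier w θ k := by
    intro l
    have hs : ∀ k y, HasSum (fun p : ℤ × ℤ => ((w (p - y, k) : ℝ) : ℂ) * latticeChar θ p)
        (latticeChar θ y * weightFourier w θ k) := by
      intro k y
      have := ((summable_weightFourier hw θ k).hasSum.mul_left (latticeChar θ y))
      rw [← (Equiv.subRight y).hasSum_iff] at this
      refine this.congr_fun fun p => ?_
      have hp : latticeChar θ p = latticeChar θ (p - y) * latticeChar θ y := by
        rw [← latticeChar_add, sub_add_cancel]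
      simp only [Function.comp, Equiv.subRight_apply]
      rw [hp]; ring
    have := (hasSum_sum fun k (_ : k ∈ Finset.univ) =>
      hasSum_sum fun y (_ : y ∈ offsets Λ k l) => hs k y).mul_left (((Λ : ℂ) ^ 2)⁻¹)
    rw [← this.tsum_eq, weightFourier]
    refine tsum_congr fun p => ?_
    simp only [weightStep, ← Finset.sum_mul]
    push_cast
    ring
  simp only [key, charOp, stepMean, Complex.real_smul, Finset.mul_sum, Finset.sum_mul]
  rw [Finset.sum_comm]
  refine Finset.sum_congr rfl fun k _ => Finset.sum_congr rfl fun l _ =>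
    Finset.sum_congr rfl fun y _ => ?_
  push_cast
  ring

theorem summable_weightStep {w : TriangleIndex → ℝ≥0} (hw : Summable w) (Λ : ℕ) :
    Summable (weightStep Λ w) := by
  have h1 : ∀ l : Fin 6, Summable fun p : ℤ × ℤ => weightStep Λ w (p, l) := by
    intro l
    simp only [weightStep]
    refine Summable.mul_left _ (summable_sum fun k _ => summable_sum fun y _ => ?_)
    exact NNReal.summable_comp_injective hw (i := fun p : ℤ × ℤ => (p - y, k)) fun p q h => by
      simpa using h
  rw [← (Equiv.prodComm _ _).summable_iff, ← NNReal.summable_coe,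
    summable_prod_of_nonneg fun _ => NNReal.coe_nonneg _]
  exact ⟨fun l => by exact_mod_cast h1 l, Summable.of_finite⟩

theorem summable_weightStep_iterate {w : TriangleIndex → ℝ≥0} (hw : Summable w) (Λ n : ℕ) :
    Summable ((weightStep Λ)^[n] w) := by
  induction n with
  | zero => exact hw
  | succ n ih => rw [Function.iterate_succ_apply']; exact summable_weightStep ih Λ

theorem weightFourier_iterate {w : TriangleIndex → ℝ≥0} (hw : Summable w) (Λ n : ℕ) (θ : ℝ × ℝ)
    (u : Fin 6 → ℂ) :
    ∑ l, weightFourier ((weightStep Λ)^[n] w) θ l * u l =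
      ∑ k, weightFourier w θ k * (charOp Λ θ)^[n] u k := by
  induction n generalizing u with
  | zero => rfl
  | succ n ih =>
    rw [Function.iterate_succ_apply', weightFourier_step (summable_weightStep_iterate hw Λ n), ih,
      Function.iterate_succ_apply]

theorem weightFourier_iterate_apply {w : TriangleIndex → ℝ≥0} (hw : Summable w) (Λ n : ℕ)
    (θ : ℝ × ℝ) (l : Fin 6) :
    weightFourier ((weightStep Λ)^[n] w) θ l =
      ∑ k, weightFourier w θ k * (charOp Λ θ)^[n] (Pi.single l 1) k := by
  rw [← weightFourier_iterate hw]
  simp [Pi.single_apply]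

/-! ### Decay of the twisted operator on the whole dual cell. -/

/-- With d = 1 - cos α the squared modulus is 4 - 2d, at most (2 - d/2)². -/
theorem norm_one_add_exp_le (α : ℝ) :
    ‖1 + Complex.exp (α * Complex.I)‖ ≤ 2 - (1 - Real.cos α) / 2 := by
  have h1 := Real.neg_one_le_cos α
  have h2 := Real.cos_le_one α
  refine le_of_sq_le_sq ?_ (by linarith)
  rw [← Complex.normSq_eq_norm_sq, Complex.normSq_apply, Complex.add_re, Complex.add_im,
    Complex.exp_ofReal_mul_I_re, Complex.exp_ofReal_mul_I_im, Complex.one_re, Complex.one_im]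
  nlinarith [Real.sin_sq_add_cos_sq α]

/-- This is |1 - zw|² ≤ 2|1 - z|² + 2|1 - w|² for z and w on the unit circle. -/
theorem one_sub_cos_add_le (α β : ℝ) :
    1 - Real.cos (α + β) ≤ 2 * (1 - Real.cos α) + 2 * (1 - Real.cos β) := by
  rw [Real.cos_add]
  nlinarith [Real.sin_sq_add_cos_sq α, Real.sin_sq_add_cos_sq β,
    sq_nonneg (Real.sin α - Real.sin β), sq_nonneg (2 - Real.cos α - Real.cos β)]

/-- Two neighbouring directions generate the lattice, so control of their phases controls both
coordinates of θ. On [-π, π] one has 1 - cos x ≥ 2x²/π², and passing to the two coordinates costs a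
factor of at most 3. -/
theorem one_sub_cos_dir_ge {θ : ℝ × ℝ} (h1 : |θ.1| ≤ Real.pi) (h2 : |θ.2| ≤ Real.pi)
    (k : Fin 6) : 2 / (3 * Real.pi ^ 2) * (θ.1 ^ 2 + θ.2 ^ 2) ≤
      (1 - Real.cos (phase (latticeDir k) θ)) + (1 - Real.cos (phase (latticeDir (k + 5)) θ)) := by
  have e1 := Real.cos_le_one_sub_mul_cos_sq h1
  have e2 := Real.cos_le_one_sub_mul_cos_sq h2
  have c1 := Real.cos_le_one θ.1
  have c2 := Real.cos_le_one θ.2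
  have a1 := one_sub_cos_add_le θ.1 (-(θ.1 - θ.2))
  have a2 := one_sub_cos_add_le θ.2 (θ.1 - θ.2)
  have c3 := Real.cos_le_one (θ.1 - θ.2)
  rw [Real.cos_neg, neg_sub, add_sub_cancel] at a1
  rw [add_sub_cancel] at a2
  have e3 : 2 / (3 * Real.pi ^ 2) * (θ.1 ^ 2 + θ.2 ^ 2) =
      (2 / Real.pi ^ 2 * θ.1 ^ 2 + 2 / Real.pi ^ 2 * θ.2 ^ 2) / 3 := by
    field_simp
  rw [e3]
  have hc : Real.cos (-θ.1 + θ.2) = Real.cos (θ.1 - θ.2) := by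
    rw [← Real.cos_neg]; congr 1; ring
  have hd : Real.cos (θ.1 + -θ.2) = Real.cos (θ.1 - θ.2) := by rw [sub_eq_add_neg]
  rcases fin6_cases k with rfl | rfl | rfl | rfl | rfl | rfl <;>
  simp [phase, latticeDir, hc, hd] <;> linarith

theorem norm_sum_le_card_sub_two {s : Finset (ℤ × ℤ)} {a b : ℤ × ℤ} (ha : a ∈ s) (hb : b ∈ s)
    (hab : a ≠ b) {F : ℤ × ℤ → ℂ} (hF : ∀ y, ‖F y‖ = 1) :
    ‖∑ y ∈ s, F y‖ ≤ s.card - 2 + ‖F a + F b‖ := by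
  classical
  have hsub : {a, b} ⊆ s := by
    intro y hy
    simp only [Finset.mem_insert, Finset.mem_singleton] at hy
    rcases hy with rfl | rfl <;> assumption
  rw [← Finset.sum_sdiff hsub, Finset.sum_pair hab]
  refine (norm_add_le _ _).trans (add_le_add_left ?_ _)
  refine (norm_sum_le _ _).trans ?_
  simp only [hF, Finset.sum_const, nsmul_eq_mul, mul_one]
  rw [Finset.card_sdiff_of_subset hsub, Finset.card_pair hab, Nat.cast_sub, Nat.cast_two]
  rw [← Finset.card_pair hab]
  exact Finset.card_le_card hsub

theorem latticeDir_ne_zero (k : Fin 6) : latticeDir k ≠ 0 := by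
  rcases fin6_cases k with rfl | rfl | rfl | rfl | rfl | rfl <;> simp [latticeDir]

/-- The triangle inequality is improved in two places: in type `k` by the displacements 0 and
`latticeDir k`, and in type `k + 2` by two displacements differing by `latticeDir (k + 5)`. Only
moduli of the sums over each type are used, so the gain holds for every vector `u` in
`norm_charOp_le`. -/
theorem sum_norm_char_le {Λ : ℕ} (hΛ : 3 ≤ Λ) {θ : ℝ × ℝ} (h1 : |θ.1| ≤ Real.pi)
    (h2 : |θ.2| ≤ Real.pi) (k : Fin 6) :
    ∑ l, ‖∑ y ∈ offsets Λ k l, latticeChar θ y‖ ≤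
      (Λ : ℝ) ^ 2 - (θ.1 ^ 2 + θ.2 ^ 2) / (3 * Real.pi ^ 2) := by
  have hn := norm_latticeChar θ
  have b1 : ‖∑ y ∈ offsets Λ k k, latticeChar θ y‖ ≤
      (offsets Λ k k).card - (1 - Real.cos (phase (latticeDir k) θ)) / 2 := by
    have h := norm_sum_le_card_sub_two (zero_mem_offsets hΛ k) (latticeDir_mem_offsets hΛ k k)
      (latticeDir_ne_zero k).symm hn
    have h' := norm_one_add_exp_le (phase (latticeDir k) θ)
    have h0 : latticeChar θ 0 = 1 := by simp [latticeChar, phase]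
    rw [h0] at h
    rw [latticeChar] at h
    linarith
  have b2 : ‖∑ y ∈ offsets Λ k (k + 2), latticeChar θ y‖ ≤ (offsets Λ k (k + 2)).card -
      (1 - Real.cos (phase (latticeDir (k + 5)) θ)) / 2 := by
    have h := norm_sum_le_card_sub_two (latticeDir_mem_offsets hΛ k (k + 2))
      (latticeDir_add_mem_offsets hΛ k) (by simpa using latticeDir_ne_zero (k + 5)) hn
    have h' := norm_one_add_exp_le (phase (latticeDir (k + 5)) θ)
    rw [latticeChar_add, ← mul_one_add, norm_mul, hn, one_mul, latticeChar.eq_1 θ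
      (latticeDir (k + 5))] at h
    linarith
  have b3 : ∀ l, ‖∑ y ∈ offsets Λ k l, latticeChar θ y‖ ≤ (offsets Λ k l).card := fun l => by
    refine (norm_sum_le _ _).trans ?_
    simp [hn]
  have hk : k ≠ k + 2 := by
    rcases fin6_cases k with rfl | rfl | rfl | rfl | rfl | rfl <;> decide
  have hcard : ∑ l, ((offsets Λ k l).card : ℝ) = (Λ : ℝ) ^ 2 := by
    exact_mod_cast sum_card_offsets (by omega : 0 < Λ) k
  have hdir := one_sub_cos_dir_ge h1 h2 k
  have hb : ∑ l, (((offsets Λ k l).card : ℝ) - ‖∑ y ∈ offsets Λ k l, latticeChar θ y‖) ≥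
      (1 - Real.cos (phase (latticeDir k) θ)) / 2 +
      (1 - Real.cos (phase (latticeDir (k + 5)) θ)) / 2 := by
    have := Finset.sum_le_sum_of_subset_of_nonneg (Finset.subset_univ ({k, k + 2} : Finset (Fin 6)))
      (f := fun l => ((offsets Λ k l).card : ℝ) - ‖∑ y ∈ offsets Λ k l, latticeChar θ y‖)
      fun l _ _ => sub_nonneg.2 (b3 l)
    rw [Finset.sum_pair hk] at this
    linarith
  rw [Finset.sum_sub_distrib, hcard] at hb
  have e : 2 / (3 * Real.pi ^ 2) * (θ.1 ^ 2 + θ.2 ^ 2) =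
      2 * ((θ.1 ^ 2 + θ.2 ^ 2) / (3 * Real.pi ^ 2)) := by ring
  linarith

theorem norm_charOp_le {Λ : ℕ} (hΛ : 3 ≤ Λ) {θ : ℝ × ℝ} (h1 : |θ.1| ≤ Real.pi)
    (h2 : |θ.2| ≤ Real.pi) {u : Fin 6 → ℂ} {M : ℝ} (hu : ∀ l, ‖u l‖ ≤ M) (k : Fin 6) :
    ‖charOp Λ θ u k‖ ≤
      Real.exp (-((θ.1 ^ 2 + θ.2 ^ 2) / (3 * Real.pi ^ 2 * (Λ : ℝ) ^ 2))) * M := by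
  have hM : 0 ≤ M := (norm_nonneg _).trans (hu 0)
  have hΛ0 : (0 : ℝ) < (Λ : ℝ) ^ 2 := by
    have : (0 : ℝ) < Λ := by exact_mod_cast (by omega : 0 < Λ)
    positivity
  have hs := sum_norm_char_le hΛ h1 h2 k
  calc ‖charOp Λ θ u k‖
      ≤ ((Λ : ℝ) ^ 2)⁻¹ * ∑ l, ‖∑ y ∈ offsets Λ k l, latticeChar θ y‖ * M := by
        rw [charOp, stepMean, norm_smul, Real.norm_of_nonneg (by positivity)]
        gcongr
        refine norm_sum_le_of_le _ fun l _ => ?_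
        rw [← Finset.sum_mul, norm_mul]
        gcongr
        exact hu l
    _ ≤ ((Λ : ℝ) ^ 2)⁻¹ * (((Λ : ℝ) ^ 2 - (θ.1 ^ 2 + θ.2 ^ 2) / (3 * Real.pi ^ 2)) * M) := by
        rw [← Finset.sum_mul]
        gcongr
    _ = (1 - (θ.1 ^ 2 + θ.2 ^ 2) / (3 * Real.pi ^ 2 * (Λ : ℝ) ^ 2)) * M := by
        have := Real.pi_pos
        field_simp
    _ ≤ _ := by
        gcongr
        have := Real.add_one_le_exp (-((θ.1 ^ 2 + θ.2 ^ 2) / (3 * Real.pi ^ 2 * (Λ : ℝ) ^ 2)))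
        linarith

theorem norm_charOp_iterate_le {Λ : ℕ} (hΛ : 3 ≤ Λ) {θ : ℝ × ℝ} (h1 : |θ.1| ≤ Real.pi)
    (h2 : |θ.2| ≤ Real.pi) {u : Fin 6 → ℂ} {M : ℝ} (hu : ∀ l, ‖u l‖ ≤ M) (n : ℕ) (k : Fin 6) :
    ‖(charOp Λ θ)^[n] u k‖ ≤
      Real.exp (-(n * ((θ.1 ^ 2 + θ.2 ^ 2) / (3 * Real.pi ^ 2 * (Λ : ℝ) ^ 2)))) * M := by
  induction n generalizing k with
  | zero => simpa using hu k
  | succ n ih =>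
    rw [Function.iterate_succ_apply']
    refine (norm_charOp_le hΛ h1 h2 ih k).trans_eq ?_
    rw [← mul_assoc, ← Real.exp_add]
    congr 2
    push_cast; ring

/-! ### Mixing of the six types and the Poisson equation. -/

/-- Doeblin's argument: each type occurs at least once among the Λ² triangles, and removing one of
each does not change the sum when `u` has sum zero. Only Λ² - 6 terms remain. -/
theorem norm_stepMean_le_of_sum_eq_zero {E : Type*} [NormedAddCommGroup E] [NormedSpace ℝ E]
    {Λ : ℕ} (hΛ : 3 ≤ Λ) {u : Fin 6 → E} (hu : ∑ l, u l = 0) {M : ℝ} (hM : ∀ l, ‖u l‖ ≤ M)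
    (k : Fin 6) : ‖stepMean Λ k fun l _ => u l‖ ≤ (1 - 6 / (Λ : ℝ) ^ 2) * M := by
  have hΛ0 : (0 : ℝ) < (Λ : ℝ) ^ 2 := by
    have : (0 : ℝ) < Λ := by exact_mod_cast (by omega : 0 < Λ)
    positivity
  have h1 : (stepMean Λ k fun l _ => u l) =
      ((Λ : ℝ) ^ 2)⁻¹ • ∑ l, (((offsets Λ k l).card : ℝ) - 1) • u l := by
    simp only [stepMean, Finset.sum_const, sub_smul, one_smul, Finset.sum_sub_distrib, hu, sub_zero,
      Nat.cast_smul_eq_nsmul]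
  have hcard : ∑ l, ((offsets Λ k l).card : ℝ) = (Λ : ℝ) ^ 2 := by
    exact_mod_cast sum_card_offsets (by omega : 0 < Λ) k
  have hc : ∀ l, (0 : ℝ) ≤ ((offsets Λ k l).card : ℝ) - 1 := fun l => by
    rw [sub_nonneg, Nat.one_le_cast, Nat.one_le_iff_ne_zero]
    exact Finset.card_ne_zero_of_mem (latticeDir_mem_offsets hΛ k l)
  rw [h1, norm_smul, Real.norm_of_nonneg (by positivity)]
  calc ((Λ : ℝ) ^ 2)⁻¹ * ‖∑ l, (((offsets Λ k l).card : ℝ) - 1) • u l‖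
      ≤ ((Λ : ℝ) ^ 2)⁻¹ * ∑ l, (((offsets Λ k l).card : ℝ) - 1) * M := by
        gcongr
        refine norm_sum_le_of_le _ fun l _ => ?_
        rw [norm_smul, Real.norm_of_nonneg (hc l)]
        exact mul_le_mul_of_nonneg_left (hM l) (hc l)
    _ = (1 - 6 / (Λ : ℝ) ^ 2) * M := by
        rw [← Finset.sum_mul, Finset.sum_sub_distrib, hcard]
        simp only [Finset.sum_const, Finset.card_univ, Fintype.card_fin, nsmul_eq_mul, mul_one]
        push_cast
        field_simp

theorem eq_zero_of_stepMean_eq {Λ : ℕ} (hΛ : 3 ≤ Λ) {u : Fin 6 → ℝ} (hu : ∑ l, u l = 0)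
    (h : ∀ k, stepMean Λ k (fun l _ => u l) = u k) : u = 0 := by
  have h1 := fun k => norm_stepMean_le_of_sum_eq_zero hΛ hu (norm_le_pi_norm u) k
  simp only [h] at h1
  have hΛ0 : (0 : ℝ) < (Λ : ℝ) ^ 2 := by
    have : (0 : ℝ) < Λ := by exact_mod_cast (by omega : 0 < Λ)
    positivity
  have h2 : ‖u‖ ≤ (1 - 6 / (Λ : ℝ) ^ 2) * ‖u‖ := by
    obtain ⟨k, hk⟩ := Finite.exists_max fun l => ‖u l‖
    have : ‖u‖ ≤ ‖u k‖ := (pi_norm_le_iff_of_nonneg (norm_nonneg _)).2 hk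
    exact this.trans (h1 k)
  have h3 : 0 < 6 / (Λ : ℝ) ^ 2 := by positivity
  have : ‖u‖ ≤ 0 := by nlinarith
  exact norm_le_zero_iff.1 this

/-- The Poisson equation of the chain of types. -/
theorem exists_sub_stepMean_eq {Λ : ℕ} (hΛ : 3 ≤ Λ) {x : Fin 6 → ℝ} (hx : ∑ k, x k = 0) :
    ∃ a : Fin 6 → ℝ, ∀ k, a k - stepMean Λ k (fun l _ => a l) = x k := by
  have hΛ' : 0 < Λ := by omega
  -- The added sum removes the kernel of constants. Double stochasticity gives that the sum of `L u`
  -- is six times the sum of `u`, so a right-hand side of sum zero has a solution of sum zero, on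
  -- which the added term vanishes.
  let L : (Fin 6 → ℝ) →ₗ[ℝ] (Fin 6 → ℝ) :=
    { toFun := fun u k => u k - stepMean Λ k (fun l _ => u l) + ∑ l, u l
      map_add' := fun u v => by
        ext k
        simp only [Pi.add_apply, stepMean_add, Finset.sum_add_distrib]
        ring
      map_smul' := fun r u => by
        ext k
        simp only [Pi.smul_apply, smul_eq_mul, stepMean_mul, ← Finset.mul_sum, RingHom.id_apply]
        ring }
  have hsum : ∀ u, ∑ k, L u k = 6 * ∑ l, u l := by
    intro u
    have := sum_stepMean hΛ' u
    simp only [L, LinearMap.coe_mk, AddHom.coe_mk, Finset.sum_add_distrib, Finset.sum_sub_distrib,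
      this]
    simp
  have hinj : Function.Injective L := by
    rw [← LinearMap.ker_eq_bot, LinearMap.ker_eq_bot']
    intro u hu
    have h0 : ∑ l, u l = 0 := by
      have := hsum u
      rw [hu] at this
      simp only [Pi.zero_apply, Finset.sum_const_zero] at this
      linarith
    refine eq_zero_of_stepMean_eq hΛ h0 fun k => ?_
    have := congrFun hu k
    simp only [L, LinearMap.coe_mk, AddHom.coe_mk, h0, Pi.zero_apply] at this
    linarith
  obtain ⟨a, ha⟩ := LinearMap.injective_iff_surjective.1 hinj x
  refine ⟨a, fun k => ?_⟩
  have h0 : ∑ l, a l = 0 := by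
    have := hsum a
    rw [ha, hx] at this
    linarith
  have := congrFun ha k
  simp only [L, LinearMap.coe_mk, AddHom.coe_mk, h0] at this
  linarith

theorem charOp_sub (Λ : ℕ) (θ : ℝ × ℝ) (u v : Fin 6 → ℂ) :
    charOp Λ θ (u - v) = charOp Λ θ u - charOp Λ θ v := by
  ext k
  simp only [charOp, Pi.sub_apply, mul_sub, stepMean_sub]

theorem charOp_smul (Λ : ℕ) (θ : ℝ × ℝ) (r : ℂ) (u : Fin 6 → ℂ) :
    charOp Λ θ (r • u) = r • charOp Λ θ u := by
  ext k
  simp only [charOp, Pi.smul_apply, smul_eq_mul, mul_left_comm _ r, stepMean_mul]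

theorem norm_charOp_le_norm {Λ : ℕ} (hΛ : 0 < Λ) (θ : ℝ × ℝ) (u : Fin 6 → ℂ) :
    ‖charOp Λ θ u‖ ≤ ‖u‖ := by
  refine (pi_norm_le_iff_of_nonneg (norm_nonneg _)).2 fun k => norm_stepMean_le hΛ k fun l y _ => ?_
  rw [norm_mul, norm_latticeChar, one_mul]
  exact norm_le_pi_norm u l

theorem charOp_iterate_sub (Λ : ℕ) (θ : ℝ × ℝ) (n : ℕ) (u v : Fin 6 → ℂ) :
    (charOp Λ θ)^[n] (u - v) = (charOp Λ θ)^[n] u - (charOp Λ θ)^[n] v := by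
  induction n with
  | zero => rfl
  | succ n ih => simp only [Function.iterate_succ_apply', ih, charOp_sub]

theorem charOp_iterate_smul (Λ : ℕ) (θ : ℝ × ℝ) (n : ℕ) (r : ℂ) (u : Fin 6 → ℂ) :
    (charOp Λ θ)^[n] (r • u) = r • (charOp Λ θ)^[n] u := by
  induction n with
  | zero => rfl
  | succ n ih => simp only [Function.iterate_succ_apply', ih, charOp_smul]

theorem norm_charOp_iterate_le_norm {Λ : ℕ} (hΛ : 0 < Λ) (θ : ℝ × ℝ) (n : ℕ) (u : Fin 6 → ℂ) :
    ‖(charOp Λ θ)^[n] u‖ ≤ ‖u‖ := by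
  induction n with
  | zero => rfl
  | succ n ih =>
    rw [Function.iterate_succ_apply']; exact (norm_charOp_le_norm hΛ θ _).trans ih

theorem charOp_zero_apply (Λ : ℕ) (u : Fin 6 → ℂ) (k : Fin 6) :
    charOp Λ 0 u k = stepMean Λ k fun l _ => u l := by
  simp [charOp, latticeChar, phase]

theorem tendsto_charOp_zero_iterate {Λ : ℕ} (hΛ : 3 ≤ Λ) (u : Fin 6 → ℂ) :
    Tendsto (fun j : ℕ => (charOp Λ 0)^[j] u) atTop (𝓝 fun _ => (∑ l, u l) / 6) := by
  have hΛ' : 0 < Λ := by omega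
  have hΛ9 : (9 : ℝ) ≤ (Λ : ℝ) ^ 2 := by
    have : (3 : ℝ) ≤ Λ := by exact_mod_cast hΛ
    nlinarith
  set m := (∑ l, u l) / 6 with hm
  set r := 1 - 6 / (Λ : ℝ) ^ 2 with hr
  have hr0 : 0 ≤ r := by
    rw [hr, sub_nonneg, div_le_one (by linarith)]; linarith
  have hr1 : r < 1 := by
    have : 0 < 6 / (Λ : ℝ) ^ 2 := by positivity
    linarith
  have hsum : ∀ j, ∑ l, (charOp Λ 0)^[j] u l = ∑ l, u l := by
    intro j
    induction j with
    | zero => rfl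
    | succ j ih =>
      simp only [Function.iterate_succ_apply', charOp_zero_apply, sum_stepMean hΛ', ih]
  have hb : ∀ j k, ‖(charOp Λ 0)^[j] u k - m‖ ≤ r ^ j * ‖u - fun _ => m‖ := by
    intro j
    induction j with
    | zero =>
      intro k
      rw [pow_zero, one_mul]
      exact norm_le_pi_norm (u - fun _ => m) k
    | succ j ih =>
      intro k
      have h0 : ∑ l, ((charOp Λ 0)^[j] u l - m) = 0 := by
        rw [Finset.sum_sub_distrib, hsum, hm]; simp; ring
      have := norm_stepMean_le_of_sum_eq_zero hΛ h0 ih k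
      rw [stepMean_sub, stepMean_const hΛ'] at this
      rw [Function.iterate_succ_apply', charOp_zero_apply, pow_succ']
      exact this.trans_eq (by ring)
  rw [tendsto_pi_nhds]
  intro k
  rw [tendsto_iff_norm_sub_tendsto_zero]
  refine squeeze_zero (fun _ => norm_nonneg _) (fun j => hb j k) ?_
  simpa using (tendsto_pow_atTop_nhds_zero_of_lt_one hr0 hr1).mul_const ‖u - fun _ => m‖

/-! ### Expansion near frequency zero and the central limit theorem. -/

theorem continuous_latticeChar (y : ℤ × ℤ) : Continuous fun θ => latticeChar θ y := by
  unfold latticeChar phase; fun_prop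

theorem continuous_charOp_iterate (Λ n : ℕ) (u : Fin 6 → ℂ) :
    Continuous fun θ => (charOp Λ θ)^[n] u := by
  induction n with
  | zero => exact continuous_const
  | succ n ih =>
    simp only [Function.iterate_succ_apply']
    refine continuous_pi fun k => ?_
    simp only [charOp, stepMean]
    refine Continuous.const_smul (continuous_finsetSum _ fun l _ => continuous_finsetSum _ fun y _ => ?_) _
    exact (continuous_latticeChar y).mul ((continuous_apply l).comp ih)

theorem isBigO_exp_expansion (δ b : ℝ) :
    (fun s : ℝ => Complex.exp ((s * δ : ℝ) * Complex.I) * (1 + s ^ 2 * b) -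
      (1 + s * δ * Complex.I + s ^ 2 * (b - δ ^ 2 / 2))) =O[𝓝 0] fun s : ℝ => s ^ 3 := by
  have h0 : Tendsto (fun s : ℝ => ((s * δ : ℝ) : ℂ) * Complex.I) (𝓝 0) (𝓝 0) := by
    have : Continuous fun s : ℝ => ((s * δ : ℝ) : ℂ) * Complex.I := by fun_prop
    simpa using this.tendsto 0
  have h1 := (Complex.exp_sub_sum_range_isBigO_pow 3).comp_tendsto h0
  have h2 : (fun s : ℝ => (((s * δ : ℝ) : ℂ) * Complex.I) ^ 3) =O[𝓝 0] fun s : ℝ => s ^ 3 := by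
    refine Asymptotics.IsBigO.of_bound (|δ| ^ 3) (Eventually.of_forall fun s => ?_)
    simp [mul_pow, mul_comm]
  have h3 := h1.trans h2
  have hb : (fun s : ℝ => (1 + (s : ℂ) ^ 2 * b)) =O[𝓝 0] fun _ : ℝ => (1 : ℝ) := by
    have : Continuous fun s : ℝ => (1 + (s : ℂ) ^ 2 * b) := by fun_prop
    exact (this.tendsto 0).isBigO_one ℝ
  have h4 := h3.mul hb
  have hc : (fun s : ℝ => (s : ℂ) ^ 3) =O[𝓝 0] fun s : ℝ => s ^ 3 :=
    Asymptotics.IsBigO.of_bound 1 (Eventually.of_forall fun s => by simp)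
  -- These are the terms of order three and four in the product of the quadratic Taylor polynomial
  -- with 1 + s²b, divided by s³.
  have hd : (fun s : ℝ => b * (δ * Complex.I - s * δ ^ 2 / 2)) =O[𝓝 0] fun _ : ℝ => (1 : ℝ) := by
    have : Continuous fun s : ℝ => b * (δ * Complex.I - s * δ ^ 2 / 2) := by fun_prop
    exact (this.tendsto 0).isBigO_one ℝ
  have h5 := h4.add (hc.mul hd)
  simp only [mul_one] at h5
  refine h5.congr_left fun s => ?_
  simp only [Function.comp, Finset.sum_range_succ, Finset.sum_range_zero, Nat.factorial]
  push_cast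
  simp only [mul_pow, Complex.I_sq]
  ring

theorem IsBigO_stepMean {Λ : ℕ} {k : Fin 6} {F : ℝ → Fin 6 → ℤ × ℤ → ℂ} {g : ℝ → ℝ}
    (h : ∀ l y, (fun s => F s l y) =O[𝓝 0] g) :
    (fun s => stepMean Λ k (F s)) =O[𝓝 0] g := by
  simp only [stepMean, Complex.real_smul]
  exact (Asymptotics.IsBigO.fun_sum fun l _ => Asymptotics.IsBigO.fun_sum fun y _ =>
    h l y).const_mul_left _

theorem stepMean_ofReal (Λ : ℕ) (k : Fin 6) (F : Fin 6 → ℤ × ℤ → ℝ) :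
    stepMean Λ k (fun l y => (F l y : ℂ)) = (stepMean Λ k F : ℝ) :=
  stepMean_map Λ k Complex.ofRealCLM.toLinearMap F

/-- An approximate eigenvector of the twisted transition operator. -/
noncomputable def approxEigen (a b : Fin 6 → ℝ) (s : ℝ) (k : Fin 6) : ℂ :=
  Complex.exp ((s * a k : ℝ) * Complex.I) * (1 + s ^ 2 * b k)

/-- After division by exp(is a_k), the corrected increments δ = phase + a_l - a_k enter. By `h1`
they have mean zero, so the first order vanishes; by `h2` the function `b` absorbs the dependence of
their variance on the type, leaving the common constant q. -/
theorem isBigO_approxEigen {Λ : ℕ} (hΛ : 0 < Λ) {t : ℝ × ℝ} {a b : Fin 6 → ℝ} {q : ℝ}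
    (h1 : ∀ k, stepMean Λ k (fun l y => phase y t + a l - a k) = 0)
    (h2 : ∀ k, stepMean Λ k (fun l y => b l - (phase y t + a l - a k) ^ 2 / 2) = b k - q / 2) :
    (fun s : ℝ => charOp Λ (s • t) (approxEigen a b s) -
      ((1 - s ^ 2 * q / 2 : ℝ) : ℂ) • approxEigen a b s) =O[𝓝 0] fun s : ℝ => s ^ 3 := by
  rw [Asymptotics.isBigO_pi]
  intro k
  have hE := IsBigO_stepMean (Λ := Λ) (k := k)
    fun l y => isBigO_exp_expansion (phase y t + a l - a k) (b l)
  have hm : ∀ s : ℝ, stepMean (E := ℂ) Λ k (fun l y => (1 : ℂ) +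
      s * ((phase y t + a l - a k : ℝ) : ℂ) * Complex.I +
      s ^ 2 * (b l - ((phase y t + a l - a k : ℝ) : ℂ) ^ 2 / 2)) = 1 + s ^ 2 * (b k - q / 2) := by
    intro s
    have e1 := stepMean_ofReal Λ k (fun l y => phase y t + a l - a k)
    have e2 := stepMean_ofReal Λ k (fun l y => b l - (phase y t + a l - a k) ^ 2 / 2)
    rw [h1] at e1
    rw [h2] at e2
    rw [Complex.ofReal_zero] at e1
    have e3 : ∀ (l : Fin 6) (y : ℤ × ℤ), (1 : ℂ) +
      s * ((phase y t + a l - a k : ℝ) : ℂ) * Complex.I +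
      s ^ 2 * (b l - ((phase y t + a l - a k : ℝ) : ℂ) ^ 2 / 2) = (1 : ℂ) +
      (s * Complex.I) * ((phase y t + a l - a k : ℝ) : ℂ) +
      s ^ 2 * ((b l - (phase y t + a l - a k) ^ 2 / 2 : ℝ) : ℂ) := by
      intro l y; push_cast; ring
    simp only [e3]
    rw [stepMean_add, stepMean_add, stepMean_mul, stepMean_mul, e1, e2, stepMean_const hΛ]
    push_cast; ring
  -- The product of 1 - s²q/2 and 1 + s²b_k has this excess fourth-order term.
  have hs4 : (fun s : ℝ => ((s : ℂ) ^ 4 * q * b k / 2)) =O[𝓝 0] fun s : ℝ => s ^ 3 := by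
    have hc : (fun s : ℝ => (s : ℂ) ^ 3) =O[𝓝 0] fun s : ℝ => s ^ 3 :=
      Asymptotics.IsBigO.of_bound 1 (Eventually.of_forall fun s => by simp)
    have hd : (fun s : ℝ => ((s : ℂ) * q * b k / 2)) =O[𝓝 0] fun _ : ℝ => (1 : ℝ) := by
      have : Continuous fun s : ℝ => ((s : ℂ) * q * b k / 2) := by fun_prop
      exact (this.tendsto 0).isBigO_one ℝ
    have := hc.mul hd
    simp only [mul_one] at this
    exact this.congr_left fun s => by ring
  have hu : (fun s : ℝ => Complex.exp ((s * a k : ℝ) * Complex.I)) =O[𝓝 0] fun _ : ℝ => (1 : ℝ) :=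
    Asymptotics.IsBigO.of_bound 1 (Eventually.of_forall fun s => by
      rw [Complex.norm_exp_ofReal_mul_I]; simp)
  have := hu.mul (hE.add hs4)
  simp only [one_mul] at this
  refine this.congr_left fun s => ?_
  rw [stepMean_sub, hm s, mul_add, mul_sub, ← stepMean_mul]
  simp only [Pi.sub_apply, Pi.smul_apply, smul_eq_mul, charOp, approxEigen, latticeChar,
    phase_smul]
  have e5 : ∀ (l : Fin 6) (y : ℤ × ℤ), Complex.exp ((s * a k : ℝ) * Complex.I) *
      (Complex.exp ((s * (phase y t + a l - a k) : ℝ) * Complex.I) * (1 + s ^ 2 * b l)) =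
      Complex.exp ((s * phase y t : ℝ) * Complex.I) *
        (Complex.exp ((s * a l : ℝ) * Complex.I) * (1 + s ^ 2 * b l)) := by
    intro l y
    rw [← mul_assoc, ← mul_assoc, ← Complex.exp_add, ← Complex.exp_add]
    congr 2
    push_cast; ring
  simp only [e5]
  push_cast
  ring

/-- Telescoping: each step makes a new error of at most ε, and neither the contraction nor the
factor r enlarges the old ones. -/
theorem norm_charOp_iterate_sub_pow_le {Λ : ℕ} (hΛ : 0 < Λ) (θ : ℝ × ℝ) {u : Fin 6 → ℂ} {r : ℂ}
    {ε : ℝ} (hr : ‖r‖ ≤ 1) (h : ‖charOp Λ θ u - r • u‖ ≤ ε) (n : ℕ) :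
    ‖(charOp Λ θ)^[n] u - r ^ n • u‖ ≤ n * ε := by
  induction n with
  | zero => simp
  | succ n ih =>
    have e : (charOp Λ θ)^[n + 1] u - r ^ (n + 1) • u =
        charOp Λ θ ((charOp Λ θ)^[n] u - r ^ n • u) + r ^ n • (charOp Λ θ u - r • u) := by
      rw [Function.iterate_succ_apply', charOp_sub, charOp_smul, smul_sub, smul_smul, pow_succ]
      abel
    rw [e]
    refine (norm_add_le _ _).trans ?_
    have h1 := (norm_charOp_le_norm hΛ θ ((charOp Λ θ)^[n] u - r ^ n • u)).trans ih
    have h2 : ‖r ^ n • (charOp Λ θ u - r • u)‖ ≤ ε := by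
      rw [norm_smul, norm_pow]
      exact (mul_le_of_le_one_left (norm_nonneg _) (pow_le_one₀ (norm_nonneg _) hr)).trans h
    push_cast
    linarith

theorem tendsto_inv_sqrt : Tendsto (fun n : ℕ => (Real.sqrt n)⁻¹) atTop (𝓝 0) :=
  tendsto_inv_atTop_zero.comp (Real.tendsto_sqrt_atTop.comp tendsto_natCast_atTop_atTop)

/-- With s = n^(-1/2), the n errors of order s³ add up to O(n^(-1/2)), while (1 - q/(2n))ⁿ tends to
exp(-q/2) and the approximate eigenvector tends to 1. -/
theorem tendsto_charOp_iterate_one {Λ : ℕ} (hΛ : 0 < Λ) {t : ℝ × ℝ} {a b : Fin 6 → ℝ} {q : ℝ}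
    (hq : 0 ≤ q) (h1 : ∀ k, stepMean Λ k (fun l y => phase y t + a l - a k) = 0)
    (h2 : ∀ k, stepMean Λ k (fun l y => b l - (phase y t + a l - a k) ^ 2 / 2) = b k - q / 2) :
    Tendsto (fun n : ℕ => (charOp Λ ((Real.sqrt n)⁻¹ • t))^[n] 1) atTop
      (𝓝 fun _ => ((Real.exp (-(q / 2)) : ℝ) : ℂ)) := by
  set s : ℕ → ℝ := fun n => (Real.sqrt n)⁻¹ with hs
  have hs0 : Tendsto s atTop (𝓝 0) := tendsto_inv_sqrt
  have hv : Tendsto (fun n => approxEigen a b (s n)) atTop (𝓝 1) := by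
    rw [tendsto_pi_nhds]
    intro k
    have : Continuous fun s : ℝ => approxEigen a b s k := by unfold approxEigen; fun_prop
    have := (this.tendsto 0).comp hs0
    simpa [approxEigen, Function.comp_def] using this
  have hss : ∀ n : ℕ, n ≠ 0 → (s n) ^ 2 = (n : ℝ)⁻¹ := fun n _ => by
    simp only [hs, inv_pow, Real.sq_sqrt (Nat.cast_nonneg n)]
  have hpow : Tendsto (fun n : ℕ => (((1 - s n ^ 2 * q / 2 : ℝ) : ℂ)) ^ n) atTop
      (𝓝 ((Real.exp (-(q / 2)) : ℝ) : ℂ)) := by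
    have h := Real.tendsto_one_add_div_pow_exp (-(q / 2))
    have h' := (Complex.continuous_ofReal.tendsto _).comp h
    refine h'.congr' ?_
    filter_upwards [eventually_ne_atTop 0] with n hn
    rw [hss n hn]
    simp only [Function.comp]
    push_cast
    congr 1; ring
  have herr : Tendsto (fun n : ℕ => (charOp Λ (s n • t))^[n] (approxEigen a b (s n)) -
      (((1 - s n ^ 2 * q / 2 : ℝ) : ℂ)) ^ n • approxEigen a b (s n)) atTop (𝓝 0) := by
    obtain ⟨C, hC⟩ := ((isBigO_approxEigen hΛ h1 h2).comp_tendsto hs0).bound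
    have hsmall : ∀ᶠ n in atTop, |s n ^ 2 * q / 2| < 1 := by
      have : Tendsto (fun n => |s n ^ 2 * q / 2|) atTop (𝓝 0) := by
        have := ((hs0.pow 2).mul_const q).div_const 2 |>.abs
        simpa using this
      exact this.eventually (gt_mem_nhds one_pos)
    have hlim : Tendsto (fun n => C * s n) atTop (𝓝 0) := by simpa using hs0.const_mul C
    refine squeeze_zero_norm' ?_ hlim
    filter_upwards [hC, hsmall, eventually_ne_atTop 0] with n hn hn1 hn0
    have hsn : 0 ≤ s n := by simp only [hs]; positivity
    have hr : ‖((1 - s n ^ 2 * q / 2 : ℝ) : ℂ)‖ ≤ 1 := by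
      rw [Complex.norm_real, Real.norm_eq_abs, abs_le]
      rw [abs_lt] at hn1
      have : 0 ≤ s n ^ 2 * q / 2 := by positivity
      constructor <;> linarith [hn1.2]
    refine (norm_charOp_iterate_sub_pow_le hΛ _ hr hn n).trans_eq ?_
    simp only [Function.comp, norm_pow, Real.norm_of_nonneg hsn]
    have hne : (n : ℝ) ≠ 0 := by exact_mod_cast hn0
    calc (n : ℝ) * (C * s n ^ 3) = C * s n * (n * s n ^ 2) := by ring
      _ = C * s n := by rw [hss n hn0, mul_inv_cancel₀ hne, mul_one]
  have hdiff : Tendsto (fun n : ℕ => (charOp Λ (s n • t))^[n] (1 - approxEigen a b (s n))) atTop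
      (𝓝 0) := by
    refine squeeze_zero_norm (fun n => norm_charOp_iterate_le_norm hΛ _ n _) ?_
    have := (tendsto_const_nhds (x := (1 : Fin 6 → ℂ))).sub hv
    rw [sub_self] at this
    simpa using this.norm
  have hlast := hpow.smul hv
  have := (hdiff.add herr).add hlast
  convert this using 1
  · ext n : 1
    rw [charOp_iterate_sub]
    abel
  · congr 1
    ext k
    simp

/-- The mean of `u` is split off. On the rest, a fixed number j of steps at frequency zero is small
by mixing, hence also at the nearby frequency θ_n by continuity, and the remaining n - j steps do
not increase the norm. -/
theorem tendsto_charOp_iterate {Λ : ℕ} (hΛ : 3 ≤ Λ) {θ : ℕ → ℝ × ℝ}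
    (hθ : Tendsto θ atTop (𝓝 0)) {r : ℂ}
    (h : Tendsto (fun n : ℕ => (charOp Λ (θ n))^[n] 1) atTop (𝓝 fun _ => r)) (u : Fin 6 → ℂ)
    (k : Fin 6) :
    Tendsto (fun n : ℕ => (charOp Λ (θ n))^[n] u k) atTop (𝓝 ((∑ l, u l) / 6 * r)) := by
  have hΛ' : 0 < Λ := by omega
  set m := (∑ l, u l) / 6 with hm
  have hdiff : Tendsto (fun n : ℕ => (charOp Λ (θ n))^[n] (u - m • 1)) atTop (𝓝 0) := by
    rw [Metric.tendsto_atTop]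
    intro ε hε
    have hj := tendsto_charOp_zero_iterate hΛ (u - m • 1)
    have hsum : (∑ l, (u - m • 1) l) / 6 = 0 := by
      simp [Finset.sum_sub_distrib, hm]; ring
    rw [hsum, Metric.tendsto_atTop] at hj
    obtain ⟨j, hj⟩ := hj ε hε
    have hj := hj j le_rfl
    have hc := ((continuous_charOp_iterate Λ j (u - m • 1)).tendsto 0).comp hθ
    have hev := hc.eventually (Metric.isOpen_ball.mem_nhds hj)
    obtain ⟨N, hN⟩ := (hev.and (eventually_ge_atTop j)).exists_forall_of_atTop
    refine ⟨N, fun n hn => ?_⟩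
    obtain ⟨h1, h2⟩ := hN n hn
    have e : (charOp Λ (θ n))^[n] (u - m • 1) =
        (charOp Λ (θ n))^[n - j] ((charOp Λ (θ n))^[j] (u - m • 1)) := by
      rw [← Function.iterate_add_apply, Nat.sub_add_cancel h2]
    rw [dist_zero_right, e]
    refine (norm_charOp_iterate_le_norm hΛ' _ _ _).trans_lt ?_
    have h1' : dist ((charOp Λ (θ n))^[j] (u - m • 1)) (fun _ => 0) < ε := h1
    have h0 : (fun _ => 0 : Fin 6 → ℂ) = 0 := rfl
    rwa [h0, dist_zero_right] at h1'
  have := hdiff.add (h.const_smul m)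
  rw [tendsto_pi_nhds] at this
  have := this k
  simp only [charOp_iterate_sub, charOp_iterate_smul, Pi.add_apply, Pi.sub_apply, Pi.smul_apply,
    sub_add_cancel, Pi.zero_apply, zero_add, smul_eq_mul] at this
  exact this

/-- The frequency (θ₂, θ₂ - θ₁) is the transpose of `latticeRot` applied to θ. -/
theorem charOp_rot (Λ : ℕ) (θ : ℝ × ℝ) (u : Fin 6 → ℂ) (k : Fin 6) :
    charOp Λ θ u (k + 1) = charOp Λ (θ.2, θ.2 - θ.1) (fun l => u (l + 1)) k := by
  rw [charOp, stepMean_rot, charOp]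
  congr 1
  ext l y
  congr 1
  simp only [latticeChar, phase, latticeRot, Equiv.coe_fn_mk]
  congr 2
  push_cast; ring

theorem charOp_iterate_rot (Λ : ℕ) (θ : ℝ × ℝ) (n : ℕ) (u : Fin 6 → ℂ) (k : Fin 6) :
    (charOp Λ θ)^[n] u (k + 1) = (charOp Λ (θ.2, θ.2 - θ.1))^[n] (fun l => u (l + 1)) k := by
  induction n generalizing k with
  | zero => rfl
  | succ n ih =>
    rw [Function.iterate_succ_apply', charOp_rot, Function.iterate_succ_apply']
    congr 1
    ext l
    exact ih l

/-- The drift summed over all types is fixed by a rotation through 60 degrees, hence zero. This is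
the solvability condition for the correctors. -/
theorem sum_stepMean_coord (Λ : ℕ) :
    ∑ k, stepMean Λ k (fun _ y => (y.1 : ℝ)) = 0 ∧ ∑ k, stepMean Λ k (fun _ y => (y.2 : ℝ)) = 0 := by
  have h : ∀ F : Fin 6 → ℤ × ℤ → ℝ, ∑ k, stepMean Λ k F =
      ∑ k, stepMean Λ k (fun l y => F (l + 1) (latticeRot y)) := by
    intro F
    rw [← (Fintype.sum_equiv (Equiv.addRight (1 : Fin 6)) _ _ fun _ => rfl)]
    simp only [Equiv.coe_addRight, stepMean_rot]
  have h1 := h fun _ y => (y.1 : ℝ)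
  have h2 := h fun _ y => (y.2 : ℝ)
  simp only [latticeRot, Equiv.coe_fn_mk, Int.cast_neg, Int.cast_add, stepMean_add,
    Finset.sum_add_distrib] at h1 h2
  have h3 : ∀ k, stepMean Λ k (fun _ y => -(y.2 : ℝ)) = -stepMean Λ k (fun _ y => (y.2 : ℝ)) :=
    fun k => by simpa using stepMean_mul Λ k (-1 : ℝ) (fun _ y => (y.2 : ℝ))
  simp only [h3, Finset.sum_neg_distrib] at h1
  constructor <;> linarith

/-- The central limit theorem for the chain of triangles, in terms of characteristic functions. -/
theorem exists_tendsto_charOp_iterate {Λ : ℕ} (hΛ : 3 ≤ Λ) :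
    ∃ q : ℝ, 0 < q ∧ ∀ (t : ℝ × ℝ) (u : Fin 6 → ℂ) (k : Fin 6),
      Tendsto (fun n : ℕ => (charOp Λ ((Real.sqrt n)⁻¹ • t))^[n] u k) atTop
        (𝓝 ((∑ l, u l) / 6 *
          (Real.exp (-(q * (t.1 ^ 2 - t.1 * t.2 + t.2 ^ 2) / 2)) : ℝ))) := by
  have hΛ' : 0 < Λ := by omega
  -- The correctors turn the two displacement coordinates into increments `d₁`, `d₂` with mean zero
  -- from each type.
  obtain ⟨a₁, ha₁⟩ := exists_sub_stepMean_eq hΛ (sum_stepMean_coord Λ).1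
  obtain ⟨a₂, ha₂⟩ := exists_sub_stepMean_eq hΛ (sum_stepMean_coord Λ).2
  let d₁ : Fin 6 → Fin 6 → ℤ × ℤ → ℝ := fun k l y => y.1 + a₁ l - a₁ k
  let d₂ : Fin 6 → Fin 6 → ℤ × ℤ → ℝ := fun k l y => y.2 + a₂ l - a₂ k
  let A := (∑ k, stepMean Λ k fun l y => d₁ k l y ^ 2) / 6
  let B := (∑ k, stepMean Λ k fun l y => d₁ k l y * d₂ k l y) / 6
  let C := (∑ k, stepMean Λ k fun l y => d₂ k l y ^ 2) / 6
  let Q : ℝ × ℝ → ℝ := fun t => A * t.1 ^ 2 + 2 * B * (t.1 * t.2) + C * t.2 ^ 2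
  let a : ℝ × ℝ → Fin 6 → ℝ := fun t k => t.1 * a₁ k + t.2 * a₂ k
  have hδ : ∀ t k l y, phase y t + a t l - a t k = t.1 * d₁ k l y + t.2 * d₂ k l y := by
    intro t k l y; simp only [phase, a, d₁, d₂]; ring
  have hz : ∀ (a' : Fin 6 → ℝ) (f : ℤ × ℤ → ℝ) (k : Fin 6),
      a' k - stepMean Λ k (fun l _ => a' l) = stepMean Λ k (fun _ y => f y) →
      stepMean Λ k (fun l y => f y + a' l - a' k) = 0 := by
    intro a' f k h
    rw [stepMean_sub, stepMean_add, stepMean_const hΛ', ← h]; ring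
  have hd₁ : ∀ k, stepMean Λ k (d₁ k) = 0 := fun k => hz a₁ (fun y => (y.1 : ℝ)) k (ha₁ k)
  have hd₂ : ∀ k, stepMean Λ k (d₂ k) = 0 := fun k => hz a₂ (fun y => (y.2 : ℝ)) k (ha₂ k)
  have h1 : ∀ t k, stepMean Λ k (fun l y => phase y t + a t l - a t k) = 0 := by
    intro t k
    simp only [hδ]
    rw [stepMean_add, stepMean_mul, stepMean_mul, hd₁, hd₂]; simp
  have hQ : ∀ t, (∑ k, stepMean Λ k fun l y => (phase y t + a t l - a t k) ^ 2) = 6 * Q t := by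
    intro t
    have e : ∀ k l y, (phase y t + a t l - a t k) ^ 2 = t.1 ^ 2 * d₁ k l y ^ 2 +
        2 * (t.1 * t.2) * (d₁ k l y * d₂ k l y) + t.2 ^ 2 * d₂ k l y ^ 2 := by
      intro k l y; rw [hδ]; ring
    simp only [e, stepMean_add, stepMean_mul, Finset.sum_add_distrib, ← Finset.mul_sum]
    simp only [Q, A, B, C]; ring
  have hQ0 : ∀ t, 0 ≤ Q t := by
    intro t
    have : 0 ≤ ∑ k, stepMean Λ k fun l y => (phase y t + a t l - a t k) ^ 2 := by
      refine Finset.sum_nonneg fun k _ => ?_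
      rw [stepMean, smul_eq_mul]
      exact mul_nonneg (by positivity) (Finset.sum_nonneg fun l _ => Finset.sum_nonneg
        fun y _ => sq_nonneg _)
    rw [hQ] at this
    linarith
  have hb : ∀ t, ∃ b : Fin 6 → ℝ, ∀ k, stepMean Λ k (fun l y => b l -
      (phase y t + a t l - a t k) ^ 2 / 2) = b k - Q t / 2 := by
    intro t
    have hsum : ∑ k, (Q t / 2 - (stepMean Λ k fun l y =>
        (phase y t + a t l - a t k) ^ 2) / 2) = 0 := by
      rw [Finset.sum_sub_distrib, ← Finset.sum_div, ← Finset.sum_div, hQ]; simp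
    obtain ⟨b, hb⟩ := exists_sub_stepMean_eq hΛ hsum
    refine ⟨b, fun k => ?_⟩
    have e : stepMean Λ k (fun l y => (phase y t + a t l - a t k) ^ 2 / 2) =
        (stepMean Λ k fun l y => (phase y t + a t l - a t k) ^ 2) / 2 := by
      simp only [div_eq_inv_mul, stepMean_mul]
    rw [stepMean_sub, e]
    linarith [hb k]
  have hlim : ∀ t, Tendsto (fun n : ℕ => (charOp Λ ((Real.sqrt n)⁻¹ • t))^[n] 1) atTop
      (𝓝 fun _ => ((Real.exp (-(Q t / 2)) : ℝ) : ℂ)) := by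
    intro t
    obtain ⟨b, hb⟩ := hb t
    exact tendsto_charOp_iterate_one hΛ' (hQ0 t) (h1 t) hb
  -- The rotation permutes the types, and the limit is the same for all of them; hence the quadratic
  -- form is invariant. The three test vectors below then leave only multiples of t₁² - t₁t₂ + t₂².
  have hrot : ∀ t : ℝ × ℝ, Q (t.2, t.2 - t.1) = Q t := by
    intro t
    have e1 := (tendsto_pi_nhds.1 (hlim t)) 1
    have e2 := (tendsto_pi_nhds.1 (hlim (t.2, t.2 - t.1))) 0
    have e3 : ∀ n : ℕ, (charOp Λ ((Real.sqrt n)⁻¹ • t))^[n] 1 1 =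
        (charOp Λ ((Real.sqrt n)⁻¹ • (t.2, t.2 - t.1)))^[n] 1 0 := by
      intro n
      have := charOp_iterate_rot Λ ((Real.sqrt n)⁻¹ • t) n 1 0
      rw [zero_add] at this
      rw [this]
      have h1' : (fun l => (1 : Fin 6 → ℂ) (l + 1)) = 1 := rfl
      rw [h1']
      simp only [Prod.smul_mk, Prod.smul_fst, Prod.smul_snd, smul_sub]
    simp only [e3] at e1
    have := tendsto_nhds_unique e1 e2
    rw [Complex.ofReal_inj, Real.exp_eq_exp] at this
    linarith
  have hr1 := hrot (1, 0)
  have hr2 := hrot (0, 1)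
  have hr3 := hrot (1, 1)
  simp only [Q] at hr1 hr2 hr3
  norm_num at hr1 hr2 hr3
  have hQA : ∀ t, Q t = A * (t.1 ^ 2 - t.1 * t.2 + t.2 ^ 2) := by
    intro t
    have hC : C = A := by linarith
    have hB : 2 * B = -A := by linarith
    simp only [Q, hC, hB]; ring
  refine ⟨A, ?_, fun t u k => ?_⟩
  · have hA0 : A = Q (1, 0) := by rw [hQA]; norm_num
    -- Nondegeneracy: the uniform decay bound at the frequency (1, 0)/√n passes to the limit and
    -- forces `Q (1, 0)` to be positive.
    have hbound : Real.exp (-(Q (1, 0) / 2)) ≤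
        Real.exp (-(1 / (3 * Real.pi ^ 2 * (Λ : ℝ) ^ 2))) := by
      have e1 := ((tendsto_pi_nhds.1 (hlim (1, 0))) 0).norm
      rw [Complex.norm_real, Real.norm_of_nonneg (Real.exp_pos _).le] at e1
      refine le_of_tendsto e1 ?_
      filter_upwards [eventually_ge_atTop 1] with n hn
      have hn' : (1 : ℝ) ≤ n := by exact_mod_cast hn
      have hsn : (Real.sqrt n)⁻¹ ≤ 1 := inv_le_one_of_one_le₀ (Real.one_le_sqrt.2 hn')
      have hpi := Real.pi_gt_three
      have := norm_charOp_iterate_le hΛ (θ := (Real.sqrt n)⁻¹ • ((1 : ℝ), (0 : ℝ))) (u := 1) (M := 1)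
        (by simp only [Prod.smul_fst, smul_eq_mul, mul_one]
            rw [abs_of_nonneg (by positivity)]; linarith)
        (by simp; positivity) (fun l => by simp) n 0
      refine this.trans_eq ?_
      simp only [Prod.smul_fst, Prod.smul_snd, smul_eq_mul, mul_one, mul_zero, inv_pow,
        Real.sq_sqrt (Nat.cast_nonneg n)]
      congr 1
      have : (n : ℝ) ≠ 0 := by positivity
      field_simp
      simp
    rw [Real.exp_le_exp] at hbound
    have hΛ0 : (0 : ℝ) < Λ := by exact_mod_cast hΛ'
    have hpos : 0 < 1 / (3 * Real.pi ^ 2 * (Λ : ℝ) ^ 2) := by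
      have := Real.pi_pos
      positivity
    rw [hA0]
    linarith
  · have hθ : Tendsto (fun n : ℕ => (Real.sqrt n)⁻¹ • t) atTop (𝓝 0) := by
      simpa using tendsto_inv_sqrt.smul_const t
    have := tendsto_charOp_iterate hΛ hθ (hlim t) u k
    rwa [hQA t] at this

/-! ### Gaussian integrals and Fourier inversion on the dual cell. -/

theorem integrable_exp_neg_sq_add_sq {c : ℝ} (hc : 0 < c) :
    Integrable fun t : ℝ × ℝ => Real.exp (-(c * (t.1 ^ 2 + t.2 ^ 2))) := by
  have := (integrable_exp_neg_mul_sq hc).mul_prod (integrable_exp_neg_mul_sq hc)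
  refine this.congr (Eventually.of_forall fun t => ?_)
  simp only
  rw [← Real.exp_add]
  congr 1; ring

theorem integrable_hexagonal_gaussian {q : ℝ} (hq : 0 < q) :
    Integrable fun t : ℝ × ℝ => Real.exp (-(q * (t.1 ^ 2 - t.1 * t.2 + t.2 ^ 2) / 2)) := by
  refine (integrable_exp_neg_sq_add_sq (c := q / 4) (by positivity)).mono' (by fun_prop) ?_
  refine Eventually.of_forall fun t => ?_
  rw [Real.norm_of_nonneg (Real.exp_pos _).le, Real.exp_le_exp]
  nlinarith [mul_nonneg hq.le (sq_nonneg (t.1 - t.2))]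

theorem fourier_gaussian_real {b : ℝ} (hb : 0 < b) (α : ℝ) :
    ∫ x : ℝ, Complex.exp (Complex.I * α * x) * Complex.exp (-b * x ^ 2) =
      ((Real.sqrt (Real.pi / b) * Real.exp (-α ^ 2 / (4 * b)) : ℝ) : ℂ) := by
  rw [fourierIntegral_gaussian (by simpa using hb) (α : ℂ), Real.sqrt_eq_rpow]
  push_cast
  rw [Complex.ofReal_cpow (by have := Real.pi_pos; positivity)]
  push_cast
  rfl

theorem integral_hexagonal_gaussian {q : ℝ} (hq : 0 < q) (α β : ℝ) :
    ∫ t : ℝ × ℝ, Complex.exp (((α * t.1 + β * t.2 : ℝ) : ℂ) * Complex.I) *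
      (Real.exp (-(q * (t.1 ^ 2 - t.1 * t.2 + t.2 ^ 2) / 2)) : ℝ) =
      ((4 * Real.pi / (Real.sqrt 3 * q) *
        Real.exp (-(2 / (3 * q) * (α ^ 2 + α * β + β ^ 2))) : ℝ) : ℂ) := by
  have hint : Integrable fun t : ℝ × ℝ =>
      Complex.exp (((α * t.1 + β * t.2 : ℝ) : ℂ) * Complex.I) *
      (Real.exp (-(q * (t.1 ^ 2 - t.1 * t.2 + t.2 ^ 2) / 2)) : ℝ) := by
    refine (integrable_hexagonal_gaussian hq).mono' (by fun_prop) (Eventually.of_forall fun t => ?_)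
    rw [norm_mul, Complex.norm_exp_ofReal_mul_I, one_mul, Complex.norm_real,
      Real.norm_of_nonneg (Real.exp_pos _).le]
  rw [Measure.volume_eq_prod, integral_prod_symm _ hint]
  have hin : ∀ y : ℝ, ∫ x : ℝ, Complex.exp (((α * x + β * y : ℝ) : ℂ) * Complex.I) *
      (Real.exp (-(q * (x ^ 2 - x * y + y ^ 2) / 2)) : ℝ) =
      (Complex.exp (Complex.I * (α / 2 + β : ℝ) * y) *
        Complex.exp (-(3 * q / 8 : ℝ) * y ^ 2)) *
      ∫ x : ℝ, Complex.exp (Complex.I * α * x) * Complex.exp (-(q / 2 : ℝ) * x ^ 2) := by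
    intro y
    -- The shift by y/2 completes the square: x² - xy + y² becomes x² + 3y²/4, and the two variables
    -- separate.
    rw [← integral_const_mul, ← integral_add_right_eq_self _ (y / 2)]
    refine integral_congr_ae (Eventually.of_forall fun x => ?_)
    simp only [Complex.ofReal_exp, ← Complex.exp_add]
    congr 1
    push_cast
    ring
  simp only [hin]
  rw [integral_mul_const, fourier_gaussian_real (by positivity),
    fourier_gaussian_real (by positivity), ← Complex.ofReal_mul]
  congr 1
  have hpi := Real.pi_pos
  have h3 : Real.sqrt (Real.pi / (3 * q / 8)) * Real.sqrt (Real.pi / (q / 2)) =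
      4 * Real.pi / (Real.sqrt 3 * q) := by
    rw [← Real.sqrt_mul (by positivity), Real.sqrt_eq_iff_mul_self_eq (by positivity)
      (by positivity)]
    have : Real.sqrt 3 * Real.sqrt 3 = 3 := Real.mul_self_sqrt (by norm_num)
    have e : 4 * Real.pi / (Real.sqrt 3 * q) * (4 * Real.pi / (Real.sqrt 3 * q)) =
        16 * Real.pi ^ 2 / (3 * q ^ 2) := by
      rw [div_mul_div_comm, mul_mul_mul_comm (Real.sqrt 3), this]; ring
    rw [e]
    field_simp
    norm_num
  rw [mul_mul_mul_comm, h3, ← Real.exp_add]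
  congr 2
  field_simp
  ring

theorem integral_exp_int_mul_I (m : ℤ) :
    ∫ x in Set.Icc (-Real.pi) Real.pi, Complex.exp (((m * x : ℝ) : ℂ) * Complex.I) =
      if m = 0 then ((2 * Real.pi : ℝ) : ℂ) else 0 := by
  have hpi := Real.pi_pos
  rw [integral_Icc_eq_integral_Ioc, ← intervalIntegral.integral_of_le (by linarith)]
  split_ifs with h
  · simp [h]; ring
  · have hc : (m : ℂ) * Complex.I ≠ 0 := mul_ne_zero (by exact_mod_cast h) Complex.I_ne_zero
    have e : ∀ x : ℝ, Complex.exp (((m * x : ℝ) : ℂ) * Complex.I) =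
        Complex.exp ((m : ℂ) * Complex.I * x) := by
      intro x; congr 1; push_cast; ring
    simp only [e]
    rw [integral_exp_mul_complex hc, div_eq_zero_iff]
    left
    rw [sub_eq_zero, Complex.exp_eq_exp_iff_exists_int]
    exact ⟨m, by push_cast; ring⟩

/-- The fundamental domain of the dual lattice. -/
def dualCell : Set (ℝ × ℝ) := Set.Icc (-Real.pi) Real.pi ×ˢ Set.Icc (-Real.pi) Real.pi

theorem measurableSet_dualCell : MeasurableSet dualCell := measurableSet_Icc.prod measurableSet_Icc

theorem isCompact_dualCell : IsCompact dualCell := isCompact_Icc.prod isCompact_Icc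

theorem integral_latticeChar (y : ℤ × ℤ) :
    ∫ θ in dualCell, latticeChar θ y = if y = 0 then ((2 * Real.pi : ℝ) : ℂ) ^ 2 else 0 := by
  have e : ∀ θ : ℝ × ℝ, latticeChar θ y = Complex.exp (((y.1 * θ.1 : ℝ) : ℂ) * Complex.I) *
      Complex.exp (((y.2 * θ.2 : ℝ) : ℂ) * Complex.I) := by
    intro θ
    rw [latticeChar, phase, Complex.ofReal_add, add_mul, Complex.exp_add]
  simp only [e]
  have := setIntegral_prod_mul (μ := (volume : Measure ℝ)) (ν := (volume : Measure ℝ))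
    (fun x : ℝ => Complex.exp (((y.1 * x : ℝ) : ℂ) * Complex.I))
    (fun x : ℝ => Complex.exp (((y.2 * x : ℝ) : ℂ) * Complex.I))
    (Set.Icc (-Real.pi) Real.pi) (Set.Icc (-Real.pi) Real.pi)
  rw [dualCell, Measure.volume_eq_prod, this, integral_exp_int_mul_I, integral_exp_int_mul_I]
  obtain ⟨a, b⟩ := y
  by_cases ha : a = 0 <;> by_cases hb : b = 0 <;> simp [ha, hb, sq]

theorem integral_weightFourier {w : TriangleIndex → ℝ≥0} (hw : Summable w) (p : ℤ × ℤ)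
    (l : Fin 6) :
    ∫ θ in dualCell, latticeChar θ (-p) * weightFourier w θ l =
      ((2 * Real.pi : ℝ) : ℂ) ^ 2 * (w (p, l) : ℝ) := by
  have hfin : IsFiniteMeasure ((volume : Measure (ℝ × ℝ)).restrict dualCell) :=
    ⟨by rw [Measure.restrict_apply_univ]; exact isCompact_dualCell.measure_lt_top⟩
  let F : ℤ × ℤ → ℝ × ℝ → ℂ := fun r θ => ((w (r, l) : ℝ) : ℂ) * latticeChar θ (r - p)
  have hFn : ∀ r θ, ‖F r θ‖ = w (r, l) := fun r θ => by simp [F, norm_latticeChar]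
  have hF : ∀ r, Integrable (F r) (volume.restrict dualCell) := fun r =>
    Integrable.mono' (integrable_const (w (r, l) : ℝ))
      (continuous_const.mul (continuous_latticeChar _)).aestronglyMeasurable
      (Eventually.of_forall fun θ => (hFn r θ).le)
  have hs : Summable fun r => ∫ θ in dualCell, ‖F r θ‖ := by
    simp only [hFn, integral_const, smul_eq_mul]
    exact (summable_type hw l).mul_left _
  have h := (hasSum_integral_of_summable_integral_norm hF hs).tsum_eq
  have e1 : ∀ θ, ∑' r, F r θ = latticeChar θ (-p) * weightFourier w θ l := by
    intro θ
    rw [weightFourier, ← tsum_mul_left]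
    refine tsum_congr fun r => ?_
    simp only [F, sub_eq_add_neg, latticeChar_add]
    ring
  simp only [e1] at h
  rw [← h]
  have e2 : ∀ r, ∫ θ in dualCell, F r θ =
      if r = p then ((2 * Real.pi : ℝ) : ℂ) ^ 2 * (w (p, l) : ℝ) else 0 := by
    intro r
    simp only [F]
    rw [integral_const_mul, integral_latticeChar]
    by_cases hr : r = p
    · simp [hr, mul_comm]
    · simp [hr, sub_eq_zero]
  simp only [e2, tsum_ite_eq]

theorem continuous_weightFourier {w : TriangleIndex → ℝ≥0} (hw : Summable w) (l : Fin 6) :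
    Continuous fun θ => weightFourier w θ l := by
  unfold weightFourier
  refine continuous_tsum (fun p => continuous_const.mul (continuous_latticeChar p))
    (summable_type hw l) fun p θ => ?_
  simp [norm_latticeChar]

theorem norm_weightFourier_le {w : TriangleIndex → ℝ≥0} (hw : Summable w) (θ : ℝ × ℝ)
    (l : Fin 6) : ‖weightFourier w θ l‖ ≤ ∑' p, (w (p, l) : ℝ) := by
  have hn : ∀ p, ‖((w (p, l) : ℝ) : ℂ) * latticeChar θ p‖ = w (p, l) := fun p => by
    simp [norm_latticeChar]
  refine (norm_tsum_le_tsum_norm ?_).trans_eq (tsum_congr hn)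
  simp only [hn]
  exact summable_type hw l

theorem weightFourier_zero (w : TriangleIndex → ℝ≥0) (l : Fin 6) :
    weightFourier w 0 l = ((∑' p, (w (p, l) : ℝ) : ℝ) : ℂ) := by
  simp [weightFourier, latticeChar, phase, Complex.ofReal_tsum]

theorem mem_dualCell {θ : ℝ × ℝ} : θ ∈ dualCell ↔ |θ.1| ≤ Real.pi ∧ |θ.2| ≤ Real.pi := by
  simp only [dualCell, Set.mem_prod, Set.mem_Icc, abs_le]

theorem sum_type_eq {w : TriangleIndex → ℝ≥0} (hw : Summable w) :
    ∑ l, ∑' p, (w (p, l) : ℝ) = ∑' i, (w i : ℝ) := by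
  have h : Summable fun i : TriangleIndex => (w i : ℝ) := by exact_mod_cast hw
  rw [← (Equiv.prodComm (Fin 6) (ℤ × ℤ)).tsum_eq, Summable.tsum_prod, tsum_fintype]
  · rfl
  · exact (Equiv.prodComm (Fin 6) (ℤ × ℤ)).summable_iff.2 h

/-! ### The local limit theorem. -/

/-- The local limit theorem for the chain of triangles. -/
theorem exists_local_limit {Λ : ℕ} (hΛ : 3 ≤ Λ) :
    ∃ q : ℝ, 0 < q ∧ ∀ w : TriangleIndex → ℝ≥0, Summable w → ∃ ε : ℕ → ℝ,
      Tendsto ε atTop (𝓝 0) ∧ ∀ n : ℕ, n ≠ 0 → ∀ (p : ℤ × ℤ) (l : Fin 6),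
        |n * ((weightStep Λ)^[n] w (p, l) : ℝ) - (∑' i, (w i : ℝ)) / (6 * Real.sqrt 3 * Real.pi * q) *
          Real.exp (-(2 / (3 * q) * ((p.1 : ℝ) ^ 2 + p.1 * p.2 + (p.2 : ℝ) ^ 2) / n))| ≤ ε n := by
  obtain ⟨q, hq, hclt⟩ := exists_tendsto_charOp_iterate hΛ
  refine ⟨q, hq, fun w hw => ?_⟩
  have hpi := Real.pi_pos
  set W := ∑' i, (w i : ℝ) with hW
  have hW0 : 0 ≤ W := tsum_nonneg fun i => NNReal.coe_nonneg _
  have hΛ0 : (0 : ℝ) < Λ := by exact_mod_cast (by omega : 0 < Λ)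
  -- The substitution θ = t/√n in the inversion integral produces the factor n of the statement. The
  -- pointwise limit `G'` carries W/6 because mixing spreads the mass equally over the types.
  let G : ℕ → Fin 6 → ℝ × ℝ → ℂ := fun n l t =>
    dualCell.indicator (fun θ => weightFourier ((weightStep Λ)^[n] w) θ l) ((Real.sqrt n)⁻¹ • t)
  let G' : ℝ × ℝ → ℂ := fun t =>
    (((W / 6) * Real.exp (-(q * (t.1 ^ 2 - t.1 * t.2 + t.2 ^ 2) / 2)) : ℝ) : ℂ)
  have hGm : ∀ n l, AEStronglyMeasurable (G n l) := by
    intro n l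
    have h1 : Measurable fun θ => weightFourier ((weightStep Λ)^[n] w) θ l :=
      (continuous_weightFourier (summable_weightStep_iterate hw Λ n) l).measurable
    exact ((h1.indicator measurableSet_dualCell).comp (measurable_const_smul _)).aestronglyMeasurable
  have hG'i : Integrable G' := ((integrable_hexagonal_gaussian hq).const_mul (W / 6)).ofReal
  set c := 1 / (3 * Real.pi ^ 2 * (Λ : ℝ) ^ 2) with hc
  have hc0 : 0 < c := by positivity
  have hbound : ∀ n : ℕ, n ≠ 0 → ∀ l t, ‖G n l t‖ ≤ W * Real.exp (-(c * (t.1 ^ 2 + t.2 ^ 2))) := by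
    intro n hn l t
    simp only [G]
    by_cases ht : (Real.sqrt n)⁻¹ • t ∈ dualCell
    · rw [Set.indicator_of_mem ht, weightFourier_iterate_apply hw]
      obtain ⟨ht1, ht2⟩ := mem_dualCell.1 ht
      have hb := norm_charOp_iterate_le hΛ ht1 ht2 (u := Pi.single l 1) (M := 1)
        (fun l' => by by_cases h : l' = l <;> simp [h]) n
      have he : (n : ℝ) * ((((Real.sqrt n)⁻¹ • t).1 ^ 2 + ((Real.sqrt n)⁻¹ • t).2 ^ 2) /
          (3 * Real.pi ^ 2 * (Λ : ℝ) ^ 2)) = c * (t.1 ^ 2 + t.2 ^ 2) := by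
        have : (n : ℝ) ≠ 0 := by exact_mod_cast hn
        simp only [Prod.smul_fst, Prod.smul_snd, smul_eq_mul, mul_pow, inv_pow,
          Real.sq_sqrt (Nat.cast_nonneg n), hc]
        field_simp
      rw [he, mul_one] at hb
      rw [hW, ← sum_type_eq hw, Finset.sum_mul]
      refine norm_sum_le_of_le _ fun k _ => ?_
      rw [norm_mul]
      exact mul_le_mul (norm_weightFourier_le hw _ k) (hb k) (norm_nonneg _)
        (tsum_nonneg fun _ => NNReal.coe_nonneg _)
    · rw [Set.indicator_of_notMem ht, norm_zero]
      positivity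
  have hbi : Integrable fun t : ℝ × ℝ => W * Real.exp (-(c * (t.1 ^ 2 + t.2 ^ 2))) :=
    (integrable_exp_neg_sq_add_sq hc0).const_mul W
  have hlim : ∀ l t, Tendsto (fun n => G n l t) atTop (𝓝 (G' t)) := by
    intro l t
    have hθ : Tendsto (fun n : ℕ => (Real.sqrt n)⁻¹ • t) atTop (𝓝 0) := by
      simpa using tendsto_inv_sqrt.smul_const t
    have hmem : ∀ᶠ n : ℕ in atTop, (Real.sqrt n)⁻¹ • t ∈ dualCell := by
      refine hθ.eventually ?_
      exact prod_mem_nhds (Icc_mem_nhds (by simpa using hpi) (by simpa using hpi))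
        (Icc_mem_nhds (by simpa using hpi) (by simpa using hpi))
    have h1 : Tendsto (fun n : ℕ => ∑ k, weightFourier w ((Real.sqrt n)⁻¹ • t) k *
        (charOp Λ ((Real.sqrt n)⁻¹ • t))^[n] (Pi.single l 1) k) atTop (𝓝 (∑ k,
          weightFourier w 0 k * ((∑ l', (Pi.single l 1 : Fin 6 → ℂ) l') / 6 *
          (Real.exp (-(q * (t.1 ^ 2 - t.1 * t.2 + t.2 ^ 2) / 2)) : ℝ)))) :=
      tendsto_finsetSum _ fun k _ =>
        (((continuous_weightFourier hw k).tendsto 0).comp hθ).mul (hclt t _ k)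
    have h2 : (∑ k, weightFourier w 0 k * ((∑ l', (Pi.single l 1 : Fin 6 → ℂ) l') / 6 *
          (Real.exp (-(q * (t.1 ^ 2 - t.1 * t.2 + t.2 ^ 2) / 2)) : ℝ))) = G' t := by
      simp only [G', weightFourier_zero, ← Finset.sum_mul, ← Complex.ofReal_sum, sum_type_eq hw,
        Finset.sum_pi_single', Finset.mem_univ, if_true]
      rw [← hW]
      push_cast
      ring
    rw [h2] at h1
    refine h1.congr' ?_
    filter_upwards [hmem] with n hn
    simp only [G]
    rw [Set.indicator_of_mem hn, weightFourier_iterate_apply hw]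
  have hL1 : ∀ l, Tendsto (fun n => ∫ t, ‖G n l t - G' t‖) atTop (𝓝 0) := by
    intro l
    -- The index is shifted because the dominating bound requires n ≠ 0.
    have := tendsto_integral_of_dominated_convergence (μ := (volume : Measure (ℝ × ℝ)))
      (F := fun n t => ‖G (n + 1) l t - G' t‖) (f := fun _ => 0)
      (fun t => W * Real.exp (-(c * (t.1 ^ 2 + t.2 ^ 2))) + ‖G' t‖)
      (fun n => ((hGm (n + 1) l).sub hG'i.aestronglyMeasurable).norm) (hbi.add hG'i.norm)
      (fun n => Eventually.of_forall fun t => by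
        rw [norm_norm]
        exact (norm_sub_le _ _).trans (add_le_add_left (hbound _ n.succ_ne_zero l t) _))
      (Eventually.of_forall fun t => by
        have := (tendsto_iff_norm_sub_tendsto_zero.1 (hlim l t))
        exact (tendsto_add_atTop_iff_nat 1).2 this)
    rw [integral_zero] at this
    exact (tendsto_add_atTop_iff_nat 1).1 this
  -- The character has modulus one, so the L¹ distance of `G` and `G'` bounds the error for all `p`
  -- at once; summing over `l` makes the bound independent of the type.
  refine ⟨fun n => ∑ l, ((2 * Real.pi) ^ 2)⁻¹ * ∫ t, ‖G n l t - G' t‖, ?_, fun n hn p l => ?_⟩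
  · simpa using tendsto_finsetSum Finset.univ fun l _ => (hL1 l).const_mul (((2 * Real.pi) ^ 2)⁻¹)
  have hn0 : (0 : ℝ) < n := by exact_mod_cast Nat.pos_of_ne_zero hn
  have hGi : Integrable (G n l) :=
    hbi.mono' (hGm n l) (Eventually.of_forall fun t => hbound n hn l t)
  let e : ℝ × ℝ → ℂ := fun t => latticeChar ((Real.sqrt n)⁻¹ • t) (-p)
  have hec : Continuous e := (continuous_latticeChar (-p)).comp (continuous_const_smul _)
  have hen : ∀ t, ‖e t‖ = 1 := fun t => norm_latticeChar _ _
  have hmul : ∀ g : ℝ × ℝ → ℂ, Integrable g → Integrable fun t => e t * g t := fun g hg =>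
    hg.norm.mono' (hec.aestronglyMeasurable.mul hg.aestronglyMeasurable)
      (Eventually.of_forall fun t => by rw [norm_mul, hen, one_mul])
  have hA : ∫ t, e t * G n l t =
      (((2 * Real.pi) ^ 2 * (n * ((weightStep Λ)^[n] w (p, l) : ℝ)) : ℝ) : ℂ) := by
    have h1 : ∀ t, e t * G n l t = dualCell.indicator (fun θ => latticeChar θ (-p) *
        weightFourier ((weightStep Λ)^[n] w) θ l) ((Real.sqrt n)⁻¹ • t) := by
      intro t
      simp only [e, G]
      by_cases ht : (Real.sqrt n)⁻¹ • t ∈ dualCell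
      · rw [Set.indicator_of_mem ht, Set.indicator_of_mem ht]
      · rw [Set.indicator_of_notMem ht, Set.indicator_of_notMem ht, mul_zero]
    simp only [h1]
    rw [Measure.integral_comp_smul volume (dualCell.indicator (fun θ => latticeChar θ (-p) *
        weightFourier ((weightStep Λ)^[n] w) θ l)), integral_indicator measurableSet_dualCell,
      integral_weightFourier (summable_weightStep_iterate hw Λ n)]
    simp only [Module.finrank_prod, Module.finrank_self, Nat.reduceAdd, inv_pow,
      Real.sq_sqrt hn0.le, inv_inv, abs_of_pos hn0, Complex.real_smul]
    push_cast
    ring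
  have hB : ∫ t, e t * G' t = (((2 * Real.pi) ^ 2 * (W / (6 * Real.sqrt 3 * Real.pi * q) *
      Real.exp (-(2 / (3 * q) * ((p.1 : ℝ) ^ 2 + p.1 * p.2 + (p.2 : ℝ) ^ 2) / n))) : ℝ) : ℂ) := by
    have h1 : ∀ t : ℝ × ℝ, e t * G' t = ((W / 6 : ℝ) : ℂ) * (Complex.exp
        (((-(p.1 : ℝ) * (Real.sqrt n)⁻¹ * t.1 + -(p.2 : ℝ) * (Real.sqrt n)⁻¹ * t.2 : ℝ) : ℂ) *
          Complex.I) * (Real.exp (-(q * (t.1 ^ 2 - t.1 * t.2 + t.2 ^ 2) / 2)) : ℝ)) := by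
      intro t
      have h2 : e t = Complex.exp (((-(p.1 : ℝ) * (Real.sqrt n)⁻¹ * t.1 +
          -(p.2 : ℝ) * (Real.sqrt n)⁻¹ * t.2 : ℝ) : ℂ) * Complex.I) := by
        simp only [e, latticeChar, phase, Prod.fst_neg, Prod.snd_neg, Prod.smul_fst,
          Prod.smul_snd, smul_eq_mul]
        congr 2
        push_cast; ring
      rw [h2]
      simp only [G']
      push_cast
      ring
    simp only [h1]
    rw [integral_const_mul, integral_hexagonal_gaussian hq, ← Complex.ofReal_mul]
    congr 1
    have hs : (Real.sqrt n)⁻¹ ^ 2 = (n : ℝ)⁻¹ := by rw [inv_pow, Real.sq_sqrt hn0.le]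
    have h4 : (-(p.1 : ℝ) * (Real.sqrt n)⁻¹) ^ 2 + -(p.1 : ℝ) * (Real.sqrt n)⁻¹ *
        (-(p.2 : ℝ) * (Real.sqrt n)⁻¹) + (-(p.2 : ℝ) * (Real.sqrt n)⁻¹) ^ 2 =
        ((p.1 : ℝ) ^ 2 + p.1 * p.2 + (p.2 : ℝ) ^ 2) / n := by
      rw [div_eq_mul_inv, ← hs]; ring
    rw [h4, mul_div_assoc (2 / (3 * q))]
    field_simp
    norm_num
  have hdiff : ‖∫ t, e t * G n l t - e t * G' t‖ ≤ ∫ t, ‖G n l t - G' t‖ := by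
    refine (norm_integral_le_integral_norm _).trans_eq ?_
    congr 1
    ext t
    rw [← mul_sub, norm_mul, hen, one_mul]
  rw [integral_sub (hmul _ hGi) (hmul _ hG'i), hA, hB, ← Complex.ofReal_sub, Complex.norm_real,
    ← mul_sub, norm_mul, Real.norm_of_nonneg (by positivity), Real.norm_eq_abs] at hdiff
  have hfin : ((2 * Real.pi) ^ 2)⁻¹ * ∫ t, ‖G n l t - G' t‖ ≤
      ∑ l, ((2 * Real.pi) ^ 2)⁻¹ * ∫ t, ‖G n l t - G' t‖ :=
    Finset.single_le_sum (f := fun l => ((2 * Real.pi) ^ 2)⁻¹ * ∫ t, ‖G n l t - G' t‖)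
      (fun l _ => mul_nonneg (by positivity) (integral_nonneg fun _ => norm_nonneg _))
      (Finset.mem_univ l)
  refine le_trans ?_ hfin
  rw [inv_mul_eq_div, le_div_iff₀ (by positivity), mul_comm]
  exact hdiff

/-! ### The planar Gaussian and uniform convergence. -/

theorem planarGaussian_nonneg {s : ℝ} (hs : 0 ≤ s) (x : Plane) : 0 ≤ planarGaussian s x := by
  have := Real.pi_pos
  unfold planarGaussian; positivity

theorem integral_planarGaussian {s : ℝ} (hs : 0 < s) : ∫ x, planarGaussian s x = 1 := by
  have hpi := Real.pi_pos
  have h := GaussianFourier.integral_rexp_neg_mul_sq_norm (V := Plane) (b := 1 / (2 * s))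
    (by positivity)
  have e : ∀ x : Plane, planarGaussian s x =
      1 / (2 * Real.pi * s) * Real.exp (-(1 / (2 * s)) * ‖x‖ ^ 2) := by
    intro x
    rw [planarGaussian]
    congr 2
    ring
  simp only [e]
  rw [integral_const_mul, h]
  simp only [finrank_euclideanSpace, Fintype.card_fin, Nat.cast_ofNat, div_self (two_ne_zero' ℝ),
    Real.rpow_one]
  field_simp

theorem integrable_planarGaussian {s : ℝ} (hs : 0 < s) : Integrable (planarGaussian s) :=
  Integrable.of_integral_ne_zero (by rw [integral_planarGaussian hs]; exact one_ne_zero)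

/-- The derivative is bounded by 1 in absolute value. On the scale √n this allows a bounded
displacement of the argument at the cost of O(n^(-1/2)). -/
theorem abs_exp_neg_sq_sub_le (r s : ℝ) :
    |Real.exp (-r ^ 2 / 2) - Real.exp (-s ^ 2 / 2)| ≤ |r - s| := by
  have hd : ∀ x : ℝ, HasDerivAt (fun x : ℝ => Real.exp (-x ^ 2 / 2))
      (Real.exp (-x ^ 2 / 2) * -x) x := by
    intro x
    have := (((hasDerivAt_pow 2 x).neg).div_const 2).exp
    refine HasDerivAt.congr_deriv this ?_
    change Real.exp (-x ^ 2 / 2) * (-((2 : ℕ) * x ^ (2 - 1)) / 2) = _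
    push_cast; ring
  have hb : ∀ x ∈ (Set.univ : Set ℝ), ‖Real.exp (-x ^ 2 / 2) * -x‖ ≤ 1 := by
    intro x _
    rw [norm_mul, norm_neg, Real.norm_of_nonneg (Real.exp_pos _).le, Real.norm_eq_abs]
    have h1 := Real.add_one_le_exp (x ^ 2 / 2)
    have h2 : |x| ≤ Real.exp (x ^ 2 / 2) := by nlinarith [sq_nonneg (|x| - 1), sq_abs x]
    calc Real.exp (-x ^ 2 / 2) * |x| ≤ Real.exp (-x ^ 2 / 2) * Real.exp (x ^ 2 / 2) := by gcongr
      _ = 1 := by rw [← Real.exp_add, neg_div, neg_add_cancel, Real.exp_zero]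
  have := convex_univ.norm_image_sub_le_of_norm_hasDerivWithin_le
    (fun x _ => (hd x).hasDerivWithinAt) hb (Set.mem_univ s) (Set.mem_univ r)
  simpa using this

theorem norm_sq_hexCenter_sub {v : Plane} (hv : v ≠ 0) (o : Plane) (p : ℤ × ℤ) :
    ‖hexCenter o v p - o‖ ^ 2 =
      3 * ‖v‖ ^ 2 * ((p.1 : ℝ) ^ 2 + p.1 * p.2 + (p.2 : ℝ) ^ 2) := by
  rw [norm_sq_coord hv, coordS_center hv, coordT_center hv]
  push_cast
  ring

theorem density_withDensity {f : Plane → ℝ≥0∞} (hf : Measurable f) :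
    density (volume.withDensity f) =ᵐ[volume] fun x => (f x).toReal := by
  filter_upwards [Measure.rnDeriv_withDensity (volume : Measure Plane) hf] with x hx
  rw [density, hx]

theorem density_nonneg (μ : Measure Plane) (x : Plane) : 0 ≤ density μ x := ENNReal.toReal_nonneg

theorem density_triangleMeasure {o v : Plane} (hv : v ≠ 0) (w : TriangleIndex → ℝ≥0) :
    ∀ᵐ x, ∃ i, x ∈ triangle o v i ∧ density (triangleMeasure o v w) x = w i := by
  have hm : Measurable (cellFun o v fun i _ => (w i : ℝ≥0∞)) :=
    measurable_cellFun o v fun i => measurable_const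
  filter_upwards [density_withDensity hm, ae_mem_gridGeneric hv o] with x hx hg
  obtain ⟨j, hj, -⟩ := existsUnique_triangle hv hg
  refine ⟨j, hj, ?_⟩
  rw [triangleMeasure_eq_withDensity, hx, cellFun_apply hv hg hj]
  simp

theorem triangleMeasure_univ (o v : Plane) (w : TriangleIndex → ℝ≥0) :
    triangleMeasure o v w Set.univ =
      ENNReal.ofReal (Real.sqrt 3 / 4 * ‖v‖ ^ 2) * ∑' i, (w i : ℝ≥0∞) := by
  rw [triangleMeasure_eq_withDensity, withDensity_apply _ MeasurableSet.univ,
    Measure.restrict_univ, lintegral_cellFun_const]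

theorem summable_of_triangleMeasure_finite {o v : Plane} (hv : v ≠ 0) (w : TriangleIndex → ℝ≥0)
    [IsFiniteMeasure (triangleMeasure o v w)] : Summable w := by
  have hpos : 0 < Real.sqrt 3 / 4 * ‖v‖ ^ 2 := by
    have := norm_pos_iff.2 hv
    positivity
  have h := measure_ne_top (triangleMeasure o v w) Set.univ
  rw [triangleMeasure_univ] at h
  have h2 : ∑' i, (w i : ℝ≥0∞) ≠ ⊤ := by
    intro h'
    rw [h', ENNReal.mul_top (by simpa using hpos)] at h
    exact h rfl
  exact ENNReal.tsum_coe_ne_top_iff_summable.1 h2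

theorem triangleMeasure_real_univ {o v : Plane} (hv : v ≠ 0) (w : TriangleIndex → ℝ≥0)
    [IsFiniteMeasure (triangleMeasure o v w)] :
    (triangleMeasure o v w).real Set.univ = Real.sqrt 3 / 4 * ‖v‖ ^ 2 * ∑' i, (w i : ℝ) := by
  have hs := summable_of_triangleMeasure_finite (o := o) hv w
  rw [Measure.real, triangleMeasure_univ, ENNReal.toReal_mul,
    ENNReal.toReal_ofReal (by positivity), ← ENNReal.coe_tsum hs, ENNReal.coe_toReal,
    NNReal.coe_tsum]

/-- Uniform convergence to the Gaussian density for densities constant on triangles. -/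
theorem exists_uniform_bound {Λ : ℕ} (hΛ : 3 ≤ Λ) : ∃ D : ℝ, 0 < D ∧
    ∀ (o v : Plane) (c : Plane → Plane), v ≠ 0 → IsHexCenterMap o v c →
      ∀ w : TriangleIndex → ℝ≥0, IsFiniteMeasure (triangleMeasure o v w) →
        ∃ η : ℕ → ℝ, Tendsto η atTop (𝓝 0) ∧ ∀ n : ℕ, n ≠ 0 → ∀ᵐ x,
          n * |density ((perronFrobenius (stretchMap Λ c))^[n] (triangleMeasure o v w)) x -
            (triangleMeasure o v w).real Set.univ * planarGaussian (D * ‖v‖ ^ 2 * n) x| ≤ η n := by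
  obtain ⟨q, hq, hlim⟩ := exists_local_limit hΛ
  -- The centre with index p is at squared distance 3‖v‖²(p₁² + p₁p₂ + p₂²) from `o`; equating the
  -- exponent 2(p₁² + p₁p₂ + p₂²)/(3qn) with that squared distance over 2D‖v‖²n gives D = 9q/4.
  refine ⟨9 * q / 4, by positivity, fun o v c hv hc w hw => ?_⟩
  have hpi := Real.pi_pos
  have hv0 : 0 < ‖v‖ := norm_pos_iff.2 hv
  have hs := summable_of_triangleMeasure_finite (o := o) hv w
  obtain ⟨ε, hε, hb⟩ := hlim w hs
  set M := (triangleMeasure o v w).real Set.univ with hM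
  have hM0 : 0 ≤ M := measureReal_nonneg
  have hMW := triangleMeasure_real_univ (o := o) hv w
  rw [← hM] at hMW
  set W := ∑' i, (w i : ℝ) with hW
  set σ := 9 * q / 4 * ‖v‖ ^ 2 with hσ
  have hσ0 : 0 < σ := by positivity
  set C := M / (2 * Real.pi * σ) with hC
  have hC0 : 0 ≤ C := by positivity
  have hCW : W / (6 * Real.sqrt 3 * Real.pi * q) = C := by
    have h3 : Real.sqrt 3 * Real.sqrt 3 = 3 := Real.mul_self_sqrt (by norm_num)
    have h30 : Real.sqrt 3 ≠ 0 := by positivity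
    rw [hC, hMW, hσ, div_eq_div_iff (by positivity) (by positivity)]
    linear_combination (-(3 / 2) * ‖v‖ ^ 2 * W * Real.pi * q) * h3
  -- The second term pays for replacing the point by its hexagon centre, at distance at most `‖v‖`,
  -- and for the tiling being centred at `o` instead of 0.
  refine ⟨fun n => ε n + C * ((‖v‖ + ‖o‖) / Real.sqrt σ * (Real.sqrt n)⁻¹), ?_, fun n hn => ?_⟩
  · simpa using hε.add ((tendsto_inv_sqrt.const_mul ((‖v‖ + ‖o‖) / Real.sqrt σ)).const_mul C)
  have hn0 : (0 : ℝ) < n := by exact_mod_cast Nat.pos_of_ne_zero hn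
  rw [perronFrobenius_iterate_triangleMeasure hv hc (by omega)]
  filter_upwards [density_triangleMeasure (o := o) hv ((weightStep Λ)^[n] w)] with x hx
  obtain ⟨⟨p, l⟩, hxi, hd⟩ := hx
  rw [hd]
  have h1 := hb n hn p l
  rw [hCW] at h1
  set z := hexCenter o v p
  set R := Real.sqrt (σ * n) with hR
  have hR0 : 0 < R := Real.sqrt_pos.2 (by positivity)
  have hR2 : R ^ 2 = σ * n := Real.sq_sqrt (by positivity)
  have e1 : Real.exp (-(2 / (3 * q) * ((p.1 : ℝ) ^ 2 + p.1 * p.2 + (p.2 : ℝ) ^ 2) / n)) =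
      Real.exp (-(‖z - o‖ / R) ^ 2 / 2) := by
    rw [div_pow, hR2, norm_sq_hexCenter_sub hv, hσ]
    congr 1
    field_simp
    ring
  have e2 : n * (M * planarGaussian (σ * n) x) = C * Real.exp (-(‖x‖ / R) ^ 2 / 2) := by
    rw [planarGaussian, div_pow, hR2, hC]
    have e3 : -‖x‖ ^ 2 / (2 * (σ * n)) = -(‖x‖ ^ 2 / (σ * n)) / 2 := by
      field_simp
    rw [e3]
    field_simp
  have hdist : |‖z - o‖ / R - ‖x‖ / R| ≤ (‖v‖ + ‖o‖) / R := by
    rw [← sub_div, abs_div, abs_of_pos hR0]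
    gcongr
    have h2 := abs_norm_sub_norm_le (z - o) x
    have h3 : ‖z - o - x‖ ≤ ‖v‖ + ‖o‖ := by
      have h4 : z - o - x = -(x - z) - o := by abel
      rw [h4]
      refine (norm_sub_le _ _).trans ?_
      rw [norm_neg]
      exact add_le_add_left (dist_le_of_mem_triangle hxi) _
    exact h2.trans h3
  have hl := (abs_exp_neg_sq_sub_le (‖z - o‖ / R) (‖x‖ / R)).trans hdist
  rw [e1] at h1
  have hRe : (‖v‖ + ‖o‖) / Real.sqrt σ * (Real.sqrt n)⁻¹ = (‖v‖ + ‖o‖) / R := by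
    rw [hR, Real.sqrt_mul hσ0.le]; field_simp
  rw [hRe, ← abs_of_pos hn0, ← abs_mul, abs_of_pos hn0, mul_sub, e2]
  have h5 : (n : ℝ) * ((weightStep Λ)^[n] w (p, l) : ℝ) - C * Real.exp (-(‖x‖ / R) ^ 2 / 2) =
      ((n : ℝ) * ((weightStep Λ)^[n] w (p, l) : ℝ) - C * Real.exp (-(‖z - o‖ / R) ^ 2 / 2)) +
      C * (Real.exp (-(‖z - o‖ / R) ^ 2 / 2) - Real.exp (-(‖x‖ / R) ^ 2 / 2)) := by ring
  rw [h5]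
  refine (abs_add_le _ _).trans (add_le_add h1 ?_)
  rw [abs_mul, abs_of_nonneg hC0]
  gcongr

/-! ### From uniform convergence to convergence in L¹. -/

/-- Scheffé's identity: for equal masses only the deficit of `f` below `g` counts. With `g` Gaussian
its tail alone needs control, and no tightness of `f` has to be proved. -/
theorem integral_abs_sub_eq {f g : Plane → ℝ} (hf : Integrable f) (hg : Integrable g)
    (h : ∫ x, f x = ∫ x, g x) : ∫ x, |f x - g x| = 2 * ∫ x, max (g x - f x) 0 := by
  have hp : Integrable fun x => max (g x - f x) 0 := (hg.sub hf).pos_part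
  have e : ∀ x, |f x - g x| = (f x - g x) + 2 * max (g x - f x) 0 := by
    intro x
    rcases le_total (f x) (g x) with h' | h'
    · rw [abs_of_nonpos (by linarith), max_eq_left (by linarith)]; ring
    · rw [abs_of_nonneg (by linarith), max_eq_right (by linarith)]; ring
  have hfg : Integrable fun x => f x - g x := hf.sub hg
  simp only [e]
  rw [integral_add hfg (hp.const_mul 2), integral_sub hf hg, integral_const_mul, h]
  ring

theorem eLpNorm_one_eq_ofReal {f : Plane → ℝ} (hf : Integrable f) :
    eLpNorm f 1 volume = ENNReal.ofReal (∫ x, |f x|) := by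
  rw [eLpNorm_one_eq_lintegral_enorm, ← ofReal_integral_norm_eq_lintegral_enorm hf]
  rfl

/-- Half of the exponent is spent on the small factor; the other half is a Gaussian of twice the
variance, still integrable with mass one. -/
theorem planarGaussian_tail {s ρ : ℝ} (hs : 0 < s) {x : Plane} (hx : ρ ≤ ‖x‖ ^ 2 / s) :
    planarGaussian s x ≤ 2 * Real.exp (-(ρ / 4)) * planarGaussian (2 * s) x := by
  have hpi := Real.pi_pos
  have e1 : -‖x‖ ^ 2 / (2 * s) = -(‖x‖ ^ 2 / s / 4) + -‖x‖ ^ 2 / (2 * (2 * s)) := by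
    field_simp; ring
  rw [planarGaussian, planarGaussian, e1, Real.exp_add]
  have e2 : 2 * Real.exp (-(ρ / 4)) * (1 / (2 * Real.pi * (2 * s)) *
      Real.exp (-‖x‖ ^ 2 / (2 * (2 * s)))) = 1 / (2 * Real.pi * s) * (Real.exp (-(ρ / 4)) *
      Real.exp (-‖x‖ ^ 2 / (2 * (2 * s)))) := by
    field_simp
  rw [e2]
  gcongr

/-- Local uniform convergence to Gaussian densities implies convergence in the mean. -/
theorem tendsto_integral_abs_sub_planarGaussian {ρ : ℕ → Plane → ℝ} {M σ : ℝ} (hσ : 0 < σ)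
    (hM : 0 ≤ M) (hρi : ∀ n, Integrable (ρ n)) (hρ0 : ∀ n x, 0 ≤ ρ n x)
    (hρM : ∀ n, ∫ x, ρ n x = M) {η : ℕ → ℝ} (hη : Tendsto η atTop (𝓝 0))
    (hb : ∀ n : ℕ, n ≠ 0 → ∀ᵐ x, n * |ρ n x - M * planarGaussian (σ * n) x| ≤ η n) :
    Tendsto (fun n : ℕ => ∫ x, |ρ n x - M * planarGaussian (σ * n) x|) atTop (𝓝 0) := by
  set V := (volume : Measure Plane).real (Metric.closedBall 0 1) with hV
  -- In the ball of radius R√n the deficit is at most η_n/n on an area R²nV, so the factors n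
  -- cancel; outside it the Gaussian tail bound is uniform in n.
  have key : ∀ R : ℝ, 0 < R → ∀ n : ℕ, n ≠ 0 → ∫ x, |ρ n x - M * planarGaussian (σ * n) x| ≤
      2 * (η n * (R ^ 2 * V)) + 4 * M * Real.exp (-(R ^ 2 / σ / 4)) := by
    intro R hR n hn
    have hn0 : (0 : ℝ) < n := by exact_mod_cast Nat.pos_of_ne_zero hn
    have hs : 0 < σ * n := by positivity
    have hgi := (integrable_planarGaussian hs).const_mul M
    have hg2 := integrable_planarGaussian (s := 2 * (σ * n)) (by positivity)
    rw [integral_abs_sub_eq (hρi n) hgi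
      (by rw [hρM, integral_const_mul, integral_planarGaussian hs, mul_one])]
    set B := Metric.closedBall (0 : Plane) (R * Real.sqrt n) with hB
    have hη0 : 0 ≤ η n := by
      obtain ⟨x, hx⟩ := (hb n hn).exists
      exact le_trans (by positivity) hx
    have hBi : Integrable (B.indicator fun _ => η n / n) :=
      (integrable_indicator_iff Metric.isClosed_closedBall.measurableSet).2
        (integrableOn_const measure_closedBall_lt_top.ne)
    have hle : ∫ x, max (M * planarGaussian (σ * n) x - ρ n x) 0 ≤
        ∫ x, (B.indicator (fun _ => η n / n) x +
          2 * M * Real.exp (-(R ^ 2 / σ / 4)) * planarGaussian (2 * (σ * n)) x) := by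
      refine integral_mono_ae (hgi.sub (hρi n)).pos_part (hBi.add (hg2.const_mul _)) ?_
      filter_upwards [hb n hn] with x hx
      have hg0 := planarGaussian_nonneg (s := 2 * (σ * n)) (by positivity) x
      by_cases hxB : x ∈ B
      · rw [Set.indicator_of_mem hxB]
        have h1 : max (M * planarGaussian (σ * n) x - ρ n x) 0 ≤ η n / n := by
          rw [le_div_iff₀ hn0, mul_comm]
          refine le_trans ?_ hx
          gcongr
          rw [abs_sub_comm]
          exact max_le (le_abs_self _) (abs_nonneg _)
        have h2 : 0 ≤ 2 * M * Real.exp (-(R ^ 2 / σ / 4)) * planarGaussian (2 * (σ * n)) x := by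
          positivity
        linarith
      · rw [Set.indicator_of_notMem hxB, zero_add]
        have hxR : R * Real.sqrt n < ‖x‖ := by
          simpa [hB, Metric.mem_closedBall, dist_zero_right] using hxB
        have h1 : R ^ 2 / σ ≤ ‖x‖ ^ 2 / (σ * n) := by
          rw [div_le_div_iff₀ hσ hs]
          have : (R * Real.sqrt n) ^ 2 ≤ ‖x‖ ^ 2 := by gcongr
          rw [mul_pow, Real.sq_sqrt hn0.le] at this
          nlinarith
        have h2 := mul_le_mul_of_nonneg_left (planarGaussian_tail hs h1) hM
        refine max_le ?_ (by positivity)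
        have := hρ0 n x
        linarith
    rw [integral_add hBi (hg2.const_mul _), integral_const_mul,
      integral_planarGaussian (by positivity), mul_one,
      integral_indicator_const _ Metric.isClosed_closedBall.measurableSet, smul_eq_mul] at hle
    have hvol : (volume : Measure Plane).real B = R ^ 2 * n * V := by
      rw [hB, Measure.real, Measure.addHaar_closedBall _ _ (by positivity), ENNReal.toReal_mul,
        ENNReal.toReal_ofReal (by positivity), finrank_euclideanSpace, Fintype.card_fin, mul_pow,
        Real.sq_sqrt hn0.le, hV, Measure.real, Measure.addHaar_closedBall volume 0 zero_le_one]
      simp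
    rw [hvol] at hle
    have h3 : R ^ 2 * n * V * (η n / n) = η n * (R ^ 2 * V) := by field_simp
    rw [h3] at hle
    linarith
  rw [Metric.tendsto_atTop]
  intro ε hε
  have hexp : Tendsto (fun R : ℝ => 4 * M * Real.exp (-(R ^ 2 / σ / 4))) atTop (𝓝 0) := by
    have h1 : Tendsto (fun R : ℝ => R ^ 2 / σ / 4) atTop atTop :=
      ((tendsto_pow_atTop two_ne_zero).atTop_div_const hσ).atTop_div_const (by norm_num)
    simpa using (Real.tendsto_exp_neg_atTop_nhds_zero.comp h1).const_mul (4 * M)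
  obtain ⟨R, hR1, hR0⟩ := ((hexp.eventually (gt_mem_nhds (half_pos hε))).and
    (eventually_gt_atTop 0)).exists
  have hlim : Tendsto (fun n => 2 * (η n * (R ^ 2 * V))) atTop (𝓝 0) := by
    simpa using (hη.mul_const (R ^ 2 * V)).const_mul 2
  obtain ⟨N, hN⟩ := ((hlim.eventually (gt_mem_nhds (half_pos hε))).and
    (eventually_ne_atTop 0)).exists_forall_of_atTop
  refine ⟨N, fun n hn => ?_⟩
  obtain ⟨h1, h2⟩ := hN n hn
  rw [dist_zero_right, Real.norm_of_nonneg (integral_nonneg fun _ => abs_nonneg _)]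
  have := key R hR0 n h2
  linarith

/-! ### Absolute continuity and contraction in L¹. -/

/-- Lebesgue measure itself has a density given triangle by triangle, so its image has a density
too, and images of null sets of measures follow. -/
theorem perronFrobenius_absolutelyContinuous {o v : Plane} (hv : v ≠ 0) {c : Plane → Plane}
    (hc : IsHexCenterMap o v c) {Λ : ℕ} (hΛ : 0 < Λ) {μ : Measure Plane} (hμ : μ ≪ volume) :
    perronFrobenius (stretchMap Λ c) μ ≪ volume := by
  have h1 : (volume : Measure Plane) = volume.withDensity (cellFun o v fun _ _ => 1) := by
    conv_lhs => rw [← withDensity_one (μ := (volume : Measure Plane))]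
    refine withDensity_congr_ae ?_
    filter_upwards [ae_mem_gridGeneric hv o] with x hx
    obtain ⟨j, hj, -⟩ := existsUnique_triangle hv hx
    rw [cellFun_apply hv hx hj]; rfl
  have h2 : perronFrobenius (stretchMap Λ c) volume ≪ volume := by
    rw [h1, perronFrobenius_cellFun hv hc hΛ fun i => measurable_const, ← h1]
    exact withDensity_absolutelyContinuous _ _
  exact (hμ.map (measurable_stretchMap _ hc.1)).trans h2

theorem perronFrobenius_iterate_absolutelyContinuous {o v : Plane} (hv : v ≠ 0)
    {c : Plane → Plane} (hc : IsHexCenterMap o v c) {Λ : ℕ} (hΛ : 0 < Λ) {μ : Measure Plane}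
    (hμ : μ ≪ volume) (n : ℕ) : (perronFrobenius (stretchMap Λ c))^[n] μ ≪ volume := by
  induction n with
  | zero => exact hμ
  | succ n ih =>
    rw [Function.iterate_succ_apply']; exact perronFrobenius_absolutelyContinuous hv hc hΛ ih

theorem isFiniteMeasure_perronFrobenius_iterate (f : Plane → Plane) (μ : Measure Plane)
    [IsFiniteMeasure μ] (n : ℕ) : IsFiniteMeasure ((perronFrobenius f)^[n] μ) := by
  induction n with
  | zero => assumption
  | succ n ih =>
    rw [Function.iterate_succ_apply', perronFrobenius]; infer_instance

theorem perronFrobenius_iterate_real_univ {f : Plane → Plane} (hf : Measurable f)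
    (μ : Measure Plane) (n : ℕ) :
    ((perronFrobenius f)^[n] μ).real Set.univ = μ.real Set.univ := by
  induction n with
  | zero => rfl
  | succ n ih =>
    rw [Function.iterate_succ_apply', perronFrobenius, Measure.real,
      Measure.map_apply hf MeasurableSet.univ, Set.preimage_univ]
    exact ih

/-- The distance of two functions in the mean. -/
noncomputable def l1Dist (f g : Plane → ℝ) : ℝ := ∫ x, |f x - g x|

theorem l1Dist_nonneg (f g : Plane → ℝ) : 0 ≤ l1Dist f g := integral_nonneg fun _ => abs_nonneg _

theorem l1Dist_triangle {f g h : Plane → ℝ} (hf : Integrable f) (hg : Integrable g)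
    (hh : Integrable h) : l1Dist f h ≤ l1Dist f g + l1Dist g h := by
  have h1 : Integrable fun x => |f x - g x| := (hf.sub hg).abs
  have h2 : Integrable fun x => |g x - h x| := (hg.sub hh).abs
  rw [l1Dist, l1Dist, l1Dist, ← integral_add h1 h2]
  exact integral_mono (hf.sub hh).abs (h1.add h2) fun x => abs_sub_le _ _ _

theorem integrable_density (μ : Measure Plane) [IsFiniteMeasure μ] : Integrable (density μ) :=
  Measure.integrable_toReal_rnDeriv

theorem integral_density {μ : Measure Plane} [IsFiniteMeasure μ] (hμ : μ ≪ volume) :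
    ∫ x, density μ x = μ.real Set.univ :=
  Measure.integral_toReal_rnDeriv hμ

theorem integral_density_le (μ : Measure Plane) [IsFiniteMeasure μ] :
    ∫ x, density μ x ≤ μ.real Set.univ := by
  have h := Measure.lintegral_rnDeriv_le (μ := μ) (ν := (volume : Measure Plane))
  simp only [density]
  rw [integral_toReal (Measure.measurable_rnDeriv _ _).aemeasurable (Measure.rnDeriv_lt_top _ _)]
  exact ENNReal.toReal_mono (measure_ne_top _ _) h

/-- Both measures share the part `m` with density min(g, h), which cancels after the push-forward.
The masses of the remainders `α` and `β` add up to the L¹ distance, and their images have no larger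
mass. -/
theorem l1Dist_density_map_le {f : Plane → Plane} (hf : Measurable f) {μ ν : Measure Plane}
    [IsFiniteMeasure μ] [IsFiniteMeasure ν] (hμ : μ ≪ volume) (hν : ν ≪ volume) :
    l1Dist (density (μ.map f)) (density (ν.map f)) ≤ l1Dist (density μ) (density ν) := by
  set g := μ.rnDeriv volume with hg
  set h := ν.rnDeriv volume with hh
  have hgm : Measurable g := Measure.measurable_rnDeriv _ _
  have hhm : Measurable h := Measure.measurable_rnDeriv _ _
  have hgi : ∫⁻ x, g x ≠ ⊤ := ((Measure.lintegral_rnDeriv_le).trans_lt (measure_lt_top μ _)).ne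
  have hhi : ∫⁻ x, h x ≠ ⊤ := ((Measure.lintegral_rnDeriv_le).trans_lt (measure_lt_top ν _)).ne
  let m := (volume : Measure Plane).withDensity fun x => min (g x) (h x)
  let α := (volume : Measure Plane).withDensity fun x => g x - h x
  let β := (volume : Measure Plane).withDensity fun x => h x - g x
  have hαi : ∫⁻ x, (g x - h x) ≠ ⊤ :=
    ((lintegral_mono fun x => tsub_le_self).trans_lt hgi.lt_top).ne
  have hβi : ∫⁻ x, (h x - g x) ≠ ⊤ :=
    ((lintegral_mono fun x => tsub_le_self).trans_lt hhi.lt_top).ne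
  have hmi : ∫⁻ x, min (g x) (h x) ≠ ⊤ :=
    ((lintegral_mono fun x => min_le_left _ _).trans_lt hgi.lt_top).ne
  have : IsFiniteMeasure m := isFiniteMeasure_withDensity hmi
  have : IsFiniteMeasure α := isFiniteMeasure_withDensity hαi
  have : IsFiniteMeasure β := isFiniteMeasure_withDensity hβi
  have hμ' : μ = m + α := by
    rw [← withDensity_add_left (hgm.min hhm), ← Measure.withDensity_rnDeriv_eq μ volume hμ]
    congr 1
    ext x
    simp only [Pi.add_apply, ← hg]
    rcases le_total (g x) (h x) with h' | h'
    · rw [min_eq_left h', tsub_eq_zero_of_le h', add_zero]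
    · rw [min_eq_right h', add_tsub_cancel_of_le h']
  have hν' : ν = m + β := by
    rw [← withDensity_add_left (hgm.min hhm), ← Measure.withDensity_rnDeriv_eq ν volume hν]
    congr 1
    ext x
    simp only [Pi.add_apply, ← hh]
    rcases le_total (g x) (h x) with h' | h'
    · rw [min_eq_left h', add_tsub_cancel_of_le h']
    · rw [min_eq_right h', tsub_eq_zero_of_le h', add_zero]
  have dens_add : ∀ a b : Measure Plane, IsFiniteMeasure a → IsFiniteMeasure b →
      density (a + b) =ᵐ[volume] fun x => density a x + density b x := by
    intro a b _ _
    filter_upwards [Measure.rnDeriv_add a b (volume : Measure Plane),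
      Measure.rnDeriv_lt_top a (volume : Measure Plane),
      Measure.rnDeriv_lt_top b (volume : Measure Plane)] with x h1 h2 h3
    simp only [density]
    rw [h1, Pi.add_apply, ENNReal.toReal_add h2.ne h3.ne]
  have e1 : μ.map f = m.map f + α.map f := by rw [hμ', Measure.map_add _ _ hf]
  have e2 : ν.map f = m.map f + β.map f := by rw [hν', Measure.map_add _ _ hf]
  have hle : l1Dist (density (μ.map f)) (density (ν.map f)) ≤
      ∫ x, (density (α.map f) x + density (β.map f) x) := by
    refine integral_mono_ae ((integrable_density _).sub (integrable_density _)).abs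
      ((integrable_density _).add (integrable_density _)) ?_
    have h1 := dens_add (m.map f) (α.map f) inferInstance inferInstance
    have h2 := dens_add (m.map f) (β.map f) inferInstance inferInstance
    rw [← e1] at h1
    rw [← e2] at h2
    filter_upwards [h1, h2] with x h1 h2
    rw [h1, h2, add_sub_add_left_eq_sub, abs_le]
    have := density_nonneg (α.map f) x
    have := density_nonneg (β.map f) x
    constructor <;> linarith
  refine hle.trans ?_
  rw [integral_add (integrable_density _) (integrable_density _)]
  have hmass : ∀ a : Measure Plane, IsFiniteMeasure a →
      ∫ x, density (a.map f) x ≤ a.real Set.univ := by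
    intro a _
    refine (integral_density_le _).trans_eq ?_
    rw [Measure.real, Measure.map_apply hf MeasurableSet.univ, Set.preimage_univ, Measure.real]
  refine (add_le_add (hmass α inferInstance) (hmass β inferInstance)).trans_eq ?_
  have m1 : Measurable fun x => g x - h x := hgm.sub hhm
  have m2 : Measurable fun x => h x - g x := hhm.sub hgm
  have i1 : Integrable fun x => (g x - h x).toReal :=
    integrable_toReal_of_lintegral_ne_top m1.aemeasurable hαi
  have i2 : Integrable fun x => (h x - g x).toReal :=
    integrable_toReal_of_lintegral_ne_top m2.aemeasurable hβi
  have hα : α.real Set.univ = ∫ x, (g x - h x).toReal := by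
    rw [integral_toReal m1.aemeasurable (ae_lt_top m1 hαi), Measure.real,
      withDensity_apply _ MeasurableSet.univ, Measure.restrict_univ]
  have hβ : β.real Set.univ = ∫ x, (h x - g x).toReal := by
    rw [integral_toReal m2.aemeasurable (ae_lt_top m2 hβi), Measure.real,
      withDensity_apply _ MeasurableSet.univ, Measure.restrict_univ]
  rw [hα, hβ, ← integral_add i1 i2]
  refine integral_congr_ae ?_
  filter_upwards [ae_lt_top hgm hgi, ae_lt_top hhm hhi] with x h1 h2
  simp only [density, ← hg, ← hh]
  rcases le_total (g x) (h x) with h' | h'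
  · have := ENNReal.toReal_mono h2.ne h'
    rw [tsub_eq_zero_of_le h', ENNReal.toReal_sub_of_le h' h2.ne, abs_of_nonpos (by linarith)]
    simp
  · have := ENNReal.toReal_mono h1.ne h'
    rw [tsub_eq_zero_of_le h', ENNReal.toReal_sub_of_le h' h1.ne, abs_of_nonneg (by linarith)]
    simp

theorem l1Dist_density_perronFrobenius_iterate_le {o v : Plane} (hv : v ≠ 0) {c : Plane → Plane}
    (hc : IsHexCenterMap o v c) {Λ : ℕ} (hΛ : 0 < Λ) {μ ν : Measure Plane}
    [IsFiniteMeasure μ] [IsFiniteMeasure ν] (hμ : μ ≪ volume) (hν : ν ≪ volume) (n : ℕ) :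
    l1Dist (density ((perronFrobenius (stretchMap Λ c))^[n] μ))
      (density ((perronFrobenius (stretchMap Λ c))^[n] ν)) ≤
      l1Dist (density μ) (density ν) := by
  induction n with
  | zero => rfl
  | succ n ih =>
    have := isFiniteMeasure_perronFrobenius_iterate (stretchMap Λ c) μ n
    have := isFiniteMeasure_perronFrobenius_iterate (stretchMap Λ c) ν n
    rw [Function.iterate_succ_apply', Function.iterate_succ_apply']
    exact (l1Dist_density_map_le (measurable_stretchMap _ hc.1)
      (perronFrobenius_iterate_absolutelyContinuous hv hc hΛ hμ n)
      (perronFrobenius_iterate_absolutelyContinuous hv hc hΛ hν n)).trans ih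

/-! ### Log-Lipschitz densities and their smoothing by iteration. -/

theorem integrable_exp_neg_infDist {T : Set Plane} (hT : Bornology.IsBounded T)
    (hne : T.Nonempty) : Integrable fun x => Real.exp (-Metric.infDist x T) := by
  obtain ⟨R, hR⟩ := hT.subset_closedBall 0
  have hJ : Integrable fun x : Plane => (1 + ‖x‖) ^ (-(3 : ℝ)) :=
    integrable_one_add_norm (by simp; norm_num)
  have hcont : Continuous fun x => Real.exp (-Metric.infDist x T) :=
    Real.continuous_exp.comp (Metric.continuous_infDist_pt T).neg
  -- The 6 is 3! from e^u ≥ u³/3!, and the exponent 3 exceeds the dimension, as integrability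
  -- requires.
  refine (hJ.const_mul (6 * Real.exp (1 + R))).mono' hcont.aestronglyMeasurable
    (Eventually.of_forall fun x => ?_)
  rw [Real.norm_of_nonneg (Real.exp_pos _).le]
  have h1 : ‖x‖ - R ≤ Metric.infDist x T := by
    rw [Metric.le_infDist hne]
    intro y hy
    have h2 : ‖y‖ ≤ R := by simpa using hR hy
    have h3 := norm_sub_norm_le x y
    rw [dist_eq_norm]
    linarith
  have hx : 0 < 1 + ‖x‖ := by positivity
  have h4 := Real.pow_div_factorial_le_exp (1 + ‖x‖) hx.le 3
  have h5 : Real.exp (-Metric.infDist x T) ≤ Real.exp (1 + R) * Real.exp (-(1 + ‖x‖)) := by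
    rw [← Real.exp_add, Real.exp_le_exp]; linarith
  refine h5.trans ?_
  rw [Real.rpow_neg hx.le, mul_comm 6, mul_assoc]
  gcongr
  rw [Real.exp_neg, ← div_eq_mul_inv, inv_eq_one_div, div_le_div_iff₀ (Real.exp_pos _)
    (by positivity)]
  have e : (1 + ‖x‖) ^ (3 : ℝ) = (1 + ‖x‖) ^ 3 := by
    rw [← Real.rpow_natCast]; norm_num
  rw [e]
  simp only [Nat.factorial] at h4
  norm_num at h4
  linarith

/-- Nonnegative functions whose logarithm is Lipschitz continuous. -/
structure LogLipschitz (K : ℝ) (h : Plane → ℝ) : Prop where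
  nonneg_const : 0 ≤ K
  nonneg : ∀ x, 0 ≤ h x
  le : ∀ x y, h x ≤ Real.exp (K * ‖x - y‖) * h y
  measurable : Measurable h

theorem LogLipschitz.add {K K' : ℝ} {h h' : Plane → ℝ} (hh : LogLipschitz K h)
    (hh' : LogLipschitz K' h') : LogLipschitz (max K K') (fun x => h x + h' x) where
  nonneg_const := le_max_of_le_left hh.nonneg_const
  nonneg x := add_nonneg (hh.nonneg x) (hh'.nonneg x)
  le x y := by
    rw [mul_add]
    refine add_le_add ((hh.le x y).trans ?_) ((hh'.le x y).trans ?_)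
    · have := hh.nonneg y
      gcongr
      exact le_max_left _ _
    · have := hh'.nonneg y
      gcongr
      exact le_max_right _ _
  measurable := hh.measurable.add hh'.measurable

theorem logLipschitz_zero : LogLipschitz 0 (fun _ => 0) :=
  ⟨le_rfl, fun _ => le_rfl, by simp, measurable_const⟩

theorem logLipschitz_exp_neg_infDist (T : Set Plane) {r K : ℝ} (hr : 0 ≤ r) (hK : 0 ≤ K) :
    LogLipschitz K (fun x => r * Real.exp (-(K * Metric.infDist x T))) where
  nonneg_const := hK
  nonneg x := by positivity
  le x y := by
    have h1 : Metric.infDist y T ≤ Metric.infDist x T + dist y x :=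
      Metric.infDist_le_infDist_add_dist
    rw [dist_comm, dist_eq_norm] at h1
    rw [mul_left_comm, ← Real.exp_add]
    gcongr
    nlinarith
  measurable := ((Real.continuous_exp.comp
    ((Metric.continuous_infDist_pt T).const_mul K |>.neg)).const_mul r).measurable

/-- The set is approximated from inside by a compact `T`, and the indicator of `T` by exp(-(n + 1)
dist(x, T)); every member of this sequence is dominated by exp(-dist(x, T)). -/
theorem exists_logLipschitz_indicator {s : Set Plane} (hs : MeasurableSet s)
    (hsf : volume s < ⊤) {r : ℝ} (hr : 0 ≤ r) {ε : ℝ} (hε : 0 < ε) :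
    ∃ K h, LogLipschitz K h ∧ Integrable h ∧ l1Dist (s.indicator fun _ => r) h ≤ ε := by
  obtain ⟨δ, hδ, hδε⟩ : ∃ δ : ℝ, 0 < δ ∧ r * δ ≤ ε / 2 := by
    refine ⟨ε / (2 * (r + 1)), by positivity, ?_⟩
    rw [mul_div_assoc', div_le_div_iff₀ (by positivity) (by norm_num)]
    nlinarith
  obtain ⟨T, hTs, hTc, hT⟩ := hs.exists_isCompact_sdiff_lt hsf.ne
    (ENNReal.ofReal_pos.2 hδ).ne'
  have hTm := hTc.measurableSet
  have hsi : Integrable (s.indicator fun _ => r) :=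
    (integrable_indicator_iff hs).2 (integrableOn_const hsf.ne)
  have hTi : Integrable (T.indicator fun _ => r) :=
    (integrable_indicator_iff hTm).2 (integrableOn_const hTc.measure_lt_top.ne)
  have h1 : l1Dist (s.indicator fun _ => r) (T.indicator fun _ => r) ≤ ε / 2 := by
    have e : ∀ x, |s.indicator (fun _ => r) x - T.indicator (fun _ => r) x| =
        (s \ T).indicator (fun _ => r) x := by
      intro x
      by_cases hxT : x ∈ T
      · simp [hxT, hTs hxT]
      · by_cases hxs : x ∈ s <;> simp [hxT, hxs, hr]
    rw [l1Dist]
    simp only [e]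
    rw [integral_indicator_const _ (hs.diff hTm), smul_eq_mul, mul_comm]
    refine le_trans ?_ hδε
    gcongr
    exact (ENNReal.toReal_mono ENNReal.ofReal_ne_top hT.le).trans_eq (ENNReal.toReal_ofReal hδ.le)
  rcases T.eq_empty_or_nonempty with rfl | hne
  · refine ⟨0, fun _ => 0, logLipschitz_zero, integrable_zero _ _ _, ?_⟩
    simp only [Set.indicator_empty] at h1
    linarith
  have hH := fun {K : ℝ} => logLipschitz_exp_neg_infDist T (K := K) hr
  have hbase := (integrable_exp_neg_infDist hTc.isBounded hne).const_mul r
  have hle : ∀ (n : ℕ) x, r * Real.exp (-(((n + 1 : ℕ) : ℝ) * Metric.infDist x T)) ≤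
      r * Real.exp (-Metric.infDist x T) := by
    intro n x
    have := Metric.infDist_nonneg (x := x) (s := T)
    have hn : (0 : ℝ) ≤ n := Nat.cast_nonneg n
    gcongr
    push_cast
    nlinarith
  have hi : ∀ n : ℕ, Integrable
      fun x => r * Real.exp (-(((n + 1 : ℕ) : ℝ) * Metric.infDist x T)) := fun n =>
    hbase.mono' (hH (Nat.cast_nonneg (n + 1))).measurable.aestronglyMeasurable
      (Eventually.of_forall fun x => by
        rw [Real.norm_of_nonneg (by positivity)]; exact hle n x)
  have hlim : Tendsto (fun n : ℕ => l1Dist (T.indicator fun _ => r)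
      fun x => r * Real.exp (-(((n + 1 : ℕ) : ℝ) * Metric.infDist x T))) atTop (𝓝 0) := by
    have := tendsto_integral_of_dominated_convergence (μ := (volume : Measure Plane))
      (F := fun (n : ℕ) x => |T.indicator (fun _ => r) x -
        r * Real.exp (-(((n + 1 : ℕ) : ℝ) * Metric.infDist x T))|) (f := fun _ => 0)
      (fun x => |T.indicator (fun _ => r) x| + r * Real.exp (-Metric.infDist x T))
      (fun n => (hTi.sub (hi n)).abs.aestronglyMeasurable) (hTi.abs.add hbase)
      (fun n => Eventually.of_forall fun x => by
        rw [Real.norm_eq_abs, abs_abs]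
        refine (abs_sub _ _).trans ?_
        rw [abs_of_nonneg (a := r * _) (by positivity)]
        exact add_le_add_right (hle n x) _)
      (Eventually.of_forall fun x => by
        by_cases hx : x ∈ T
        · simp [hx, Metric.infDist_zero_of_mem hx]
        · have hpos : 0 < Metric.infDist x T :=
            (hTc.isClosed.notMem_iff_infDist_pos hne).1 hx
          have h2 : Tendsto (fun n : ℕ => ((n + 1 : ℕ) : ℝ) * Metric.infDist x T) atTop atTop :=
            ((tendsto_natCast_atTop_atTop (R := ℝ)).comp
              (tendsto_add_atTop_nat 1)).atTop_mul_const hpos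
          have h3 := ((Real.tendsto_exp_neg_atTop_nhds_zero.comp h2).const_mul r).abs
          simp only [Set.indicator_of_notMem hx, zero_sub, abs_neg]
          simpa [Function.comp_def] using h3)
    simpa [l1Dist] using this
  obtain ⟨n, hn⟩ := (hlim.eventually (gt_mem_nhds (half_pos hε))).exists
  refine ⟨_, _, hH (Nat.cast_nonneg (n + 1)), hi n, ?_⟩
  have := l1Dist_triangle hsi hTi (hi n)
  linarith

/-- Log-Lipschitz functions are dense among the nonnegative integrable functions. -/
theorem exists_logLipschitz_approx {g : Plane → ℝ} (hg : Integrable g) : ∀ ε > 0,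
    ∃ K h, LogLipschitz K h ∧ Integrable h ∧ l1Dist (fun x => |g x|) h ≤ ε := by
  -- Absolute values make the property meaningful for the signed functions that occur in the
  -- induction.
  refine Integrable.induction (fun g : Plane → ℝ => ∀ ε > 0, ∃ K h, LogLipschitz K h ∧
    Integrable h ∧ l1Dist (fun x => |g x|) h ≤ ε) ?_ ?_ ?_ ?_ hg
  · intro c s hs hsf ε hε
    have := exists_logLipschitz_indicator hs hsf (abs_nonneg c) hε
    have e : (fun x => |s.indicator (fun _ => c) x|) = s.indicator fun _ => |c| := by
      ext x; by_cases hx : x ∈ s <;> simp [hx]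
    rwa [e]
  · intro f g hfg hf hg ihf ihg ε hε
    obtain ⟨K, h, h1, h2, h3⟩ := ihf (ε / 2) (half_pos hε)
    obtain ⟨K', h', h1', h2', h3'⟩ := ihg (ε / 2) (half_pos hε)
    refine ⟨_, _, h1.add h1', h2.add h2', ?_⟩
    have i1 : Integrable fun x => |(|f x| - h x)| := (hf.abs.sub h2).abs
    have i2 : Integrable fun x => |(|g x| - h' x)| := (hg.abs.sub h2').abs
    have hle : l1Dist (fun x => |(f + g) x|) (fun x => h x + h' x) ≤
        ∫ x, (|(|f x| - h x)| + |(|g x| - h' x)|) := by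
      refine integral_mono ((hf.add hg).abs.sub (h2.add h2')).abs (i1.add i2) fun x => ?_
      have e : |(f + g) x| = |f x| + |g x| := by
        by_cases hx : f x = 0
        · simp [hx]
        · have : g x = 0 := by
            by_contra h'
            exact Set.disjoint_left.1 hfg hx h'
          simp [this]
      simp only [e]
      rw [add_sub_add_comm]
      exact abs_add_le _ _
    rw [integral_add i1 i2] at hle
    simp only [l1Dist] at h3 h3' hle ⊢
    linarith
  · rw [← isSeqClosed_iff_isClosed]
    intro F f hF hlim ε hε
    have h1 := (tendsto_iff_norm_sub_tendsto_zero.1 hlim).eventually (gt_mem_nhds (half_pos hε))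
    obtain ⟨n, hn⟩ := h1.exists
    obtain ⟨K, h, hh, hi, hd⟩ := hF n (ε / 2) (half_pos hε)
    refine ⟨K, h, hh, hi, ?_⟩
    have i1 := (L1.integrable_coeFn (F n)).abs
    have i2 := (L1.integrable_coeFn f).abs
    have htri := l1Dist_triangle i2 i1 hi
    have h2 : l1Dist (fun x => |f x|) (fun x => |F n x|) ≤ ‖F n - f‖ := by
      rw [L1.norm_eq_integral_norm]
      refine integral_mono_ae (i2.sub i1).abs (L1.integrable_coeFn _).norm ?_
      filter_upwards [Lp.coeFn_sub (F n) f] with x hx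
      rw [hx, Pi.sub_apply, Real.norm_eq_abs, abs_sub_comm (F n x)]
      exact abs_abs_sub_abs_le _ _
    linarith
  · intro f g hfg hf ih ε hε
    obtain ⟨K, h, hh, hi, hd⟩ := ih ε hε
    refine ⟨K, h, hh, hi, le_of_eq_of_le (integral_congr_ae ?_) hd⟩
    filter_upwards [hfg] with x hx
    rw [hx]

/-- Inverse branches shrink distances by Λ, and a bound on ratios survives sums with nonnegative
coefficients, however many branches contribute. This is why the oscillation is measured
multiplicatively. -/
theorem cellStep_le_exp_mul {Λ : ℕ} {o v : Plane} {K : ℝ} {h : TriangleIndex → Plane → ℝ≥0∞}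
    (hh : ∀ i x y, h i x ≤ ENNReal.ofReal (Real.exp (K * ‖x - y‖)) * h i y) (j : TriangleIndex)
    (x y : Plane) : cellStep Λ o v h j x ≤
      ENNReal.ofReal (Real.exp (K / Λ * ‖x - y‖)) * cellStep Λ o v h j y := by
  rw [cellStep, cellStep, mul_left_comm]
  gcongr
  rw [Finset.mul_sum]
  refine Finset.sum_le_sum fun k _ => ?_
  rw [Finset.mul_sum]
  refine Finset.sum_le_sum fun z _ => ?_
  refine (hh _ _ (contract Λ o v (j.1 - z) y)).trans_eq ?_
  have e : ∀ p, ‖contract Λ o v p x - contract Λ o v p y‖ = ‖x - y‖ / Λ := by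
    intro p
    rw [contract, contract, add_sub_add_left_eq_sub, ← smul_sub, sub_sub_sub_cancel_right,
      norm_smul, norm_inv, RCLike.norm_natCast, inv_mul_eq_div]
  rw [e, mul_div_left_comm, mul_comm ‖x - y‖]

theorem cellStep_ne_top {Λ : ℕ} (hΛ : 0 < Λ) {o v : Plane} {h : TriangleIndex → Plane → ℝ≥0∞}
    (hh : ∀ i x, h i x ≠ ⊤) (j : TriangleIndex) (x : Plane) : cellStep Λ o v h j x ≠ ⊤ := by
  refine ENNReal.mul_ne_top (ENNReal.inv_ne_top.2 (by positivity)) ?_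
  exact ENNReal.sum_ne_top.2 fun k _ => ENNReal.sum_ne_top.2 fun y _ => hh _ _

theorem measurable_cellStep_iterate (Λ : ℕ) (o v : Plane) {h : TriangleIndex → Plane → ℝ≥0∞}
    (hh : ∀ i, Measurable (h i)) (m : ℕ) (j : TriangleIndex) :
    Measurable ((cellStep Λ o v)^[m] h j) := by
  induction m generalizing j with
  | zero => exact hh j
  | succ m ih => rw [Function.iterate_succ_apply']; exact measurable_cellStep Λ o v ih j

theorem cellStep_iterate_ne_top {Λ : ℕ} (hΛ : 0 < Λ) {o v : Plane}
    {h : TriangleIndex → Plane → ℝ≥0∞} (hh : ∀ i x, h i x ≠ ⊤) (m : ℕ) (j : TriangleIndex)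
    (x : Plane) : (cellStep Λ o v)^[m] h j x ≠ ⊤ := by
  induction m generalizing j x with
  | zero => exact hh j x
  | succ m ih => rw [Function.iterate_succ_apply']; exact cellStep_ne_top hΛ ih j x

theorem cellStep_iterate_le_exp_mul {Λ : ℕ} {o v : Plane} {K : ℝ}
    {h : TriangleIndex → Plane → ℝ≥0∞}
    (hh : ∀ i x y, h i x ≤ ENNReal.ofReal (Real.exp (K * ‖x - y‖)) * h i y) (m : ℕ)
    (j : TriangleIndex) (x y : Plane) : (cellStep Λ o v)^[m] h j x ≤
      ENNReal.ofReal (Real.exp (K / Λ ^ m * ‖x - y‖)) * (cellStep Λ o v)^[m] h j y := by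
  induction m generalizing j x y with
  | zero => simpa using hh j x y
  | succ m ih =>
    rw [Function.iterate_succ_apply', pow_succ, ← div_div]
    exact cellStep_le_exp_mul ih j x y

theorem perronFrobenius_iterate_cellFun {o v : Plane} (hv : v ≠ 0) {c : Plane → Plane}
    (hc : IsHexCenterMap o v c) {Λ : ℕ} (hΛ : 0 < Λ) {h : TriangleIndex → Plane → ℝ≥0∞}
    (hh : ∀ i, Measurable (h i)) (m : ℕ) :
    (perronFrobenius (stretchMap Λ c))^[m] (volume.withDensity (cellFun o v h)) =
      volume.withDensity (cellFun o v ((cellStep Λ o v)^[m] h)) := by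
  induction m with
  | zero => rfl
  | succ m ih =>
    rw [Function.iterate_succ_apply', ih,
      perronFrobenius_cellFun hv hc hΛ (measurable_cellStep_iterate Λ o v hh m),
      Function.iterate_succ_apply']

/-- After sufficiently many iterations, an absolutely continuous measure is close in the mean to
a measure with a constant density on each triangle. -/
theorem exists_triangleMeasure_approx {o v : Plane} (hv : v ≠ 0) {c : Plane → Plane}
    (hc : IsHexCenterMap o v c) {Λ : ℕ} (hΛ : 1 < Λ) {μ : Measure Plane} [IsFiniteMeasure μ]
    (hμ : μ ≪ volume) {δ : ℝ} (hδ : 0 < δ) :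
    ∃ m w, IsFiniteMeasure (triangleMeasure o v w) ∧
      l1Dist (density ((perronFrobenius (stretchMap Λ c))^[m] μ))
        (density (triangleMeasure o v w)) ≤ δ := by
  have hΛ0 : 0 < Λ := by omega
  obtain ⟨K, h, hL, hi, hd⟩ := exists_logLipschitz_approx (integrable_density μ) (δ / 2)
    (half_pos hδ)
  simp only [abs_of_nonneg (density_nonneg μ _)] at hd
  have hHm : Measurable fun x => ENNReal.ofReal (h x) := hL.measurable.ennreal_ofReal
  set k : TriangleIndex → Plane → ℝ≥0∞ := fun _ x => ENNReal.ofReal (h x) with hk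
  set ν := (volume : Measure Plane).withDensity fun x => ENNReal.ofReal (h x) with hν
  have hνfin : IsFiniteMeasure ν := isFiniteMeasure_withDensity_ofReal hi.2
  have hνd : density ν =ᵐ[volume] h := by
    filter_upwards [density_withDensity hHm] with x hx
    rw [hx, ENNReal.toReal_ofReal (hL.nonneg x)]
  have hνc : ν = volume.withDensity (cellFun o v k) := by
    refine withDensity_congr_ae ?_
    filter_upwards [ae_mem_gridGeneric hv o] with x hx
    obtain ⟨j, hj, -⟩ := existsUnique_triangle hv hx
    rw [cellFun_apply hv hx hj]
  have hνac : ν ≪ volume := withDensity_absolutelyContinuous _ _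
  have hd' : l1Dist (density μ) (density ν) ≤ δ / 2 := by
    refine le_of_eq_of_le (integral_congr_ae ?_) hd
    filter_upwards [hνd] with x hx
    rw [hx]
  set M := ν.real Set.univ with hM
  obtain ⟨m, hm⟩ : ∃ m : ℕ, (Real.exp (K / (Λ : ℝ) ^ m * ‖v‖) - 1) * M < δ / 2 := by
    have h1 : Tendsto (fun m : ℕ => K / (Λ : ℝ) ^ m) atTop (𝓝 0) :=
      tendsto_const_nhds.div_atTop (tendsto_pow_atTop_atTop_of_one_lt (by exact_mod_cast hΛ))
    have h2 : Tendsto (fun m : ℕ => (Real.exp (K / (Λ : ℝ) ^ m * ‖v‖) - 1) * M) atTop (𝓝 0) := by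
      have := (((Real.continuous_exp.tendsto _).comp (h1.mul_const ‖v‖)).sub_const 1).mul_const M
      simpa [Function.comp_def] using this
    exact (h2.eventually (gt_mem_nhds (half_pos hδ))).exists
  set r := Real.exp (K / (Λ : ℝ) ^ m * ‖v‖) with hr
  have hr1 : 1 ≤ r := Real.one_le_exp (by have := hL.nonneg_const; positivity)
  set q := (cellStep Λ o v)^[m] k with hq
  have hqm : ∀ i, Measurable (q i) := measurable_cellStep_iterate Λ o v (fun _ => hHm) m
  have hqt : ∀ i x, q i x ≠ ⊤ := cellStep_iterate_ne_top hΛ0 (fun _ _ => ENNReal.ofReal_ne_top) m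
  have hqle : ∀ i x y, ‖x - y‖ ≤ ‖v‖ → (q i x).toReal ≤ r * (q i y).toReal := by
    intro i x y hxy
    have h1 := cellStep_iterate_le_exp_mul (Λ := Λ) (o := o) (v := v) (K := K) (h := k)
      (fun i x y => by
        simp only [hk]
        rw [← ENNReal.ofReal_mul (Real.exp_pos _).le]
        exact ENNReal.ofReal_le_ofReal (hL.le x y)) m i x y
    have h2 := ENNReal.toReal_mono (ENNReal.mul_ne_top ENNReal.ofReal_ne_top (hqt i y)) h1
    rw [ENNReal.toReal_mul, ENNReal.toReal_ofReal (Real.exp_pos _).le] at h2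
    refine h2.trans ?_
    have := hL.nonneg_const
    rw [hr]
    gcongr
  -- The branch densities `q i` are defined on the whole plane, so they can be sampled at the
  -- hexagon centre, a vertex of the triangle at distance at most `‖v‖` from all its points.
  let w : TriangleIndex → ℝ≥0 := fun i => (q i (hexCenter o v i.1)).toNNReal
  set ν' := (perronFrobenius (stretchMap Λ c))^[m] ν with hν'
  have hν'e : ν' = volume.withDensity (cellFun o v q) := by
    rw [hν', hνc, perronFrobenius_iterate_cellFun hv hc hΛ0 (fun _ => hHm) m]
  have hν'fin : IsFiniteMeasure ν' := isFiniteMeasure_perronFrobenius_iterate _ _ _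
  have hcmp : ∀ᵐ x, density (triangleMeasure o v w) x ≤ r * density ν' x ∧
      density ν' x ≤ r * density (triangleMeasure o v w) x := by
    rw [hν'e, triangleMeasure_eq_withDensity]
    have hwm : Measurable (cellFun o v fun i _ => (w i : ℝ≥0∞)) :=
      measurable_cellFun o v fun i => measurable_const
    filter_upwards [ae_mem_gridGeneric hv o, density_withDensity hwm,
      density_withDensity (measurable_cellFun o v hqm)] with x hx h1 h2
    obtain ⟨j, hj, -⟩ := existsUnique_triangle hv hx
    rw [h1, h2, cellFun_apply hv hx hj, cellFun_apply hv hx hj]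
    have h3 := dist_le_of_mem_triangle hj
    have h4 : (((w j : ℝ≥0) : ℝ≥0∞)).toReal = (q j (hexCenter o v j.1)).toReal := rfl
    rw [h4]
    exact ⟨hqle _ _ _ (by rwa [norm_sub_rev]), hqle _ _ _ h3⟩
  have hwfin : IsFiniteMeasure (triangleMeasure o v w) := by
    rw [triangleMeasure_eq_withDensity]
    refine isFiniteMeasure_withDensity ?_
    have h1 : ∫⁻ x, cellFun o v (fun i _ => (w i : ℝ≥0∞)) x ≤
        ∫⁻ x, ENNReal.ofReal r * cellFun o v q x := by
      refine lintegral_mono_ae ?_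
      filter_upwards [ae_mem_gridGeneric hv o] with x hx
      obtain ⟨j, hj, -⟩ := existsUnique_triangle hv hx
      rw [cellFun_apply hv hx hj, cellFun_apply hv hx hj]
      have h3 := hqle j (hexCenter o v j.1) x (by
        rw [norm_sub_rev]; exact dist_le_of_mem_triangle hj)
      rw [ENNReal.coe_toNNReal (hqt _ _)]
      rw [← ENNReal.ofReal_toReal (hqt j (hexCenter o v j.1)), ← ENNReal.ofReal_toReal (hqt j x),
        ← ENNReal.ofReal_mul (by linarith)]
      exact ENNReal.ofReal_le_ofReal h3
    refine (h1.trans_lt ?_).ne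
    rw [lintegral_const_mul _ (measurable_cellFun o v hqm)]
    refine ENNReal.mul_lt_top ENNReal.ofReal_lt_top ?_
    have h2 := measure_lt_top ν' Set.univ
    rwa [hν'e, withDensity_apply _ MeasurableSet.univ, Measure.restrict_univ] at h2
  refine ⟨m, w, hwfin, ?_⟩
  have := isFiniteMeasure_perronFrobenius_iterate (stretchMap Λ c) μ m
  have hA := l1Dist_density_perronFrobenius_iterate_le hv hc hΛ0 hμ hνac m
  have hB : l1Dist (density ν') (density (triangleMeasure o v w)) ≤ (r - 1) * M := by
    have e : (r - 1) * M = ∫ x, (r - 1) * density ν' x := by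
      rw [integral_const_mul, integral_density
        (perronFrobenius_iterate_absolutelyContinuous hv hc hΛ0 hνac m),
        perronFrobenius_iterate_real_univ (measurable_stretchMap _ hc.1)]
    rw [e]
    refine integral_mono_ae ((integrable_density _).sub (integrable_density _)).abs
      ((integrable_density _).const_mul _) ?_
    filter_upwards [hcmp] with x hx
    have h0 := density_nonneg ν' x
    rw [abs_le]
    constructor <;> nlinarith [hx.1, hx.2, mul_nonneg (sub_nonneg.2 hr1) h0,
      mul_le_mul_of_nonneg_left hx.1 (sub_nonneg.2 hr1)]
  have hT := l1Dist_triangle (integrable_density ((perronFrobenius (stretchMap Λ c))^[m] μ))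
    (integrable_density ν') (integrable_density (triangleMeasure o v w))
  linarith

/-! ### Change of variance and conclusion. -/

/-- Pointwise g_s ≤ (t/s) g_t, so the positive part of g_s - g_t has mass at most t/s - 1, and both
masses are one. It absorbs the m preliminary steps, since (n + m)/n tends to 1. -/
theorem l1Dist_planarGaussian_le {s t : ℝ} (hs : 0 < s) (hst : s ≤ t) :
    l1Dist (planarGaussian s) (planarGaussian t) ≤ 2 * (t / s - 1) := by
  have ht := hs.trans_le hst
  have hpi := Real.pi_pos
  have hr : 0 ≤ t / s - 1 := by rw [sub_nonneg, one_le_div hs]; exact hst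
  have his := integrable_planarGaussian hs
  have hit := integrable_planarGaussian ht
  have hle : ∀ x, planarGaussian s x ≤ t / s * planarGaussian t x := by
    intro x
    rw [planarGaussian, planarGaussian, ← mul_assoc]
    have e : t / s * (1 / (2 * Real.pi * t)) = 1 / (2 * Real.pi * s) := by field_simp
    rw [e]
    gcongr ?_ * Real.exp ?_
    rw [neg_div, neg_div, neg_le_neg_iff]
    gcongr
  have hb : ∀ x, |planarGaussian s x - planarGaussian t x| ≤
      2 * ((t / s - 1) * planarGaussian t x) - (planarGaussian s x - planarGaussian t x) := by
    intro x
    have h1 := hle x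
    have h2 := planarGaussian_nonneg ht.le x
    have h3 := mul_nonneg hr h2
    rw [abs_le]
    constructor <;> linarith
  refine (integral_mono (his.sub hit).abs (((hit.const_mul _).const_mul 2).sub (his.sub hit))
    hb).trans_eq ?_
  have e := integral_sub ((hit.const_mul (t / s - 1)).const_mul 2) (his.sub hit)
  simp only [Pi.sub_apply] at e
  refine e.trans ?_
  rw [integral_sub his hit, integral_const_mul, integral_const_mul,
    integral_planarGaussian ht, integral_planarGaussian hs]
  ring

theorem tendsto_l1Dist_planarGaussian_add {σ : ℝ} (hσ : 0 < σ) (m : ℕ) :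
    Tendsto (fun n : ℕ => l1Dist (planarGaussian (σ * n)) (planarGaussian (σ * (n + m : ℕ))))
      atTop (𝓝 0) := by
  have h1 : Tendsto (fun n : ℕ => 2 * ((m : ℝ) / n)) atTop (𝓝 0) := by
    simpa using (tendsto_const_div_atTop_nhds_zero_nat (m : ℝ)).const_mul 2
  refine squeeze_zero' (Eventually.of_forall fun n => l1Dist_nonneg _ _) ?_ h1
  filter_upwards [eventually_gt_atTop 0] with n hn
  have hn0 : (0 : ℝ) < n := by exact_mod_cast hn
  refine (l1Dist_planarGaussian_le (t := σ * (n + m : ℕ)) (by positivity)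
    (by gcongr; omega)).trans_eq ?_
  push_cast
  field_simp
  ring

theorem tendsto_mul_eLpNorm_top {f : ℕ → Plane → ℝ} {η : ℕ → ℝ} (hη : Tendsto η atTop (𝓝 0))
    (hb : ∀ n : ℕ, n ≠ 0 → ∀ᵐ x, n * |f n x| ≤ η n) :
    Tendsto (fun n : ℕ => (n : ℝ≥0∞) * eLpNorm (f n) ∞ volume) atTop (𝓝 0) := by
  have h1 : Tendsto (fun n => ENNReal.ofReal (η n)) atTop (𝓝 0) := by
    simpa using ENNReal.tendsto_ofReal hη
  refine tendsto_of_tendsto_of_tendsto_of_le_of_le' tendsto_const_nhds h1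
    (Eventually.of_forall fun n => zero_le) ?_
  filter_upwards [eventually_ne_atTop 0] with n hn
  have hn0 : (0 : ℝ) < n := by exact_mod_cast Nat.pos_of_ne_zero hn
  have h2 : eLpNorm (f n) ∞ volume ≤ ENNReal.ofReal (η n / n) := by
    rw [eLpNorm_exponent_top]
    refine eLpNormEssSup_le_of_ae_bound ?_
    filter_upwards [hb n hn] with x hx
    rwa [Real.norm_eq_abs, le_div_iff₀' hn0]
  refine (mul_le_mul_right h2 _).trans_eq ?_
  rw [← ENNReal.ofReal_natCast, ← ENNReal.ofReal_mul hn0.le, mul_div_cancel₀ _ hn0.ne']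

theorem tendsto_l1Dist_density_planarGaussian {o v : Plane} (hv : v ≠ 0) {c : Plane → Plane}
    (hc : IsHexCenterMap o v c) {Λ : ℕ} (hΛ : 1 < Λ) {σ : ℝ} (hσ : 0 < σ)
    (hbound : ∀ w : TriangleIndex → ℝ≥0, IsFiniteMeasure (triangleMeasure o v w) →
      ∃ η : ℕ → ℝ, Tendsto η atTop (𝓝 0) ∧ ∀ n : ℕ, n ≠ 0 → ∀ᵐ x,
        n * |density ((perronFrobenius (stretchMap Λ c))^[n] (triangleMeasure o v w)) x -
          (triangleMeasure o v w).real Set.univ * planarGaussian (σ * n) x| ≤ η n)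
    {μ : Measure Plane} [IsProbabilityMeasure μ] (hμ : μ ≪ volume) :
    Tendsto (fun n : ℕ => l1Dist (density ((perronFrobenius (stretchMap Λ c))^[n] μ))
      (planarGaussian (σ * n))) atTop (𝓝 0) := by
  have hΛ0 : 0 < Λ := by omega
  have hf := measurable_stretchMap (Λ : ℝ) hc.1
  rw [Metric.tendsto_atTop']
  intro ε hε
  -- Four errors of at most ε/5 occur: this approximation, carried along by L¹ contraction; the
  -- limit for the triangle measure; its mass `M`, which need not be 1; and the change of variance
  -- from n to n + m.
  obtain ⟨m, w, hw, hd⟩ := exists_triangleMeasure_approx hv hc hΛ hμ (δ := ε / 5) (by positivity)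
  set τ := triangleMeasure o v w with hτ
  set M := τ.real Set.univ with hM
  have hτac : τ ≪ volume := by
    rw [hτ, triangleMeasure_eq_withDensity]; exact withDensity_absolutelyContinuous _ _
  have hμac := perronFrobenius_iterate_absolutelyContinuous hv hc hΛ0 hμ
  have hτn := perronFrobenius_iterate_absolutelyContinuous hv hc hΛ0 hτac
  have hμfin := isFiniteMeasure_perronFrobenius_iterate (stretchMap Λ c) μ
  have hτfin := isFiniteMeasure_perronFrobenius_iterate (stretchMap Λ c) τ
  have hM1 : |M - 1| ≤ ε / 5 := by
    have e1 : ∫ x, density τ x = M := integral_density hτac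
    have e2 : ∫ x, density ((perronFrobenius (stretchMap Λ c))^[m] μ) x = 1 := by
      have := hμfin m
      rw [integral_density (hμac m), perronFrobenius_iterate_real_univ hf]
      simp
    have := hμfin m
    rw [← e1, ← e2, abs_sub_comm, ← integral_sub (integrable_density _) (integrable_density _)]
    exact (abs_integral_le_integral_abs).trans hd
  obtain ⟨η, hη, hb⟩ := hbound w hw
  have hB := tendsto_integral_abs_sub_planarGaussian hσ (M := M) measureReal_nonneg
    (ρ := fun n => density ((perronFrobenius (stretchMap Λ c))^[n] τ))
    (fun n => by have := hτfin n; exact integrable_density _) (fun n => density_nonneg _)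
    (fun n => by
      have := hτfin n
      rw [integral_density (hτn n), perronFrobenius_iterate_real_univ hf]) hη hb
  have hE := tendsto_l1Dist_planarGaussian_add hσ m
  obtain ⟨N, hN⟩ := eventually_atTop.1
    ((hB.eventually (gt_mem_nhds (show 0 < ε / 5 by positivity))).and
      ((hE.eventually (gt_mem_nhds (show 0 < ε / 5 by positivity))).and (eventually_gt_atTop 0)))
  refine ⟨N + m, fun k hk => ?_⟩
  obtain ⟨n, rfl⟩ := Nat.exists_eq_add_of_le' (show m ≤ k by omega)
  obtain ⟨h1, h2, hn⟩ := hN n (by omega)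
  rw [Real.dist_eq, sub_zero, abs_of_nonneg (l1Dist_nonneg _ _)]
  have hn0 : (0 : ℝ) < n := by exact_mod_cast hn
  have hgn := integrable_planarGaussian (s := σ * n) (by positivity)
  have hgk := integrable_planarGaussian (s := σ * (n + m : ℕ)) (by positivity)
  have := hμfin (n + m)
  have := hτfin n
  have := hμfin m
  have hA := l1Dist_density_perronFrobenius_iterate_le hv hc hΛ0 (hμac m) hτac n
  rw [← Function.iterate_add_apply] at hA
  have hC : l1Dist (fun x => M * planarGaussian (σ * n) x) (planarGaussian (σ * n)) ≤ ε / 5 := by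
    have e : ∀ x, |M * planarGaussian (σ * n) x - planarGaussian (σ * n) x| =
        |M - 1| * planarGaussian (σ * n) x := by
      intro x
      rw [← sub_one_mul, abs_mul, abs_of_nonneg (planarGaussian_nonneg (by positivity) x)]
    simp only [l1Dist, e]
    rw [integral_const_mul, integral_planarGaussian (by positivity), mul_one]
    exact hM1
  have t1 := l1Dist_triangle
    (integrable_density ((perronFrobenius (stretchMap Λ c))^[n + m] μ))
    (integrable_density ((perronFrobenius (stretchMap Λ c))^[n] τ)) hgk
  have t2 := l1Dist_triangle
    (integrable_density ((perronFrobenius (stretchMap Λ c))^[n] τ)) (hgn.const_mul M) hgk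
  have t3 := l1Dist_triangle (hgn.const_mul M) hgn hgk
  have h1' : l1Dist (density ((perronFrobenius (stretchMap Λ c))^[n] τ))
      (fun x => M * planarGaussian (σ * n) x) < ε / 5 := h1
  linarith

theorem mainTheorem3 (Λ : ℕ) (hΛ : 3 ≤ Λ) (hodd : Odd Λ) :
    ∃ D : ℝ, 0 < D ∧
      ∀ (o v : Plane) (c : Plane → Plane), v ≠ 0 → IsHexCenterMap o v c →
        -- constancy of the density on the triangles is preserved
        (∀ w : TriangleIndex → ℝ≥0, ∃ w' : TriangleIndex → ℝ≥0,
          perronFrobenius (stretchMap Λ c) (triangleMeasure o v w) = triangleMeasure o v w' ∧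
          ((Function.support w).Finite → (Function.support w').Finite)) ∧
        -- densities that start constant on the triangles are uniformly asymptotically Gaussian
        (∀ w : TriangleIndex → ℝ≥0, IsProbabilityMeasure (triangleMeasure o v w) →
          Tendsto (fun n : ℕ => (n : ℝ≥0∞) *
            eLpNorm (fun x =>
              density ((perronFrobenius (stretchMap Λ c))^[n] (triangleMeasure o v w)) x
                - planarGaussian (D * ‖v‖ ^ 2 * n) x) ∞ volume) atTop (𝓝 0)) ∧
        -- every initial probability density becomes asymptotically Gaussian in the mean
        (∀ μ : Measure Plane, IsProbabilityMeasure μ → μ ≪ volume →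
          (∀ n : ℕ, (perronFrobenius (stretchMap Λ c))^[n] μ ≪ volume) ∧
          Tendsto (fun n : ℕ =>
            eLpNorm (fun x =>
              density ((perronFrobenius (stretchMap Λ c))^[n] μ) x
                - planarGaussian (D * ‖v‖ ^ 2 * n) x) 1 volume) atTop (𝓝 0)) := by
  obtain ⟨D, hD, hbound⟩ := exists_uniform_bound hΛ
  refine ⟨D, hD, fun o v c hv hc => ⟨fun w => ?_, fun w hw => ?_, fun μ hμ hac => ?_⟩⟩
  · exact ⟨weightStep Λ w, perronFrobenius_triangleMeasure hv hc (by omega) w,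
      finite_support_weightStep Λ⟩
  · obtain ⟨η, hη, hb⟩ := hbound o v c hv hc w inferInstance
    refine tendsto_mul_eLpNorm_top hη fun n hn => ?_
    simpa using hb n hn
  · have hσ : 0 < D * ‖v‖ ^ 2 := mul_pos hD (pow_pos (norm_pos_iff.2 hv) 2)
    refine ⟨perronFrobenius_iterate_absolutelyContinuous hv hc (by omega) hac, ?_⟩
    have h1 := ENNReal.tendsto_ofReal (tendsto_l1Dist_density_planarGaussian hv hc
      (show 1 < Λ by omega) hσ (hbound o v c hv hc) hac)
    rw [ENNReal.ofReal_zero] at h1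
    refine h1.congr' ?_
    filter_upwards [eventually_gt_atTop 0] with n hn
    have hn0 : (0 : ℝ) < n := by exact_mod_cast hn
    have := isFiniteMeasure_perronFrobenius_iterate (stretchMap Λ c) μ n
    exact (eLpNorm_one_eq_ofReal
      ((integrable_density _).sub (integrable_planarGaussian (by positivity)))).symm
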